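/- **Conventions.** $\lambda$ is an infinite cardinal and $\mu>\lambda$ is a cardinal or $\infty$. Vocabularies may have function symbols and predicates of infinite arity, but of arity $\le\lambda$. $\|M\|$ is the cardinality of the universe $|M|$ of $M$; $\delta$ denotes a limit ordinal; $M\subseteq N$ between models means submodel. **Ess-AECs.** An *ess-$[\lambda,\mu)$-AEC* $\mathfrak k=(K,\le)$ is a class $K$ of models of a fixed vocabulary $\tau$, each of cardinality in $[\lambda,\mu)$, with a partial order $\le$ on $K$ that refines $\subseteq$, both closed under isomorphism, such that: (union) if $\langle M_i:i<\delta\rangle$ is $\le$-increasing and $|\bigcup_i M_i|<\mu$, there is a unique $M\in K$ with universe $\bigcup_i|M_i|$ and $M_i\le M$ for all $i$; if moreover $M_i\le N$ for all $i$, then $M\le N$; (coherence) if $M_1\subseteq M_2$, $M_1\le N$ and $M_2\le N$, then $M_1\le M_2$; (Löwenheim–Skolem) if $A\subseteq N\in K$ there is $M\le N$ with $A\subseteq M$ and $\|M\|\le\lambda+|A|$. Its *up-closure* consists of the models $M$ of any cardinality that are the union of a family $D$ of submodels lying in $K$ and of cardinality $\lambda$, such that every subset of $M$ of size $\le\lambda$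 is included in a member of $D$ and $N_1\subseteq N_2$ implies $N_1\le N_2$ for $N_1,N_2\in D$; there $M\le N$ iff such families $D\subseteq D'$ exist for $M$ and $N$. $\dot I(\kappa,\mathfrak k)$ is the number of isomorphism types of members of $\mathfrak k$ of cardinality $\kappa$. Embeddings are isomorphisms onto some $N''\le N'$. The orbital type $\mathrm{ortp}(a,M,N)$, for $M\le N$ and $a\in N$, is the class of $(N,a)$ under the equivalence relation generated by "some embeddings over $M$ into a common model identify the elements". **Frames.** A frame $\mathfrak s=(\mathfrak k_{\mathfrak s},\mathcal S^{\rm bs},\text{non-forking})$ consists of $\mathfrak k_{\mathfrak s}=(K_{\mathfrak s},\le)$, a set $\mathcal S^{\rm bs}(M)$ of orbital types over each $M$ (the basic ones), and a relation "$\mathrm{ortp}(a,M_1,M_3)$ does not fork over $M_0$" for $M_0\le M_1\le M_3$, $a\in M_3$. It is a *good ess-$[\lambda,\mu)$-frame* if all of the following hold. 1. $\mathfrak k_{\mathfrak s}$ is an ess-$[\lambda,\mu)$-AEC, and its up-closure $\mathfrak K[\mathfrak s]$ is an ess-$[\lambda,\infty)$-AEC. 2. In every cardinality $\chi\in[\lambda,\mu)$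 there is a superlimit model $M$: $M$ is not $\le$-maximal, every member of $K_{\mathfrak s}$ of cardinality $\chi$ embeds into $M$, and the union of an increasing chain of length $\delta<\chi^+$ of models isomorphic to $M$ is isomorphic to $M$. Also $\dot I(\lambda,\mathfrak k_{\mathfrak s})\le 2^\lambda$. 3. $\mathfrak k_{\mathfrak s}$ has amalgamation, joint embedding and no maximal model. 4. Basic types are preserved by isomorphisms and are non-algebraic; if $M<N$, some $a\in N\setminus M$ has basic $\mathrm{ortp}(a,M,N)$; $|\mathcal S^{\rm bs}(M)|\le\|M\|$. 5. Non-forking is preserved by isomorphisms; it implies $a\notin M_1$ and that $\mathrm{ortp}(a,M_0,M_3)$, $\mathrm{ortp}(a,M_1,M_3)$ are basic; for $M_0=M_1$ it says exactly that $\mathrm{ortp}(a,M_0,M_3)$ is basic. It satisfies monotonicity (decreasing $M_1$, increasing $M_0$, increasing or decreasing $M_3$), local character (if $\langle M_i:i\le\delta\rangle$ is increasing continuous, a basic type over $M_\delta$ does not fork over $M_i$ for all large $i<\delta$), transitivity, uniqueness of non-forking extensions, symmetry, existence of non-forking extensions, continuity (a type over $M_\delta$ all of whose restrictions to $M_i$,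 $i<\delta$, are basic and do not fork over $M_0$ is basic and does not fork over $M_0$), and non-forking amalgamation (if $\mathrm{ortp}(a_\ell,M_0,M_\ell)$ is basic for $\ell=1,2$, there are $M_3\ge M_0$ and embeddings $f_\ell:M_\ell\to M_3$ over $M_0$ such that $\mathrm{ortp}(f_\ell(a_\ell),f_{3-\ell}(M_{3-\ell}),M_3)$ does not fork over $M_0$ for $\ell=1,2$). Symmetry reads: if $a_1,a_2\in M_3\ge M_0$ realize basic types over $M_0$, then [there are $M_1,M_3'$ with $M_0\le M_1\le M_3'$, $M_3\le M_3'$, $a_1\in M_1$ and $\mathrm{ortp}(a_2,M_1,M_3')$ not forking over $M_0$] iff the same holds with $a_1,a_2$ exchanged. $\mathfrak s$ *has primes* if every $p\in\mathcal S^{\rm bs}(M)$ is $\mathrm{ortp}(a,M,N)$ for some $(M,N,a)$ such that whenever $\mathrm{ortp}(a',M,N')=p$ there is an embedding of $N$ into $N'$ over $M$ mapping $a$ to $a'$. A triple $(M,N,b)$ with $\mathrm{ortp}(b,M,N)$ basic is a *uniqueness triple* if for each $M'\ge M$ any two amalgamations of $N$ and $M'$ over $M$ in which the type of $b$ over $M'$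 does not fork over $M$ are equivalent over $N$ and $M'$. Types $p,q$ over $M$ are *weakly orthogonal* if $p$ has a unique extension over $N$ for every uniqueness triple $(M,N,b)$ with $b$ realizing $q$, and *orthogonal* if their non-forking extensions over each $M_1\ge M$ are weakly orthogonal. A basic type $p$ over $M$ is *regular* if, for all $N\ge M$, every $q\in\mathcal S^{\rm bs}(N)$ that extends $p$ and forks over $M$ is orthogonal to the non-forking extension of $p$ over $N$. $\mathfrak s$ *has regulars* if whenever $M<N$ some $a\in N\setminus M$ has regular $\mathrm{ortp}(a,M,N)$. **Smooth equivalence relations.** Let $\mathrm{seq}(M)$ be the set of $\bar a\in{}^\lambda M$ whose range is the universe of some $N\le M$. A *smooth equivalence relation* $\mathbb E$ for $\mathfrak s$ assigns to each $M\in K_{\mathfrak s}$ an equivalence relation $\mathbb E_M$ on a subset $\mathrm{dom}(\mathbb E_M)$ of $\mathrm{seq}(M)$ such that: $\mathbb E_{M_2}\restriction\mathrm{seq}(M_1)=\mathbb E_{M_1}$ for $M_1\le M_2$ (domains included); isomorphisms $M_1\to M_2$ carry $\mathbb E_{M_1}$ to $\mathbb E_{M_2}$; and if $\langle M_i:i\le\delta\rangle$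 is increasing continuous, every $\mathbb E_{M_\delta}$-class has a representative in $\mathrm{dom}(\mathbb E_{M_i})$ for some $i<\delta$. It is *small* if $\mathbb E_M$ has at most $\|M\|$ classes for every $M$. **The frame $\mathfrak s\langle\mathbb E\rangle$.** Add to $\tau$ a $\lambda$-place function symbol $F_*$, a constant $c_*$ and a unary predicate $P_*$. $K_{\mathfrak s\langle\mathbb E\rangle}$ consists of the models $M^*$ with a *witness* $M\in K_{\mathfrak s}$: $|M|=P_*^{M^*}$; the predicates of $\tau$ are interpreted as in $M$; the functions of $\tau$ agree with those of $M$ on tuples from $M$ and take the value $c_*$ on other tuples; $F_*$ maps $\mathrm{dom}(\mathbb E_M)$ into $|M^*|\setminus|M|\setminus\{c_*\}$, with equal values exactly on $\mathbb E_M$-equivalent sequences, and takes the value $c_*$ elsewhere; $c_*\notin|M|$, and every element of $|M^*|\setminus|M|\setminus\{c_*\}$ is a value of $F_*$ on $\mathrm{dom}(\mathbb E_M)$. Put $M^*\le N^*$ iff $M^*\subseteq N^*$ and $M\le N$ for witnesses $M,N$. The basic types over $M^*$ are the $\mathrm{ortp}(a,M^*,N^*)$, $M^*\le N^*$, with $a\in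 N\setminus M$ and $\mathrm{ortp}_{\mathfrak s}(a,M,N)\in\mathcal S^{\rm bs}_{\mathfrak s}(M)$ for the witnesses $M\le N$; non-forking in $\mathfrak s\langle\mathbb E\rangle$ is non-forking in $\mathfrak s$ between the witnesses. **Claim.** Let $\mathfrak s$ be a good ess-$[\lambda,\mu)$-frame and $\mathbb E$ a small smooth equivalence relation for $\mathfrak s$. Then: (1) $\mathfrak s\langle\mathbb E\rangle$ is a good ess-$[\lambda,\mu)$-frame; (2) for every cardinal $\kappa$, $\mathfrak s\langle\mathbb E\rangle$ and $\mathfrak s$ have the same number of isomorphism types of models of cardinality $\kappa$, both for the classes $K_{\mathfrak s\langle\mathbb E\rangle}$, $K_{\mathfrak s}$ and for their up-closures; (3) if $\mathfrak s$ has primes, so does $\mathfrak s\langle\mathbb E\rangle$; if $\mathfrak s$ has regulars, so does $\mathfrak s\langle\mathbb E\rangle$. -/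

import Mathlib

universe u

namespace EssFrame

/-! Vocabularies and models -/

/-- A vocabulary whose function symbols and predicates may have infinite arity; an arity is an
index type, and an individual constant is a function symbol with empty arity. -/
structure Vocab : Type (u + 1) where
  Fn : Type u
  Rl : Type u
  fnArity : Fn → Type u
  rlArity : Rl → Type u

/-- A model of a vocabulary. The elements of a model are sets, so that inclusion of models, unions
of chains and so on have their literal meaning. (The carrier of every member of the classes below
has fewer elements than there are sets, hence is itself a set and not a proper class.) -/
structure Model (τ : Vocab.{u}) : Type (u + 1) where
  carrier : Set ZFSet.{u}
  fn : ∀ F : τ.Fn, (τ.fnArity F → carrier) → carrier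
  rel : ∀ R : τ.Rl, (τ.rlArity R → carrier) → Prop

namespace Model

variable {τ : Vocab.{u}}

/-- The cardinality of the universe of a model, in the universe of proper classes. -/
noncomputable def card (M : Model τ) : Cardinal.{u + 1} := Cardinal.mk M.carrier

/-- The map `f` commutes with the functions and preserves the predicates in both directions. -/
def Preserves (f : ZFSet.{u} → ZFSet.{u}) (M N : Model τ) : Prop :=
  (∀ (F : τ.Fn) (a : τ.fnArity F → M.carrier) (b : τ.fnArity F → N.carrier),
    (∀ i, (b i : ZFSet.{u}) = f (a i)) → (N.fn F b : ZFSet.{u}) = f (M.fn F a)) ∧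
  (∀ (R : τ.Rl) (a : τ.rlArity R → M.carrier) (b : τ.rlArity R → N.carrier),
    (∀ i, (b i : ZFSet.{u}) = f (a i)) → (M.rel R a ↔ N.rel R b))

/-- `f`, restricted to the universe of `M`, is an isomorphism from `M` onto `N`. -/
def IsIso (f : ZFSet.{u} → ZFSet.{u}) (M N : Model τ) : Prop :=
  Set.BijOn f M.carrier N.carrier ∧ Preserves f M N

/-- Isomorphic models. -/
def Isomorphic (M N : Model τ) : Prop := ∃ f, IsIso f M N

/-- `M` is a submodel (substructure) of `N`. -/
def Sub (M N : Model τ) : Prop :=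
  M.carrier ⊆ N.carrier ∧ Preserves id M N

end Model

/-- The cardinal bound `μ`, where `⊤` stands for `∞`: then the bound is the number of all sets, so
that having fewer than `bound ⊤` elements means being a set and not a proper class. -/
noncomputable def bound : WithTop Cardinal.{u} → Cardinal.{u + 1}
  | none => Cardinal.univ.{u, u + 1}
  | some μ => Cardinal.lift.{u + 1, u} μ

/-! Essentially abstract elementary classes -/

/-- A class of models together with a two-place relation on it. -/
structure ModelClass (τ : Vocab.{u}) where
  K : Set (Model τ)
  le : Model τ → Model τ → Prop

namespace ModelClass

variable {τ : Vocab.{u}}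

/-- `⟨M i : i < δ⟩` is increasing. -/
def IncreasingBelow (k : ModelClass τ) (δ : Ordinal.{u}) (M : Ordinal.{u} → Model τ) : Prop :=
  ∀ i j, i ≤ j → j < δ → k.le (M i) (M j)

/-- `⟨M i : i ≤ δ⟩` is increasing continuous. -/
def IncreasingContinuous (k : ModelClass τ) (δ : Ordinal.{u}) (M : Ordinal.{u} → Model τ) :
    Prop :=
  (∀ i j, i ≤ j → j ≤ δ → k.le (M i) (M j)) ∧
  ∀ j, j ≤ δ → Order.IsSuccLimit j → (M j).carrier = ⋃ i ∈ Set.Iio j, (M i).carrier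

/-- `k` is an essentially `[lam, mu)`-AEC. -/
structure IsEssAEC (lam : Cardinal.{u}) (mu : WithTop Cardinal.{u}) (k : ModelClass τ) :
    Prop where
  infinite : Cardinal.aleph0 ≤ lam
  lam_lt : (lam : WithTop Cardinal.{u}) < mu
  fnArity_le : ∀ F : τ.Fn, Cardinal.mk (τ.fnArity F) ≤ lam
  rlArity_le : ∀ R : τ.Rl, Cardinal.mk (τ.rlArity R) ≤ lam
  le_mem : ∀ M N, k.le M N → M ∈ k.K ∧ N ∈ k.K
  iso_mem : ∀ f M₁ M₂, Model.IsIso f M₁ M₂ → M₁ ∈ k.K → M₂ ∈ k.K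
  iso_le : ∀ f M₁ N₁ M₂ N₂, Model.IsIso f N₁ N₂ → Model.IsIso f M₁ M₂ →
    k.le M₁ N₁ → k.le M₂ N₂
  card_ge : ∀ M ∈ k.K, Cardinal.lift.{u + 1, u} lam ≤ M.card
  card_lt : ∀ M ∈ k.K, M.card < bound mu
  refl : ∀ M ∈ k.K, k.le M M
  trans : ∀ M₁ M₂ M₃, k.le M₁ M₂ → k.le M₂ M₃ → k.le M₁ M₃
  antisymm : ∀ M₁ M₂, k.le M₁ M₂ → k.le M₂ M₁ → M₁ = M₂
  le_sub : ∀ M N, k.le M N → M.Sub N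
  union : ∀ (δ : Ordinal.{u}) (M : Ordinal.{u} → Model τ), Order.IsSuccLimit δ →
    k.IncreasingBelow δ M →
    Cardinal.mk (⋃ i ∈ Set.Iio δ, (M i).carrier : Set ZFSet.{u}) < bound mu →
    ∃! U : Model τ, U ∈ k.K ∧ U.carrier = ⋃ i ∈ Set.Iio δ, (M i).carrier ∧
      ∀ i < δ, k.le (M i) U
  union_le : ∀ (δ : Ordinal.{u}) (M : Ordinal.{u} → Model τ) (U N : Model τ),
    Order.IsSuccLimit δ → k.IncreasingBelow δ M →
    U ∈ k.K → U.carrier = ⋃ i ∈ Set.Iio δ, (M i).carrier → (∀ i < δ, k.le (M i) U) →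
    (∀ i < δ, k.le (M i) N) → k.le U N
  coherent : ∀ M₁ M₂ N, M₁.Sub M₂ → k.le M₁ N → k.le M₂ N → k.le M₁ M₂
  lowenheimSkolem : ∀ (N : Model τ) (A : Set ZFSet.{u}), N ∈ k.K → A ⊆ N.carrier →
    ∃ M, A ⊆ M.carrier ∧ k.le M N ∧
      M.card ≤ Cardinal.lift.{u + 1, u} lam + Cardinal.mk A

/-- `D` is a system of submodels of `M`, each a member of the class of cardinality `lam`, directed
by the relation of the class in such a way that `M` is its `lam⁺`-directed union. -/
def Generates (k : ModelClass τ) (lam : Cardinal.{u}) (D : Set (Model τ)) (M : Model τ) : Prop :=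
  (∀ N ∈ D, N ∈ k.K ∧ N.card = Cardinal.lift.{u + 1, u} lam ∧ N.Sub M) ∧
  (∀ A ⊆ M.carrier, Cardinal.mk A ≤ Cardinal.lift.{u + 1, u} lam →
    ∃ N ∈ D, A ⊆ N.carrier) ∧
  (∀ N₁ ∈ D, ∀ N₂ ∈ D, N₁.carrier ⊆ N₂.carrier → k.le N₁ N₂)

/-- The class of models of all cardinalities `≥ lam` generated by the models of cardinality `lam`
of the class `k`: its members are the directed unions of models of cardinality `lam`, and `M` is
below `N` if a system of submodels with union `M` is included in such a system with union `N`.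
The systems are `lam⁺`-directed because arities up to `lam` are allowed: this makes the
interpretation of the symbols in the union meaningful. -/
def up (k : ModelClass τ) (lam : Cardinal.{u}) : ModelClass τ where
  K := {M | M.card < bound ⊤ ∧ ∃ D, k.Generates lam D M}
  le M N := M.card < bound ⊤ ∧ N.card < bound ⊤ ∧
    ∃ D D' : Set (Model τ), D ⊆ D' ∧ k.Generates lam D M ∧ k.Generates lam D' N

/-- The number of isomorphism types of members of the class of cardinality `κ`. -/
noncomputable def numIso (k : ModelClass τ) (κ : Cardinal.{u}) : Cardinal.{u + 1} :=
  Cardinal.mk (Quot (fun M N : {M : Model τ //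
    M ∈ k.K ∧ M.card = Cardinal.lift.{u + 1, u} κ} => Model.Isomorphic M.1 N.1))

/-- `f` is an embedding of `N` into `N'`: an isomorphism onto some model that is below `N'`. -/
def IsEmb (k : ModelClass τ) (f : ZFSet.{u} → ZFSet.{u}) (N N' : Model τ) : Prop :=
  ∃ N'', Model.IsIso f N N'' ∧ k.le N'' N'

/-! Orbital types -/

/-- A pair `(N, a)` with `M` below `N` and `a ∈ N`. -/
structure Pointed (k : ModelClass τ) (M : Model τ) where
  N : Model τ
  a : ZFSet.{u}
  le : k.le M N
  mem : a ∈ N.carrier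

/-- `(N, a)` and `(N', a')` can be embedded over `M` into one model so that `a` and `a'` are
identified. -/
def AtomicEq (k : ModelClass τ) (M : Model τ) (x y : k.Pointed M) : Prop :=
  ∃ (L : Model τ) (f g : ZFSet.{u} → ZFSet.{u}), k.IsEmb f x.N L ∧ k.IsEmb g y.N L ∧
    (∀ z ∈ M.carrier, f z = z ∧ g z = z) ∧ f x.a = g y.a

/-- The orbital types over `M`: classes of the equivalence relation generated by `AtomicEq`. -/
def Typ (k : ModelClass τ) (M : Model τ) : Type (u + 1) := Quot (k.AtomicEq M)

/-- The orbital type of `a` over `M` in `N`. -/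
def ortp (k : ModelClass τ) {M N : Model τ} {a : ZFSet.{u}} (h : k.le M N)
    (ha : a ∈ N.carrier) : k.Typ M :=
  Quot.mk _ ⟨N, a, h, ha⟩

/-- `p` is the type of `a` over `M` in `N`. -/
def IsTypeOf (k : ModelClass τ) {M : Model τ} (p : k.Typ M) (a : ZFSet.{u}) (N : Model τ) :
    Prop :=
  ∃ (h : k.le M N) (ha : a ∈ N.carrier), p = k.ortp h ha

/-- `a` in `N` and `a'` in `N'` have the same type over `M`. -/
def SameType (k : ModelClass τ) (M : Model τ) (a : ZFSet.{u}) (N : Model τ) (a' : ZFSet.{u})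
    (N' : Model τ) : Prop :=
  ∃ p : k.Typ M, k.IsTypeOf p a N ∧ k.IsTypeOf p a' N'

/-- The type `q` over `M₁` extends the type `p` over `M₀`. -/
def Extends (k : ModelClass τ) {M₀ M₁ : Model τ} (p : k.Typ M₀) (q : k.Typ M₁) : Prop :=
  k.le M₀ M₁ ∧ ∃ a N, k.IsTypeOf q a N ∧ k.IsTypeOf p a N

/-- `M` is a superlimit model of cardinality `χ`. -/
def IsSuperlimit (k : ModelClass τ) (χ : Cardinal.{u}) (M : Model τ) : Prop :=
  M ∈ k.K ∧ M.card = Cardinal.lift.{u + 1, u} χ ∧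
  (∃ N, k.le M N ∧ M ≠ N) ∧
  (∀ N ∈ k.K, N.card = Cardinal.lift.{u + 1, u} χ → ∃ f, k.IsEmb f N M) ∧
  (∀ (δ : Ordinal.{u}) (S : Ordinal.{u} → Model τ) (U : Model τ), Order.IsSuccLimit δ →
    δ.card ≤ χ → k.IncreasingBelow δ S → (∀ i < δ, Model.Isomorphic M (S i)) →
    U ∈ k.K → U.carrier = ⋃ i ∈ Set.Iio δ, (S i).carrier → (∀ i < δ, k.le (S i) U) →
    Model.Isomorphic M U)

/-! Smooth equivalence relations -/

/-- The index set of sequences of length `lam`. -/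
abbrev Idx (lam : Cardinal.{u}) : Type u := lam.ord.ToType

/-- The sequences of length `lam` of elements of `M` whose range is the universe of a model below
`M`. -/
def seq (k : ModelClass τ) (lam : Cardinal.{u}) (M : Model τ) : Set (Idx lam → ZFSet.{u}) :=
  {a | ∃ N, k.le N M ∧ N.carrier = Set.range a}

end ModelClass

/-- A function attaching to every model a two-place relation on sequences of length `lam`. -/
abbrev SeqRel (τ : Vocab.{u}) (lam : Cardinal.{u}) : Type (u + 1) :=
  Model τ → (ModelClass.Idx lam → ZFSet.{u}) → (ModelClass.Idx lam → ZFSet.{u}) → Prop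

/-- `E` is a smooth equivalence relation for the class `k`. Each `E M` is an equivalence relation on
a subset of `seq M`, namely on its domain `{a | E M a a}`. -/
structure IsSmooth {τ : Vocab.{u}} (k : ModelClass τ) {lam : Cardinal.{u}} (E : SeqRel τ lam) :
    Prop where
  mem_seq : ∀ M ∈ k.K, ∀ a b, E M a b → a ∈ k.seq lam M ∧ b ∈ k.seq lam M
  symm : ∀ M ∈ k.K, ∀ a b, E M a b → E M b a
  trans : ∀ M ∈ k.K, ∀ a b c, E M a b → E M b c → E M a c
  restrict : ∀ M₁ M₂, k.le M₁ M₂ → ∀ a ∈ k.seq lam M₁, ∀ b ∈ k.seq lam M₁,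
    (E M₂ a b ↔ E M₁ a b)
  iso : ∀ f M₁ M₂, M₁ ∈ k.K → Model.IsIso f M₁ M₂ → ∀ a b,
    (∀ i, a i ∈ M₁.carrier) → (∀ i, b i ∈ M₁.carrier) →
    (E M₁ a b ↔ E M₂ (f ∘ a) (f ∘ b))
  continuous : ∀ (δ : Ordinal.{u}) (M : Ordinal.{u} → Model τ), Order.IsSuccLimit δ →
    k.IncreasingContinuous δ M → ∀ a, E (M δ) a a →
    ∃ i < δ, ∃ b, E (M i) b b ∧ E (M δ) a b

/-- `E` is small: `E M` has at most as many classes as `M` has elements. -/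
def IsSmall {τ : Vocab.{u}} (k : ModelClass τ) {lam : Cardinal.{u}} (E : SeqRel τ lam) : Prop :=
  ∀ M ∈ k.K, Cardinal.mk (Quot (fun a b : {a // E M a a} => E M a.1 b.1)) ≤ M.card

/-! Adding names for the classes of a smooth equivalence relation -/

/-- The two new function symbols: one with `lam` places and an individual constant. -/
inductive NewFn : Type u
  | F
  | c

/-- The expansion of `τ` by a `lam`-place function symbol, an individual constant and a unary
predicate (the predicate `none`). -/
def Vocab.expand (τ : Vocab.{u}) (lam : Cardinal.{u}) : Vocab.{u} where
  Fn := τ.Fn ⊕ NewFn.{u}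
  Rl := Option τ.Rl
  fnArity := fun
    | .inl F => τ.fnArity F
    | .inr .F => ModelClass.Idx lam
    | .inr .c => PEmpty
  rlArity := fun
    | some R => τ.rlArity R
    | none => PUnit

section Expansion

variable {τ : Vocab.{u}} {lam : Cardinal.{u}}

/-- The interpretation of the new constant. -/
def newConst (S : Model (τ.expand lam)) : S.carrier := S.fn (.inr .c) PEmpty.elim

/-- The interpretation of the new function symbol. -/
def newFun (S : Model (τ.expand lam)) (a : ModelClass.Idx lam → S.carrier) : S.carrier :=
  S.fn (.inr .F) a

/-- The interpretation of the new unary predicate. -/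
def newPred (S : Model (τ.expand lam)) : Set ZFSet.{u} :=
  {x | ∃ h : x ∈ S.carrier, S.rel none (fun _ => ⟨x, h⟩)}

/-- `M` witnesses that `S` belongs to the expanded class. -/
structure IsWitness (k : ModelClass τ) (E : SeqRel τ lam) (M : Model τ)
    (S : Model (τ.expand lam)) : Prop where
  mem : M ∈ k.K
  carrier_eq : M.carrier = newPred S
  rel_iff : ∀ (R : τ.Rl) (a : τ.rlArity R → S.carrier),
    S.rel (some R) a ↔ ∃ b : τ.rlArity R → M.carrier,
      (∀ i, (b i : ZFSet.{u}) = a i) ∧ M.rel R b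
  fn_eq : ∀ (F : τ.Fn) (a : τ.fnArity F → S.carrier) (b : τ.fnArity F → M.carrier),
    (∀ i, (b i : ZFSet.{u}) = a i) → (S.fn (.inl F) a : ZFSet.{u}) = M.fn F b
  fn_eq_const : ∀ (F : τ.Fn) (a : τ.fnArity F → S.carrier),
    (∃ i, (a i : ZFSet.{u}) ∉ M.carrier) → S.fn (.inl F) a = newConst S
  newFun_new : ∀ a : ModelClass.Idx lam → S.carrier, E M (fun i => a i) (fun i => a i) →
    (newFun S a : ZFSet.{u}) ∉ M.carrier ∧ newFun S a ≠ newConst S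
  newFun_eq_iff : ∀ a b : ModelClass.Idx lam → S.carrier,
    E M (fun i => a i) (fun i => a i) → E M (fun i => b i) (fun i => b i) →
    (newFun S a = newFun S b ↔ E M (fun i => a i) (fun i => b i))
  newFun_const : ∀ a : ModelClass.Idx lam → S.carrier, ¬ E M (fun i => a i) (fun i => a i) →
    newFun S a = newConst S
  const_notMem : (newConst S : ZFSet.{u}) ∉ M.carrier
  covered : ∀ x : S.carrier, (x : ZFSet.{u}) ∉ M.carrier → x ≠ newConst S →
    ∃ a : ModelClass.Idx lam → S.carrier, E M (fun i => a i) (fun i => a i) ∧ newFun S a = x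

/-- The class `k⟨E⟩`. -/
def ModelClass.adjoin (k : ModelClass τ) (E : SeqRel τ lam) : ModelClass (τ.expand lam) where
  K := {S | ∃ M, IsWitness k E M S}
  le S T := S.Sub T ∧ ∃ M N, IsWitness k E M S ∧ IsWitness k E N T ∧ k.le M N

end Expansion

/-! Frames -/

/-- A frame: a class of models, a set of basic types over every model, and a four-place
non-forking relation `nf M₀ M₁ a M₃`, which says that the type of `a` over `M₁` in `M₃` does not
fork over `M₀`. -/
structure Frame (τ : Vocab.{u}) where
  k : ModelClass τ
  bs : ∀ M, Set (k.Typ M)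
  nf : Model τ → Model τ → ZFSet.{u} → Model τ → Prop

namespace Frame

variable {τ : Vocab.{u}}

/-- `M` is below `N`, `a ∈ N` and the type of `a` over `M` in `N` is basic. -/
def IsBasic (s : Frame τ) (M N : Model τ) (a : ZFSet.{u}) : Prop :=
  ∃ (h : s.k.le M N) (ha : a ∈ N.carrier), s.k.ortp h ha ∈ s.bs M

/-- `s` is a good ess-`[lam, mu)`-frame. -/
structure IsGood (lam : Cardinal.{u}) (mu : WithTop Cardinal.{u}) (s : Frame τ) : Prop where
  essAEC : s.k.IsEssAEC lam mu
  essAEC_up : (s.k.up lam).IsEssAEC lam ⊤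
  superlimit : ∀ χ : Cardinal.{u}, lam ≤ χ → (χ : WithTop Cardinal.{u}) < mu →
    ∃ M, s.k.IsSuperlimit χ M
  numIso_le : s.k.numIso lam ≤ Cardinal.lift.{u + 1, u} (2 ^ lam)
  amalgamation : ∀ M₀ M₁ M₂, s.k.le M₀ M₁ → s.k.le M₀ M₂ → ∃ M₃ f₁ f₂,
    s.k.IsEmb f₁ M₁ M₃ ∧ s.k.IsEmb f₂ M₂ M₃ ∧ ∀ x ∈ M₀.carrier, f₁ x = x ∧ f₂ x = x
  jointEmbedding : ∀ M₁ ∈ s.k.K, ∀ M₂ ∈ s.k.K, ∃ M₃ f₁ f₂,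
    s.k.IsEmb f₁ M₁ M₃ ∧ s.k.IsEmb f₂ M₂ M₃
  no_maximal : ∀ M ∈ s.k.K, ∃ N, s.k.le M N ∧ M ≠ N
  bs_iso : ∀ f M N M' N' a, Model.IsIso f N N' → Model.IsIso f M M' →
    s.IsBasic M N a → s.IsBasic M' N' (f a)
  bs_nonalgebraic : ∀ M N a, s.IsBasic M N a → a ∉ M.carrier
  bs_density : ∀ M N, s.k.le M N → M ≠ N →
    ∃ a ∈ N.carrier, a ∉ M.carrier ∧ s.IsBasic M N a
  bs_stability : ∀ M ∈ s.k.K, Cardinal.mk (s.bs M) ≤ M.card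
  nf_basic : ∀ M₀ M₁ a M₃, s.nf M₀ M₁ a M₃ → s.k.le M₀ M₁ ∧ s.k.le M₁ M₃ ∧
    a ∈ M₃.carrier ∧ a ∉ M₁.carrier ∧ s.IsBasic M₀ M₃ a ∧ s.IsBasic M₁ M₃ a
  nf_iso : ∀ f M₀ M₁ a M₃ M₀' M₁' M₃', Model.IsIso f M₃ M₃' → Model.IsIso f M₁ M₁' →
    Model.IsIso f M₀ M₀' → s.nf M₀ M₁ a M₃ → s.nf M₀' M₁' (f a) M₃'
  nf_self : ∀ M₀ a M₃, s.k.le M₀ M₃ → a ∈ M₃.carrier →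
    (s.nf M₀ M₀ a M₃ ↔ s.IsBasic M₀ M₃ a)
  nf_mono : ∀ M₀ M₀' M₁' M₁ M₃ M₃' M₃'' a, s.k.le M₀ M₀' → s.k.le M₀' M₁' →
    s.k.le M₁' M₁ → s.k.le M₁ M₃ → s.k.le M₃ M₃' → s.k.le M₃'' M₃' →
    M₁.carrier ∪ {a} ⊆ M₃''.carrier → s.nf M₀ M₁ a M₃ →
    s.nf M₀' M₁' a M₃' ∧ s.nf M₀' M₁' a M₃''
  nf_localChar : ∀ (δ : Ordinal.{u}) (M : Ordinal.{u} → Model τ) N a, Order.IsSuccLimit δ →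
    s.k.IncreasingContinuous δ M → s.IsBasic (M δ) N a →
    ∃ i < δ, ∀ j, i ≤ j → j < δ → s.nf (M j) (M δ) a N
  nf_trans : ∀ M₀ M₀' M₀'' M₃ a, s.k.le M₀ M₀' → s.k.le M₀' M₀'' → s.k.le M₀'' M₃ →
    s.nf M₀' M₀'' a M₃ → s.nf M₀ M₀' a M₃ → s.nf M₀ M₀'' a M₃
  nf_unique : ∀ M₀ M₁ a N a' N', s.nf M₀ M₁ a N → s.nf M₀ M₁ a' N' →
    s.k.SameType M₀ a N a' N' → s.k.SameType M₁ a N a' N'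
  nf_symm : ∀ M₀ M₃ a₁ a₂, s.IsBasic M₀ M₃ a₁ → s.IsBasic M₀ M₃ a₂ →
    ((∃ M₁ M₃', s.k.le M₀ M₁ ∧ s.k.le M₁ M₃' ∧ a₁ ∈ M₁.carrier ∧ s.k.le M₃ M₃' ∧
        s.nf M₀ M₁ a₂ M₃') ↔
      (∃ M₂ M₃', s.k.le M₀ M₂ ∧ s.k.le M₂ M₃' ∧ a₂ ∈ M₂.carrier ∧ s.k.le M₃ M₃' ∧
        s.nf M₀ M₂ a₁ M₃'))
  nf_extension : ∀ M N a L, s.k.le M N → s.IsBasic M L a →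
    ∃ b L', s.nf M N b L' ∧ s.k.SameType M a L b L'
  nf_continuity : ∀ (δ : Ordinal.{u}) (M : Ordinal.{u} → Model τ) N a, Order.IsSuccLimit δ →
    s.k.IncreasingContinuous δ M → s.k.le (M δ) N → a ∈ N.carrier →
    (∀ i < δ, s.nf (M 0) (M i) a N) → s.nf (M 0) (M δ) a N
  nf_amalgamation : ∀ M₀ M₁ M₂ a₁ a₂, s.IsBasic M₀ M₁ a₁ → s.IsBasic M₀ M₂ a₂ →
    ∃ M₃ N₁ N₂ f₁ f₂, s.k.le M₀ M₃ ∧ Model.IsIso f₁ M₁ N₁ ∧ Model.IsIso f₂ M₂ N₂ ∧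
      s.k.le N₁ M₃ ∧ s.k.le N₂ M₃ ∧ (∀ x ∈ M₀.carrier, f₁ x = x ∧ f₂ x = x) ∧
      s.nf M₀ N₂ (f₁ a₁) M₃ ∧ s.nf M₀ N₁ (f₂ a₂) M₃

/-! Primes -/

/-- `(M, N, a)` is a prime triple. -/
def IsPrimeTriple (s : Frame τ) (M N : Model τ) (a : ZFSet.{u}) : Prop :=
  s.IsBasic M N a ∧ ∀ N' a', s.IsBasic M N' a' → s.k.SameType M a N a' N' →
    ∃ f, s.k.IsEmb f N N' ∧ (∀ x ∈ M.carrier, f x = x) ∧ f a = a'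

/-- Every basic type is realized in a prime triple. -/
def HasPrimes (s : Frame τ) : Prop :=
  ∀ M ∈ s.k.K, ∀ p ∈ s.bs M, ∃ N a, s.k.IsTypeOf p a N ∧ s.IsPrimeTriple M N a

/-! Regular types -/

/-- The type `q` does not fork over `M₀`. -/
def DoesNotFork (s : Frame τ) (M₀ : Model τ) {M₁ : Model τ} (q : s.k.Typ M₁) : Prop :=
  ∃ a N, s.k.IsTypeOf q a N ∧ s.nf M₀ M₁ a N

/-- `(M, N, a)` is a uniqueness triple: for every `M'` above `M`, any two amalgamations of `N` and
`M'` over `M` in which the type of (the image of) `a` over `M'` does not fork over `M` are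
equivalent over `N` and `M'`. -/
def IsUniqTriple (s : Frame τ) (M N : Model τ) (a : ZFSet.{u}) : Prop :=
  s.IsBasic M N a ∧ ∀ (M' N₁ N₂ : Model τ) (f₁ f₂ : ZFSet.{u} → ZFSet.{u}),
    s.k.le M M' → s.k.le M' N₁ → s.k.le M' N₂ →
    s.k.IsEmb f₁ N N₁ → s.k.IsEmb f₂ N N₂ → (∀ x ∈ M.carrier, f₁ x = x ∧ f₂ x = x) →
    s.nf M M' (f₁ a) N₁ → s.nf M M' (f₂ a) N₂ →
    ∃ L g₁ g₂, s.k.IsEmb g₁ N₁ L ∧ s.k.IsEmb g₂ N₂ L ∧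
      (∀ x ∈ M'.carrier, g₁ x = x ∧ g₂ x = x) ∧ ∀ x ∈ N.carrier, g₁ (f₁ x) = g₂ (f₂ x)

/-- `p` and `q` are weakly orthogonal: `p` has a unique extension over `N` whenever `(M, N, b)` is a
uniqueness triple with `b` realizing `q`. -/
def WeaklyOrthogonal (s : Frame τ) {M : Model τ} (p q : s.k.Typ M) : Prop :=
  ∀ N b, s.IsUniqTriple M N b → s.k.IsTypeOf q b N → ∃! r : s.k.Typ N, s.k.Extends p r

/-- `p` and `q` are orthogonal: their non-forking extensions over any model above are weakly
orthogonal. -/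
def Orthogonal (s : Frame τ) {M : Model τ} (p q : s.k.Typ M) : Prop :=
  ∀ (M₁ : Model τ) (p₁ q₁ : s.k.Typ M₁), s.k.le M M₁ →
    s.k.Extends p p₁ → s.DoesNotFork M p₁ → s.k.Extends q q₁ → s.DoesNotFork M q₁ →
    s.WeaklyOrthogonal p₁ q₁

/-- The basic type `p` is regular: every basic forking extension of `p` is orthogonal to (the
non-forking extension of) `p`. -/
def IsRegular (s : Frame τ) {M : Model τ} (p : s.k.Typ M) : Prop :=
  p ∈ s.bs M ∧ ∀ (N : Model τ) (q p' : s.k.Typ N), s.k.le M N → q ∈ s.bs N →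
    s.k.Extends p q → ¬ s.DoesNotFork M q → s.k.Extends p p' → s.DoesNotFork M p' →
    s.Orthogonal q p'

/-- Regular types are dense: every proper extension contains a new element with a regular type. -/
def HasRegulars (s : Frame τ) : Prop :=
  ∀ M N, s.k.le M N → M ≠ N → ∃ a ∈ N.carrier, a ∉ M.carrier ∧
    ∃ p : s.k.Typ M, s.k.IsTypeOf p a N ∧ s.IsRegular p

/-! The frame `s⟨E⟩` -/

/-- The frame `s⟨E⟩`: basic types and non-forking are those of the witnesses. -/
def adjoin {lam : Cardinal.{u}} (s : Frame τ) (E : SeqRel τ lam) : Frame (τ.expand lam) where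
  k := s.k.adjoin E
  bs S := {p | ∃ T a, (s.k.adjoin E).IsTypeOf p a T ∧
    ∃ M N, IsWitness s.k E M S ∧ IsWitness s.k E N T ∧ s.k.le M N ∧
      a ∉ M.carrier ∧ s.IsBasic M N a}
  nf S₀ S₁ a S₃ := (s.k.adjoin E).le S₀ S₁ ∧ (s.k.adjoin E).le S₁ S₃ ∧
    ∃ M₀ M₁ M₃, IsWitness s.k E M₀ S₀ ∧ IsWitness s.k E M₁ S₁ ∧ IsWitness s.k E M₃ S₃ ∧
      s.nf M₀ M₁ a M₃

end Frame

end EssFrame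

namespace EssFrame
open Cardinal

/-! Small sets of sets and fresh names -/

/-! An expansion of a model `M` contains no information beyond `M`, the value of the new constant
and an injective naming of the `E M`-classes. This is `IsWitness.eq_expandModel`, where
`expandModel` is the explicit expansion and `Naming` the condition on the names. The witness is
recovered from the expansion (`IsWitness.unique`), and isomorphisms and embeddings pass in both
directions between expansions and witnesses (`IsWitness.isIso`, `IsWitness.exists_isIso`,
`IsWitness.isEmb`, `IsWitness.exists_isEmb`). So each property of the frame is proved for the
witnesses and then lifted.

Lifting has two directions. Downwards, a model below the witness of `T` has exactly one expansion
below `T`, namely `restr`. Upwards, an expansion `S` of `M` extends to an expansion of `N` above `M`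
as soon as `N` contains none of the new elements of `S`; this can always be arranged by replacing
`N` by a copy over `M` (`IsWitness.exists_lift_copy`). A map that fixes `M` then fixes `S`, since
the new elements are values of functions at tuples from `M` (`IsWitness.fix`).

The hypotheses on `E` enter as follows. Compatibility with restriction makes names of classes
persist to larger models, invariance makes isomorphisms lift, and smallness keeps the cardinality.
Continuity gives each class over the union of a chain a representative at an earlier stage, so that
the union of the expansions names all the classes over the union of the witnesses. Hence
`adjoin_isEssAEC` and `numIso_adjoin`.

For the up-closure, `E` extends to `upRel`, decided in submodels of cardinality `lam`. It is again
smooth and small, and adding names commutes with the up-closure (`up_adjoin`), so the same two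
theorems apply to the up-closure of the original class.

By amalgamation two types are equal iff a single common extension identifies the realizations
(`ModelClass.Amalgamates.ortp_eq_iff`). Therefore types over `S` of elements of a witness correspond
to types over `M` (`TypeCorr`), and basic types, non-forking, primes and regularity follow. For
regularity only one direction is needed for uniqueness triples: those of the expanded frame restrict
to the witnesses, and weak orthogonality is a universal statement about such triples. -/

theorem not_small_zfset : ¬ Small.{u} ZFSet.{u} := by
  intro h
  have h1 : ∀ x : ZFSet.{u}, x ∈ ZFSet.range (fun y : ZFSet.{u} => y) := fun x => by simp
  exact ZFSet.mem_irrefl _ (h1 _)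

theorem small_iff_mk_lt {α : Type (u + 1)} : Small.{u} α ↔ #α < univ.{u, u + 1} := by
  have := small_iff_lift_mk_lt_univ (α := α)
  rwa [lift_id] at this

/-- The complement of a set inside the proper class of all sets is a proper class, hence large
enough to receive any small type injectively. -/
theorem exists_fresh {α : Type (u + 1)} [Small.{u} α] (X : Set ZFSet.{u}) [Small.{u} X] :
    ∃ g : α → ZFSet.{u}, Function.Injective g ∧ ∀ a, g a ∉ X := by
  have hX : ¬ Small.{u} (Xᶜ : Set ZFSet.{u}) := by
    intro h
    apply not_small_zfset.{u}
    have : Small.{u} (X ∪ Xᶜ : Set ZFSet.{u}) := inferInstance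
    rw [Set.union_compl_self] at this
    exact small_univ_iff.1 this
  rw [small_iff_mk_lt, not_lt] at hX
  have hle : #α ≤ #(Xᶜ : Set ZFSet.{u}) := (small_iff_mk_lt.1 inferInstance).le.trans hX
  obtain ⟨e⟩ := hle
  exact ⟨fun a => (e a).1, fun a b h => e.injective (Subtype.ext h), fun a => (e a).2⟩

/-- Source of copies of a model over a submodel. The fresh values are kept off `C` as well as off
`X`, since otherwise injectivity could fail against the fixed elements. -/
theorem exists_rename (C Y X : Set ZFSet.{u}) [Small.{u} Y] [Small.{u} X] [Small.{u} C] :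
    ∃ f : ZFSet.{u} → ZFSet.{u}, Set.InjOn f Y ∧ (∀ x ∈ C, f x = x) ∧
      ∀ x ∈ Y, x ∉ C → f x ∉ X := by
  classical
  obtain ⟨g, hg, hgX⟩ := exists_fresh (α := Y) (X ∪ C)
  refine ⟨fun x => if h : x ∈ Y ∧ x ∉ C then g ⟨x, h.1⟩ else x, ?_, ?_, ?_⟩
  · intro x hx y hy hxy
    by_cases h1 : x ∈ C <;> by_cases h2 : y ∈ C
    · simpa [h1, h2] using hxy
    · simp only [h1, h2, hy, not_true_eq_false, and_false, dite_false, not_false_eq_true,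
        and_self, dite_true] at hxy
      exact (hgX ⟨y, hy⟩ (Or.inr (hxy ▸ h1))).elim
    · simp only [h1, h2, hx, not_true_eq_false, and_false, dite_false, not_false_eq_true,
        and_self, dite_true] at hxy
      exact (hgX ⟨x, hx⟩ (Or.inr (hxy ▸ h2))).elim
    · simp only [h1, h2, hx, hy, not_false_eq_true, and_self, dite_true] at hxy
      simpa using hg hxy
  · intro x hx
    simp [hx]
  · intro x hx hC
    simp only [hx, hC, not_false_eq_true, and_self, dite_true]
    exact fun h => hgX _ (Or.inl h)

theorem bound_le_univ (mu : WithTop Cardinal.{u}) : bound mu ≤ univ.{u, u + 1} := by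
  cases mu with
  | top => exact le_rfl
  | coe a => exact (lift_lt_univ a).le

/-! ### Models described by raw tuples of sets; submodels and isomorphisms. -/

namespace Model

variable {τ : Vocab.{u}}

open Classical in
/-- The value of a function of `M` at a tuple of sets; junk if the tuple is not from `M`. -/
noncomputable def ev (M : Model τ) (F : τ.Fn) (a : τ.fnArity F → ZFSet.{u}) : ZFSet.{u} :=
  if h : ∀ i, a i ∈ M.carrier then M.fn F (fun i => ⟨a i, h i⟩) else ∅

/-- The tuple `a` of sets is from `M` and satisfies the predicate `R`. -/
def holds (M : Model τ) (R : τ.Rl) (a : τ.rlArity R → ZFSet.{u}) : Prop :=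
  ∃ h : ∀ i, a i ∈ M.carrier, M.rel R (fun i => ⟨a i, h i⟩)

theorem ev_coe (M : Model τ) (F : τ.Fn) (a : τ.fnArity F → M.carrier) :
    M.ev F (fun i => a i) = M.fn F a := by
  rw [ev, dif_pos fun i => (a i).2]

theorem holds_coe (M : Model τ) (R : τ.Rl) (a : τ.rlArity R → M.carrier) :
    M.holds R (fun i => a i) ↔ M.rel R a :=
  ⟨fun ⟨_, h⟩ => h, fun h => ⟨fun i => (a i).2, h⟩⟩

theorem ev_mem (M : Model τ) (F : τ.Fn) {a : τ.fnArity F → ZFSet.{u}}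
    (h : ∀ i, a i ∈ M.carrier) : M.ev F a ∈ M.carrier := by
  rw [ev, dif_pos h]; exact Subtype.coe_prop _

/-- When `f` maps `M` into `N`, the second tuple in `Preserves` is determined by the first, so it
can be eliminated together with the subtype coercions. -/
theorem preserves_iff {f : ZFSet.{u} → ZFSet.{u}} {M N : Model τ}
    (hf : Set.MapsTo f M.carrier N.carrier) :
    Preserves f M N ↔
      (∀ F (a : τ.fnArity F → ZFSet.{u}), (∀ i, a i ∈ M.carrier) →
        N.ev F (fun i => f (a i)) = f (M.ev F a)) ∧
      (∀ R (a : τ.rlArity R → ZFSet.{u}), (∀ i, a i ∈ M.carrier) →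
        (M.holds R a ↔ N.holds R (fun i => f (a i)))) := by
  constructor
  · rintro ⟨h1, h2⟩
    refine ⟨fun F a ha => ?_, fun R a ha => ?_⟩
    · have := h1 F (fun i => ⟨a i, ha i⟩) (fun i => ⟨f (a i), hf (ha i)⟩) (fun i => rfl)
      rw [← ev_coe, ← ev_coe] at this
      exact this
    · have := h2 R (fun i => ⟨a i, ha i⟩) (fun i => ⟨f (a i), hf (ha i)⟩) (fun i => rfl)
      rw [← holds_coe, ← holds_coe] at this
      exact this
  · rintro ⟨h1, h2⟩
    refine ⟨fun F a b hab => ?_, fun R a b hab => ?_⟩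
    · have := h1 F (fun i => a i) (fun i => (a i).2)
      rw [← ev_coe, ← ev_coe, funext hab]
      exact this
    · have := h2 R (fun i => a i) (fun i => (a i).2)
      rw [← holds_coe, ← holds_coe, funext hab]
      exact this

theorem sub_iff {M N : Model τ} : M.Sub N ↔ M.carrier ⊆ N.carrier ∧
      (∀ F (a : τ.fnArity F → ZFSet.{u}), (∀ i, a i ∈ M.carrier) → N.ev F a = M.ev F a) ∧
      (∀ R (a : τ.rlArity R → ZFSet.{u}), (∀ i, a i ∈ M.carrier) →
        (M.holds R a ↔ N.holds R a)) := by
  constructor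
  · rintro ⟨h, h'⟩
    exact ⟨h, (preserves_iff (f := id) (fun x hx => h hx)).1 h'⟩
  · rintro ⟨h, h'⟩
    exact ⟨h, (preserves_iff (f := id) (fun x hx => h hx)).2 h'⟩

theorem ext_ev {M N : Model τ} (hc : M.carrier = N.carrier)
    (hF : ∀ F (a : τ.fnArity F → ZFSet.{u}), (∀ i, a i ∈ M.carrier) → N.ev F a = M.ev F a)
    (hR : ∀ R (a : τ.rlArity R → ZFSet.{u}), (∀ i, a i ∈ M.carrier) →
        (M.holds R a ↔ N.holds R a)) : M = N := by
  obtain ⟨C, f, r⟩ := M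
  obtain ⟨C', f', r'⟩ := N
  obtain rfl : C = C' := hc
  congr 1
  · funext F a
    have := hF F (fun i => a i) (fun i => (a i).2)
    rw [ev_coe ⟨C, f', r'⟩ F a, ev_coe ⟨C, f, r⟩ F a] at this
    exact Subtype.ext this.symm
  · funext R a
    have := hR R (fun i => a i) (fun i => (a i).2)
    rw [holds_coe ⟨C, f', r'⟩ R a, holds_coe ⟨C, f, r⟩ R a] at this
    exact propext this

/-- The usual way below to prove models equal: compare them as submodels, then compare universes. -/
theorem Sub.eq_of_subset {M N : Model τ} (h : M.Sub N) (h' : N.carrier ⊆ M.carrier) : M = N := by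
  obtain ⟨h1, h2, h3⟩ := sub_iff.1 h
  exact ext_ev (h1.antisymm h') h2 h3

theorem Sub.refl (M : Model τ) : M.Sub M :=
  sub_iff.2 ⟨subset_rfl, fun _ _ _ => rfl, fun _ _ _ => Iff.rfl⟩

theorem Sub.trans {M N L : Model τ} (h : M.Sub N) (h' : N.Sub L) : M.Sub L := by
  rw [sub_iff] at *
  exact ⟨h.1.trans h'.1, fun F a ha => (h'.2.1 F a fun i => h.1 (ha i)).trans (h.2.1 F a ha),
    fun R a ha => (h.2.2 R a ha).trans (h'.2.2 R a fun i => h.1 (ha i))⟩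

theorem Sub.of_subset {M N L : Model τ} (h : M.Sub L) (h' : N.Sub L)
    (hc : M.carrier ⊆ N.carrier) : M.Sub N := by
  rw [sub_iff] at *
  exact ⟨hc, fun F a ha => (h'.2.1 F a fun i => hc (ha i)).symm.trans (h.2.1 F a ha),
    fun R a ha => (h.2.2 R a ha).trans (h'.2.2 R a fun i => hc (ha i)).symm⟩

theorem isIso_iff {f : ZFSet.{u} → ZFSet.{u}} {M N : Model τ} : IsIso f M N ↔
      Set.BijOn f M.carrier N.carrier ∧
      (∀ F (a : τ.fnArity F → ZFSet.{u}), (∀ i, a i ∈ M.carrier) →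
        N.ev F (fun i => f (a i)) = f (M.ev F a)) ∧
      (∀ R (a : τ.rlArity R → ZFSet.{u}), (∀ i, a i ∈ M.carrier) →
        (M.holds R a ↔ N.holds R (fun i => f (a i)))) :=
  ⟨fun h => ⟨h.1, (preserves_iff h.1.mapsTo).1 h.2⟩,
    fun h => ⟨h.1, (preserves_iff h.1.mapsTo).2 h.2⟩⟩

theorem IsIso.mapsTo {f : ZFSet.{u} → ZFSet.{u}} {M N : Model τ} (h : IsIso f M N) {x : ZFSet.{u}}
    (hx : x ∈ M.carrier) : f x ∈ N.carrier := h.1.mapsTo hx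

theorem IsIso.congr {f g : ZFSet.{u} → ZFSet.{u}} {M N : Model τ} (h : IsIso f M N)
    (hfg : ∀ x ∈ M.carrier, g x = f x) : IsIso g M N := by
  rw [isIso_iff] at *
  refine ⟨h.1.congr fun x hx => (hfg x hx).symm, fun F a ha => ?_, fun R a ha => ?_⟩
  · rw [hfg _ (M.ev_mem F ha), ← h.2.1 F a ha]
    congr 1; funext i; exact hfg _ (ha i)
  · rw [h.2.2 R a ha]
    have : (fun i => g (a i)) = fun i => f (a i) := funext fun i => hfg _ (ha i)
    rw [this]

theorem IsIso.refl (M : Model τ) : IsIso id M M :=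
  isIso_iff.2 ⟨Set.bijOn_id _, fun _ _ _ => rfl, fun _ _ _ => Iff.rfl⟩

theorem IsIso.of_fix {f : ZFSet.{u} → ZFSet.{u}} {M : Model τ} (h : ∀ x ∈ M.carrier, f x = x) :
    IsIso f M M := (IsIso.refl M).congr h

theorem IsIso.comp {f g : ZFSet.{u} → ZFSet.{u}} {M N L : Model τ} (hg : IsIso g N L)
    (hf : IsIso f M N) : IsIso (g ∘ f) M L := by
  rw [isIso_iff] at *
  refine ⟨hg.1.comp hf.1, fun F a ha => ?_, fun R a ha => ?_⟩
  · have := hg.2.1 F (fun i => f (a i)) (fun i => hf.1.mapsTo (ha i))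
    rw [hf.2.1 F a ha] at this
    exact this
  · exact (hf.2.2 R a ha).trans (hg.2.2 R _ fun i => hf.1.mapsTo (ha i))

theorem IsIso.inv {f : ZFSet.{u} → ZFSet.{u}} {M N : Model τ} (hf : IsIso f M N) :
    IsIso (Function.invFunOn f M.carrier) N M := by
  have hinv := hf.1.invOn_invFunOn
  have hbij : Set.BijOn (Function.invFunOn f M.carrier) N.carrier M.carrier :=
    hf.1.symm hinv.symm
  rw [isIso_iff] at *
  refine ⟨hbij, fun F a ha => ?_, fun R a ha => ?_⟩
  · have := hf.2.1 F (fun i => Function.invFunOn f M.carrier (a i))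
      (fun i => hbij.mapsTo (ha i))
    have h2 : (fun i => f (Function.invFunOn f M.carrier (a i))) = a :=
      funext fun i => hinv.2 (ha i)
    rw [h2] at this
    rw [this]
    exact (hinv.1 (M.ev_mem F fun i => hbij.mapsTo (ha i))).symm
  · have := hf.2.2 R (fun i => Function.invFunOn f M.carrier (a i))
      (fun i => hbij.mapsTo (ha i))
    have h2 : (fun i => f (Function.invFunOn f M.carrier (a i))) = a :=
      funext fun i => hinv.2 (ha i)
    rw [h2] at this
    exact this.symm

theorem IsIso.inv_apply {f : ZFSet.{u} → ZFSet.{u}} {M N : Model τ} (hf : IsIso f M N)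
    {x : ZFSet.{u}} (hx : x ∈ M.carrier) : Function.invFunOn f M.carrier (f x) = x :=
  hf.1.invOn_invFunOn.1 hx

theorem IsIso.apply_inv {f : ZFSet.{u} → ZFSet.{u}} {M N : Model τ} (hf : IsIso f M N)
    {x : ZFSet.{u}} (hx : x ∈ N.carrier) : f (Function.invFunOn f M.carrier x) = x :=
  hf.1.invOn_invFunOn.2 hx

theorem IsIso.card_eq {f : ZFSet.{u} → ZFSet.{u}} {M N : Model τ} (hf : IsIso f M N) :
    M.card = N.card :=
  Cardinal.mk_congr (Set.BijOn.equiv f hf.1)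

/-- The model with a given universe, given functions and given predicates. -/
def ofEv (C : Set ZFSet.{u}) (e : ∀ F : τ.Fn, (τ.fnArity F → ZFSet.{u}) → ZFSet.{u})
    (he : ∀ F a, (∀ i, a i ∈ C) → e F a ∈ C)
    (r : ∀ R : τ.Rl, (τ.rlArity R → ZFSet.{u}) → Prop) : Model τ where
  carrier := C
  fn F a := ⟨e F fun i => a i, he F _ fun i => (a i).2⟩
  rel R a := r R fun i => a i

section ofEv
variable {C : Set ZFSet.{u}} {e : ∀ F : τ.Fn, (τ.fnArity F → ZFSet.{u}) → ZFSet.{u}}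
    {he : ∀ F a, (∀ i, a i ∈ C) → e F a ∈ C}
    {r : ∀ R : τ.Rl, (τ.rlArity R → ZFSet.{u}) → Prop}

theorem ofEv_ev {F : τ.Fn} {a : τ.fnArity F → ZFSet.{u}} (ha : ∀ i, a i ∈ C) :
    (ofEv C e he r).ev F a = e F a := by
  exact (dif_pos ha).trans rfl

theorem ofEv_holds {R : τ.Rl} {a : τ.rlArity R → ZFSet.{u}} (ha : ∀ i, a i ∈ C) :
    (ofEv C e he r).holds R a ↔ r R a :=
  ⟨fun ⟨_, h⟩ => h, fun h => ⟨ha, h⟩⟩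

end ofEv

/-- The image of a model under a map. -/
noncomputable def map (f : ZFSet.{u} → ZFSet.{u}) (M : Model τ) : Model τ :=
  ofEv (f '' M.carrier)
    (fun F a => f (M.ev F fun i => Function.invFunOn f M.carrier (a i)))
    (fun F _ ha => Set.mem_image_of_mem f (M.ev_mem F fun i => Function.invFunOn_mem (ha i)))
    (fun R a => M.holds R fun i => Function.invFunOn f M.carrier (a i))

theorem isIso_map {f : ZFSet.{u} → ZFSet.{u}} {M : Model τ} (hf : Set.InjOn f M.carrier) :
    IsIso f M (M.map f) := by
  have key : ∀ x ∈ M.carrier, Function.invFunOn f M.carrier (f x) = x :=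
    fun x hx => hf.leftInvOn_invFunOn hx
  refine isIso_iff.2 ⟨hf.bijOn_image, fun F a ha => ?_, fun R a ha => ?_⟩
  · rw [map, ofEv_ev fun i => Set.mem_image_of_mem f (ha i)]
    congr 2; funext i; exact key _ (ha i)
  · rw [map, ofEv_holds fun i => Set.mem_image_of_mem f (ha i)]
    have : (fun i => Function.invFunOn f M.carrier (f (a i))) = a := funext fun i => key _ (ha i)
    rw [this]

theorem IsIso.sub {f : ZFSet.{u} → ZFSet.{u}} {M N M' N' : Model τ} (h : IsIso f N N')
    (h' : IsIso f M M') (hs : M.Sub N) : M'.Sub N' := by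
  have hsub := hs.1
  have key : ∀ x ∈ M'.carrier, f (Function.invFunOn f M.carrier x) = x :=
    fun x hx => h'.apply_inv hx
  have hin : ∀ x ∈ M'.carrier, Function.invFunOn f M.carrier x ∈ M.carrier :=
    fun x hx => h'.inv.mapsTo hx
  rw [isIso_iff] at h h'
  rw [sub_iff] at hs ⊢
  refine ⟨fun x hx => ?_, fun F a ha => ?_, fun R a ha => ?_⟩
  · rw [← key x hx]; exact h.1.mapsTo (hsub (hin x hx))
  · have e1 := h.2.1 F _ (fun i => hsub (hin _ (ha i)))
    have e2 := h'.2.1 F _ (fun i => hin _ (ha i))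
    rw [funext fun i => key _ (ha i)] at e1 e2
    rw [e1, e2, hs.2.1 F _ fun i => hin _ (ha i)]
  · have e1 := h.2.2 R _ (fun i => hsub (hin _ (ha i)))
    have e2 := h'.2.2 R _ (fun i => hin _ (ha i))
    rw [funext fun i => key _ (ha i)] at e1 e2
    rw [← e1, ← e2, hs.2.2 R _ fun i => hin _ (ha i)]

/-- An isomorphism restricts to submodels. -/
theorem IsIso.restrict_map {f : ZFSet.{u} → ZFSet.{u}} {M N M' : Model τ} (h : IsIso f M N)
    (hs : M'.Sub M) : IsIso f M' (M'.map f) :=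
  isIso_map (h.1.injOn.mono hs.1)

theorem IsIso.unique {f : ZFSet.{u} → ZFSet.{u}} {M N N' : Model τ} (h : IsIso f M N)
    (h' : IsIso f M N') : N = N' :=
  (IsIso.sub h' h (Sub.refl M)).eq_of_subset (h.1.image_eq ▸ h'.1.image_eq.symm.subset)

end Model

/-! ### The expanded vocabulary on raw tuples, and the explicit expansion. -/

section Untyped

variable {τ : Vocab.{u}} {lam : Cardinal.{u}}

/-- The new constant, as a set. -/
noncomputable def cst (S : Model (τ.expand lam)) : ZFSet.{u} := newConst S

/-- The new function, on tuples of sets. -/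
noncomputable def nameOf (S : Model (τ.expand lam)) (a : ModelClass.Idx lam → ZFSet.{u}) :
    ZFSet.{u} := S.ev (.inr .F) a

/-- The old functions, on tuples of sets. -/
noncomputable def oldEv (S : Model (τ.expand lam)) (F : τ.Fn) (a : τ.fnArity F → ZFSet.{u}) :
    ZFSet.{u} := S.ev (.inl F) a

/-- The old predicates, on tuples of sets. -/
def oldHolds (S : Model (τ.expand lam)) (R : τ.Rl) (a : τ.rlArity R → ZFSet.{u}) : Prop :=
  S.holds (some R) a

theorem cst_mem (S : Model (τ.expand lam)) : cst S ∈ S.carrier := (newConst S).2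

theorem ev_const (S : Model (τ.expand lam)) (a : PEmpty.{u + 1} → ZFSet.{u}) :
    S.ev (.inr .c) a = cst S := by
  have h : ∀ i, a i ∈ S.carrier := fun i => i.elim
  have : S.ev (.inr .c) a = S.fn (.inr .c) fun i => ⟨a i, h i⟩ := dif_pos h
  rw [this, cst, newConst]
  congr 2
  funext i
  exact i.elim

theorem coe_oldFn (S : Model (τ.expand lam)) (F : τ.Fn) (a : τ.fnArity F → S.carrier) :
    (S.fn (.inl F) a : ZFSet.{u}) = oldEv S F fun i => a i :=
  (Model.ev_coe S (.inl F) a).symm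

theorem coe_newFun (S : Model (τ.expand lam)) (a : ModelClass.Idx lam → S.carrier) :
    (newFun S a : ZFSet.{u}) = nameOf S fun i => a i :=
  (Model.ev_coe S (.inr .F) a).symm

theorem oldRel_iff (S : Model (τ.expand lam)) (R : τ.Rl) (a : τ.rlArity R → S.carrier) :
    S.rel (some R) a ↔ oldHolds S R fun i => a i :=
  (Model.holds_coe S (some R) a).symm

theorem mem_newPred {S : Model (τ.expand lam)} {x : ZFSet.{u}} :
    x ∈ newPred S ↔ S.holds none fun _ => x :=
  ⟨fun ⟨h, h'⟩ => ⟨fun _ => h, h'⟩, fun ⟨h, h'⟩ => ⟨h ⟨⟩, h'⟩⟩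

theorem newPred_subset (S : Model (τ.expand lam)) : newPred S ⊆ S.carrier := fun _ h => h.1

/-- Separates the five kinds of symbols of the expanded vocabulary, once for all; both submodels and
isomorphisms are read off from it. -/
theorem expand_preserves_iff {f : ZFSet.{u} → ZFSet.{u}} {S T : Model (τ.expand lam)} :
    ((∀ F (a : (τ.expand lam).fnArity F → ZFSet.{u}), (∀ i, a i ∈ S.carrier) →
        T.ev F (fun i => f (a i)) = f (S.ev F a)) ∧
      (∀ R (a : (τ.expand lam).rlArity R → ZFSet.{u}), (∀ i, a i ∈ S.carrier) →
        (S.holds R a ↔ T.holds R (fun i => f (a i))))) ↔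
    cst T = f (cst S) ∧
    (∀ a : ModelClass.Idx lam → ZFSet.{u}, (∀ i, a i ∈ S.carrier) →
      nameOf T (fun i => f (a i)) = f (nameOf S a)) ∧
    (∀ F (a : τ.fnArity F → ZFSet.{u}), (∀ i, a i ∈ S.carrier) →
      oldEv T F (fun i => f (a i)) = f (oldEv S F a)) ∧
    (∀ R (a : τ.rlArity R → ZFSet.{u}), (∀ i, a i ∈ S.carrier) →
      (oldHolds S R a ↔ oldHolds T R (fun i => f (a i)))) ∧
    ∀ x ∈ S.carrier, (x ∈ newPred S ↔ f x ∈ newPred T) := by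
  constructor
  · rintro ⟨h1, h2⟩
    refine ⟨?_, fun a ha => h1 (.inr .F) a ha, fun F a ha => h1 (.inl F) a ha,
      fun R a ha => h2 (some R) a ha, fun x hx => ?_⟩
    · have := h1 (.inr .c) (PEmpty.elim) (fun i => i.elim)
      exact (ev_const T _).symm.trans (this.trans (congrArg f (ev_const S _)))
    · rw [mem_newPred, mem_newPred]
      exact h2 none (fun _ => x) (fun _ => hx)
  · rintro ⟨hc, h1, h2, h3, h4⟩
    refine ⟨?_, ?_⟩
    · rintro (F | (_ | _)) a ha
      · exact h2 F a ha
      · exact h1 a ha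
      · exact (ev_const T _).trans (hc.trans (congrArg f (ev_const S a)).symm)
    · rintro (_ | R) a ha
      · have := h4 (a ⟨⟩) (ha ⟨⟩)
        rw [mem_newPred, mem_newPred] at this
        exact this
      · exact h3 R a ha

theorem expand_sub_iff {S T : Model (τ.expand lam)} : S.Sub T ↔ S.carrier ⊆ T.carrier ∧
    cst T = cst S ∧
    (∀ a : ModelClass.Idx lam → ZFSet.{u}, (∀ i, a i ∈ S.carrier) → nameOf T a = nameOf S a) ∧
    (∀ F (a : τ.fnArity F → ZFSet.{u}), (∀ i, a i ∈ S.carrier) → oldEv T F a = oldEv S F a) ∧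
    (∀ R (a : τ.rlArity R → ZFSet.{u}), (∀ i, a i ∈ S.carrier) →
      (oldHolds S R a ↔ oldHolds T R a)) ∧
    ∀ x ∈ S.carrier, (x ∈ newPred S ↔ x ∈ newPred T) :=
  Model.sub_iff.trans (and_congr_right fun _ => expand_preserves_iff (f := id))

theorem expand_isIso_iff {f : ZFSet.{u} → ZFSet.{u}} {S T : Model (τ.expand lam)} :
    Model.IsIso f S T ↔ Set.BijOn f S.carrier T.carrier ∧
    cst T = f (cst S) ∧
    (∀ a : ModelClass.Idx lam → ZFSet.{u}, (∀ i, a i ∈ S.carrier) →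
      nameOf T (fun i => f (a i)) = f (nameOf S a)) ∧
    (∀ F (a : τ.fnArity F → ZFSet.{u}), (∀ i, a i ∈ S.carrier) →
      oldEv T F (fun i => f (a i)) = f (oldEv S F a)) ∧
    (∀ R (a : τ.rlArity R → ZFSet.{u}), (∀ i, a i ∈ S.carrier) →
      (oldHolds S R a ↔ oldHolds T R (fun i => f (a i)))) ∧
    ∀ x ∈ S.carrier, (x ∈ newPred S ↔ f x ∈ newPred T) :=
  Model.isIso_iff.trans (and_congr_right fun _ => expand_preserves_iff)

/-- `c` and the values of `G` may serve as the new elements over `M`. -/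
def Naming (E : SeqRel τ lam) (M : Model τ) (c : ZFSet.{u})
    (G : (ModelClass.Idx lam → ZFSet.{u}) → ZFSet.{u}) : Prop :=
  c ∉ M.carrier ∧ (∀ a, E M a a → G a ∉ M.carrier ∧ G a ≠ c) ∧
    ∀ a b, E M a a → E M b b → (G a = G b ↔ E M a b)

/-- The new elements over `M`. -/
def newElts (E : SeqRel τ lam) (M : Model τ) (c : ZFSet.{u})
    (G : (ModelClass.Idx lam → ZFSet.{u}) → ZFSet.{u}) : Set ZFSet.{u} :=
  insert c (G '' {a | E M a a})

open Classical in
/-- The expansion of `M` by the new constant `c` and the new elements `G a`. -/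
noncomputable def expandModel (E : SeqRel τ lam) (M : Model τ) (c : ZFSet.{u})
    (G : (ModelClass.Idx lam → ZFSet.{u}) → ZFSet.{u}) : Model (τ.expand lam) :=
  Model.ofEv (M.carrier ∪ newElts E M c G)
    (fun
      | .inl F => fun a => if ∀ i, a i ∈ M.carrier then M.ev F a else c
      | .inr .F => fun a => if E M a a then G a else c
      | .inr .c => fun _ => c)
    (by
      rintro (F | (_ | _)) a ha
      · change (if _ then _ else _) ∈ _
        split_ifs with h
        · exact Or.inl (M.ev_mem F h)
        · exact Or.inr (Or.inl rfl)
      · change (if _ then _ else _) ∈ _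
        split_ifs with h
        · exact Or.inr (Or.inr ⟨a, h, rfl⟩)
        · exact Or.inr (Or.inl rfl)
      · exact Or.inr (Or.inl rfl))
    (fun
      | some R => fun a => M.holds R a
      | none => fun a => a ⟨⟩ ∈ M.carrier)

section expandModel

variable {E : SeqRel τ lam} {M : Model τ} {c : ZFSet.{u}}
  {G : (ModelClass.Idx lam → ZFSet.{u}) → ZFSet.{u}}

theorem cst_expandModel : cst (expandModel E M c G) = c := rfl

theorem newPred_expandModel : newPred (expandModel E M c G) = M.carrier :=
  Set.ext fun _ => ⟨fun ⟨_, h⟩ => h, fun h => ⟨Or.inl h, h⟩⟩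

theorem nameOf_expandModel {a : ModelClass.Idx lam → ZFSet.{u}}
    (ha : ∀ i, a i ∈ M.carrier) (h : E M a a) : nameOf (expandModel E M c G) a = G a := by
  have h0 : ∀ i, a i ∈ (expandModel E M c G).carrier := fun i => Or.inl (ha i)
  exact (dif_pos h0).trans (if_pos h)

theorem nameOf_expandModel_const {a : ModelClass.Idx lam → ZFSet.{u}}
    (ha : ∀ i, a i ∈ (expandModel E M c G).carrier) (h : ¬ E M a a) :
    nameOf (expandModel E M c G) a = c := by
  exact (dif_pos ha).trans (if_neg h)

theorem oldEv_expandModel {F : τ.Fn} {a : τ.fnArity F → ZFSet.{u}}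
    (ha : ∀ i, a i ∈ M.carrier) : oldEv (expandModel E M c G) F a = M.ev F a := by
  have h0 : ∀ i, a i ∈ (expandModel E M c G).carrier := fun i => Or.inl (ha i)
  exact (dif_pos h0).trans (if_pos ha)

theorem oldEv_expandModel_const {F : τ.Fn} {a : τ.fnArity F → ZFSet.{u}}
    (ha : ∀ i, a i ∈ (expandModel E M c G).carrier) (h : ¬ ∀ i, a i ∈ M.carrier) :
    oldEv (expandModel E M c G) F a = c := by
  exact (dif_pos ha).trans (if_neg h)

theorem oldHolds_expandModel {R : τ.Rl} {a : τ.rlArity R → ZFSet.{u}} :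
    oldHolds (expandModel E M c G) R a ↔ M.holds R a :=
  ⟨fun ⟨_, h⟩ => h, fun h => ⟨fun i => Or.inl (h.1 i), h⟩⟩

end expandModel

end Untyped

/-! Witnesses -/

section Witness

variable {τ : Vocab.{u}} {lam : Cardinal.{u}} {mu : WithTop Cardinal.{u}} {k : ModelClass τ}
  {E : SeqRel τ lam}

theorem ModelClass.seq_mem (hk : k.IsEssAEC lam mu) {M : Model τ}
    {a : ModelClass.Idx lam → ZFSet.{u}} (ha : a ∈ k.seq lam M) (i) : a i ∈ M.carrier := by
  obtain ⟨N, hN, hc⟩ := ha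
  exact (hk.le_sub _ _ hN).1 (hc ▸ Set.mem_range_self i)

theorem IsSmooth.mem_left (hE : IsSmooth k E) (hk : k.IsEssAEC lam mu) {M : Model τ}
    (hM : M ∈ k.K) {a b : ModelClass.Idx lam → ZFSet.{u}} (h : E M a b) (i) : a i ∈ M.carrier :=
  ModelClass.seq_mem hk (hE.mem_seq M hM a b h).1 i

theorem IsSmooth.refl_right (hE : IsSmooth k E) {M : Model τ}
    (hM : M ∈ k.K) {a b : ModelClass.Idx lam → ZFSet.{u}} (h : E M a b) : E M b b :=
  hE.trans M hM b a b (hE.symm M hM a b h) h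

theorem IsSmooth.lift (hE : IsSmooth k E) (hk : k.IsEssAEC lam mu) {M N : Model τ}
    (hMN : k.le M N) {a b : ModelClass.Idx lam → ZFSet.{u}} (h : E M a b) : E N a b :=
  let h' := hE.mem_seq M (hk.le_mem _ _ hMN).1 a b h
  (hE.restrict M N hMN a h'.1 b h'.2).2 h

/-- Coherence: the model below `N` enumerated by `a` is a submodel of `M`, hence below `M`. -/
theorem ModelClass.seq_of_subset (hk : k.IsEssAEC lam mu) {M N : Model τ}
    (hMN : k.le M N) {a : ModelClass.Idx lam → ZFSet.{u}} (ha : a ∈ k.seq lam N)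
    (h : ∀ i, a i ∈ M.carrier) : a ∈ k.seq lam M := by
  obtain ⟨L, hL, hc⟩ := ha
  refine ⟨L, hk.coherent _ _ _ ((hk.le_sub _ _ hL).of_subset (hk.le_sub _ _ hMN) ?_) hL hMN, hc⟩
  rw [hc]
  rintro _ ⟨i, rfl⟩
  exact h i

/-- `IsSmooth.restrict` demands tuples in `seq M`; by `ModelClass.seq_of_subset` it is enough that
their entries lie in `M`. -/
theorem IsSmooth.descend (hE : IsSmooth k E) (hk : k.IsEssAEC lam mu) {M N : Model τ}
    (hMN : k.le M N) {a b : ModelClass.Idx lam → ZFSet.{u}} (ha : ∀ i, a i ∈ M.carrier)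
    (hb : ∀ i, b i ∈ M.carrier) (h : E N a b) : E M a b :=
  let h' := hE.mem_seq N (hk.le_mem _ _ hMN).2 a b h
  (hE.restrict M N hMN a (ModelClass.seq_of_subset hk hMN h'.1 ha) b
    (ModelClass.seq_of_subset hk hMN h'.2 hb)).1 h

theorem Naming.mono (hE : IsSmooth k E) (hk : k.IsEssAEC lam mu) {M N : Model τ}
    (hMN : k.le M N) {c : ZFSet.{u}} {G : (ModelClass.Idx lam → ZFSet.{u}) → ZFSet.{u}}
    (h : Naming E N c G) : Naming E M c G := by
  obtain ⟨h1, h2, h3⟩ := h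
  have hs := (hk.le_sub _ _ hMN).1
  have hM := (hk.le_mem _ _ hMN).1
  refine ⟨fun h => h1 (hs h), fun a ha => ?_, fun a b ha hb => ?_⟩
  · have := h2 a (hE.lift hk hMN ha)
    exact ⟨fun h => this.1 (hs h), this.2⟩
  · rw [h3 a b (hE.lift hk hMN ha) (hE.lift hk hMN hb)]
    exact ⟨hE.descend hk hMN (hE.mem_left hk hM ha) (hE.mem_left hk hM hb), hE.lift hk hMN⟩

theorem isWitness_expandModel (hE : IsSmooth k E) (hk : k.IsEssAEC lam mu) {M : Model τ}
    (hM : M ∈ k.K) {c : ZFSet.{u}} {G : (ModelClass.Idx lam → ZFSet.{u}) → ZFSet.{u}}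
    (h : Naming E M c G) : IsWitness k E M (expandModel E M c G) := by
  have hmem := fun {a} (ha : E M a a) => hE.mem_left hk hM ha
  have hval := coe_newFun (expandModel E M c G)
  have hval' : ∀ a : ModelClass.Idx lam → (expandModel E M c G).carrier,
      E M (fun i => a i) (fun i => a i) →
      (newFun (expandModel E M c G) a : ZFSet.{u}) = G fun i => a i :=
    fun a ha => (hval a).trans (nameOf_expandModel (hmem ha) ha)
  have hcv : ((newConst (expandModel E M c G)) : ZFSet.{u}) = c := cst_expandModel
  constructor
  · exact hM
  · exact newPred_expandModel.symm
  · intro R a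
    refine (oldRel_iff _ R a).trans (oldHolds_expandModel.trans ?_)
    exact ⟨fun ⟨h, h'⟩ => ⟨fun i => ⟨a i, h i⟩, fun i => rfl, h'⟩, fun ⟨b, hb, h'⟩ => by
      rw [← funext hb, Model.holds_coe]; exact h'⟩
  · intro F a b hab
    refine (coe_oldFn _ F a).trans ?_
    rw [← Model.ev_coe, ← funext hab]
    exact oldEv_expandModel fun i => (b i).2
  · intro F a ⟨i, hi⟩
    apply Subtype.ext
    exact (coe_oldFn _ F a).trans <| oldEv_expandModel_const (fun i => (a i).2) fun h => hi (h i)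
  · intro a ha
    rw [← Subtype.coe_ne_coe, hval' a ha, hcv]
    exact h.2.1 _ ha
  · intro a b ha hb
    rw [← Subtype.coe_inj, hval' a ha, hval' b hb]
    exact h.2.2 _ _ ha hb
  · intro a ha
    rw [← Subtype.coe_inj, hval a, hcv]
    exact nameOf_expandModel_const (fun i => (a i).2) ha
  · rw [hcv]; exact h.1
  · rintro ⟨x, hx⟩ hxM hxc
    rw [← Subtype.coe_ne_coe, hcv] at hxc
    rcases hx with hx | hx | ⟨a, ha, rfl⟩
    · exact (hxM hx).elim
    · exact (hxc hx).elim
    · refine ⟨fun i => ⟨a i, Or.inl (hmem ha i)⟩, ha, ?_⟩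
      exact Subtype.ext (hval' _ ha)

namespace IsWitness

variable {M : Model τ} {S : Model (τ.expand lam)}

theorem subset (h : IsWitness k E M S) : M.carrier ⊆ S.carrier :=
  h.carrier_eq ▸ newPred_subset S

theorem naming (hE : IsSmooth k E) (hk : k.IsEssAEC lam mu) (h : IsWitness k E M S) :
    Naming E M (cst S) (nameOf S) := by
  have hmem := fun {a} (ha : E M a a) i => h.subset (hE.mem_left hk h.mem ha i)
  have hval := coe_newFun S
  refine ⟨h.const_notMem, fun a ha => ?_, fun a b ha hb => ?_⟩
  · have := h.newFun_new (fun i => ⟨a i, hmem ha i⟩) ha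
    rwa [← Subtype.coe_ne_coe, hval] at this
  · have := h.newFun_eq_iff (fun i => ⟨a i, hmem ha i⟩) (fun i => ⟨b i, hmem hb i⟩) ha hb
    rwa [← Subtype.coe_inj, hval, hval] at this

/-- The clauses for a witness prescribe every symbol except the constant and the names of classes,
and the covering clause rules out further elements. Arguments about expansions thus reduce to
arguments about names. -/
theorem eq_expandModel (hE : IsSmooth k E) (hk : k.IsEssAEC lam mu) (h : IsWitness k E M S) :
    S = expandModel E M (cst S) (nameOf S) := by
  have hmem := fun {a} (ha : E M a a) i => hE.mem_left hk h.mem ha i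
  have hval := coe_newFun S
  have hc : S.carrier = (expandModel E M (cst S) (nameOf S)).carrier := by
    apply Set.Subset.antisymm
    · intro x hx
      by_cases hxM : x ∈ M.carrier
      · exact Or.inl hxM
      by_cases hxc : (⟨x, hx⟩ : S.carrier) = newConst S
      · exact Or.inr (Or.inl (congrArg Subtype.val hxc))
      · obtain ⟨a, ha, hax⟩ := h.covered ⟨x, hx⟩ hxM hxc
        exact Or.inr (Or.inr ⟨_, ha, (hval a).symm.trans (congrArg Subtype.val hax)⟩)
    · rintro x (hx | rfl | ⟨a, ha, rfl⟩)
      · exact h.subset hx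
      · exact cst_mem S
      · exact Model.ev_mem S (.inr .F) fun i => h.subset (hmem ha i)
  refine Model.Sub.eq_of_subset ?_ hc.symm.subset
  rw [expand_sub_iff]
  refine ⟨hc.subset, rfl, fun a ha => ?_, fun F a ha => ?_, fun R a ha => ?_, fun x hx => ?_⟩
  · by_cases h' : E M a a
    · exact nameOf_expandModel (hmem h') h'
    · rw [nameOf_expandModel_const (fun i => hc ▸ ha i) h']
      have := h.newFun_const (fun i => ⟨a i, ha i⟩) h'
      rw [← Subtype.coe_inj, hval] at this
      exact this.symm
  · by_cases h' : ∀ i, a i ∈ M.carrier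
    · rw [oldEv_expandModel h']
      have := h.fn_eq F (fun i => ⟨a i, ha i⟩) (fun i => ⟨a i, h' i⟩) fun i => rfl
      exact ((coe_oldFn _ _ _).symm.trans (this.trans (Model.ev_coe _ _ _).symm)).symm
    · rw [oldEv_expandModel_const (fun i => hc ▸ ha i) h']
      have := h.fn_eq_const F (fun i => ⟨a i, ha i⟩) (not_forall.1 h')
      exact ((coe_oldFn _ _ _).symm.trans (congrArg Subtype.val this)).symm
  · rw [oldHolds_expandModel]
    have := h.rel_iff R (fun i => ⟨a i, ha i⟩)
    refine (oldRel_iff S R _).symm.trans <| Iff.trans this ⟨fun ⟨b, hb, h'⟩ => ?_, fun ⟨h, h'⟩ => ⟨fun i => ⟨a i, h i⟩, fun i => rfl, h'⟩⟩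
    rw [← Model.holds_coe, funext hb] at h'
    exact h'
  · rw [newPred_expandModel, h.carrier_eq]

/-- The new predicate recovers the universe of the witness, and the old symbols restricted to it
recover the structure. -/
theorem unique (h : IsWitness k E M S) {N : Model τ} (h' : IsWitness k E N S) : M = N := by
  have hc : M.carrier = N.carrier := h.carrier_eq.trans h'.carrier_eq.symm
  refine Model.ext_ev hc (fun F a ha => ?_) (fun R a ha => ?_)
  · have h1 := h.fn_eq F (fun i => ⟨a i, h.subset (ha i)⟩) (fun i => ⟨a i, ha i⟩) fun i => rfl
    have h2 := h'.fn_eq F (fun i => ⟨a i, h.subset (ha i)⟩) (fun i => ⟨a i, hc ▸ ha i⟩)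
      fun i => rfl
    exact (Model.ev_coe N F fun i => ⟨a i, hc ▸ ha i⟩).trans
      (h2.symm.trans (h1.trans (Model.ev_coe M F fun i => ⟨a i, ha i⟩).symm))
  · have h1 := h.rel_iff R (fun i => ⟨a i, h.subset (ha i)⟩)
    have h2 := h'.rel_iff R (fun i => ⟨a i, h.subset (ha i)⟩)
    replace h2 := h1.symm.trans h2
    constructor
    · rintro ⟨h3, h4⟩
      obtain ⟨b, hb, h5⟩ := h2.1 ⟨fun i => ⟨a i, h3 i⟩, fun i => rfl, h4⟩
      rw [← Model.holds_coe, funext hb] at h5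
      exact h5
    · rintro ⟨h3, h4⟩
      obtain ⟨b, hb, h5⟩ := h2.2 ⟨fun i => ⟨a i, h3 i⟩, fun i => rfl, h4⟩
      rw [← Model.holds_coe, funext hb] at h5
      exact h5

end IsWitness

end Witness

/-! ### Submodels, isomorphisms and extensions of expansions. -/

section Adjoin

variable {τ : Vocab.{u}} {lam : Cardinal.{u}} {mu : WithTop Cardinal.{u}} {k : ModelClass τ}
  {E : SeqRel τ lam}

/-- Agreement on the constant and on the names of the smaller model suffices, because the default
values are taken on the same tuples in both expansions. -/
theorem expandModel_sub (hE : IsSmooth k E) (hk : k.IsEssAEC lam mu) {M N : Model τ}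
    (hMN : k.le M N) {c c' : ZFSet.{u}} {G G' : (ModelClass.Idx lam → ZFSet.{u}) → ZFSet.{u}}
    (hN : Naming E N c' G') (hc : c = c') (hG : ∀ a, E M a a → G a = G' a) :
    (expandModel E M c G).Sub (expandModel E N c' G') := by
  subst hc
  have hsub := (hk.le_sub _ _ hMN)
  have hMK := (hk.le_mem _ _ hMN).1
  have hs : (expandModel E M c G).carrier ⊆ (expandModel E N c G').carrier := by
    rintro x (hx | rfl | ⟨a, ha, rfl⟩)
    · exact Or.inl (hsub.1 hx)
    · exact Or.inr (Or.inl rfl)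
    · exact Or.inr (Or.inr ⟨a, hE.lift hk hMN ha, (hG a ha).symm⟩)
  -- A new element over `M` is also new over `N`, so it does not become an old element. This settles
  -- the new predicate and shows that no tuple leaves the default case.
  have hiff : ∀ x ∈ (expandModel E M c G).carrier, (x ∈ M.carrier ↔ x ∈ N.carrier) := by
    rintro x (hx | rfl | ⟨a, ha, rfl⟩)
    · exact iff_of_true hx (hsub.1 hx)
    · exact iff_of_false (fun h => hN.1 (hsub.1 h)) hN.1
    · have : G a ∉ N.carrier := by rw [hG a ha]; exact (hN.2.1 a (hE.lift hk hMN ha)).1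
      exact iff_of_false (fun h => this (hsub.1 h)) this
  rw [Model.sub_iff] at hsub
  rw [expand_sub_iff]
  refine ⟨hs, rfl, fun a ha => ?_, fun F a ha => ?_, fun R a ha => ?_, fun x hx => ?_⟩
  · by_cases h : E M a a
    · have hm := hE.mem_left hk hMK h
      rw [nameOf_expandModel hm h, nameOf_expandModel (fun i => hsub.1 (hm i)) (hE.lift hk hMN h),
        hG a h]
    · rw [nameOf_expandModel_const ha h, nameOf_expandModel_const (fun i => hs (ha i))]
      intro h'
      have hm := fun i => (hiff _ (ha i)).2 (hE.mem_left hk (hk.le_mem _ _ hMN).2 h' i)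
      exact h (hE.descend hk hMN hm hm h')
  · by_cases h : ∀ i, a i ∈ M.carrier
    · rw [oldEv_expandModel h, oldEv_expandModel fun i => hsub.1 (h i)]
      exact hsub.2.1 F a h
    · rw [oldEv_expandModel_const ha h, oldEv_expandModel_const fun i => hs (ha i)]
      exact fun h' => h fun i => (hiff _ (ha i)).2 (h' i)
  · rw [oldHolds_expandModel, oldHolds_expandModel]
    by_cases h : ∀ i, a i ∈ M.carrier
    · exact hsub.2.2 R a h
    · exact iff_of_false (fun h' => h h'.1) fun h' => h fun i => (hiff _ (ha i)).2 (h'.1 i)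
  · rw [newPred_expandModel, newPred_expandModel]
    exact hiff x hx

theorem expandModel_congr (hE : IsSmooth k E) (hk : k.IsEssAEC lam mu) {M : Model τ}
    (hM : M ∈ k.K) {c c' : ZFSet.{u}} {G G' : (ModelClass.Idx lam → ZFSet.{u}) → ZFSet.{u}}
    (hN : Naming E M c' G') (hc : c = c') (hG : ∀ a, E M a a → G a = G' a) :
    expandModel E M c G = expandModel E M c' G' := by
  refine (expandModel_sub hE hk (hk.refl M hM) hN hc hG).eq_of_subset ?_
  subst hc
  rintro x (hx | rfl | ⟨a, ha, rfl⟩)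
  · exact Or.inl hx
  · exact Or.inr (Or.inl rfl)
  · exact Or.inr (Or.inr ⟨a, ha, hG a ha⟩)

/-- By invariance of `E`, classes over `M` and over `N` match under `g`; a map that sends each name
to the name of the image class is then bijective on the new elements. -/
theorem isIso_expandModel (hE : IsSmooth k E) (hk : k.IsEssAEC lam mu) {M N : Model τ}
    (hM : M ∈ k.K) {c c' : ZFSet.{u}} {G G' : (ModelClass.Idx lam → ZFSet.{u}) → ZFSet.{u}}
    (hMG : Naming E M c G) (hNG : Naming E N c' G') {g : ZFSet.{u} → ZFSet.{u}}
    (hg : Model.IsIso g M N) (hc : g c = c') (hG : ∀ a, E M a a → g (G a) = G' (g ∘ a)) :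
    Model.IsIso g (expandModel E M c G) (expandModel E N c' G') := by
  have hN : N ∈ k.K := hk.iso_mem _ _ _ hg hM
  have hiso : ∀ {a b}, (∀ i, a i ∈ M.carrier) → (∀ i, b i ∈ M.carrier) →
      (E M a b ↔ E N (g ∘ a) (g ∘ b)) := fun {a b} ha hb => hE.iso g M N hM hg a b ha hb
  have hmem := fun {a} (ha : E M a a) i => hE.mem_left hk hM ha i
  have hup : ∀ {a}, E M a a → E N (g ∘ a) (g ∘ a) := fun ha => (hiso (hmem ha) (hmem ha)).1 ha
  have hiff : ∀ x ∈ (expandModel E M c G).carrier, (x ∈ M.carrier ↔ g x ∈ N.carrier) := by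
    rintro x (hx | rfl | ⟨a, ha, rfl⟩)
    · exact iff_of_true hx (hg.mapsTo hx)
    · exact iff_of_false hMG.1 (by rw [hc]; exact hNG.1)
    · exact iff_of_false (hMG.2.1 a ha).1 (by rw [hG a ha]; exact (hNG.2.1 _ (hup ha)).1)
  have hdom : ∀ {a}, (∀ i, a i ∈ (expandModel E M c G).carrier) → ¬ E M a a →
      ¬ E N (fun i => g (a i)) (fun i => g (a i)) := fun {a} ha h h' => by
    have hm := fun i => (hiff _ (ha i)).2 (hE.mem_left hk hN h' i)
    exact h ((hiso hm hm).2 h')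
  have hmaps : Set.MapsTo g (expandModel E M c G).carrier (expandModel E N c' G').carrier := by
    rintro x (hx | rfl | ⟨a, ha, rfl⟩)
    · exact Or.inl (hg.mapsTo hx)
    · exact Or.inr (Or.inl hc)
    · exact Or.inr (Or.inr ⟨_, hup ha, (hG a ha).symm⟩)
  rw [expand_isIso_iff]
  refine ⟨⟨hmaps, ?_, ?_⟩, hc.symm, fun a ha => ?_, fun F a ha => ?_, fun R a ha => ?_,
    fun x hx => ?_⟩
  · intro x hx y hy hxy
    have hxN := hiff x hx
    have hyN := hiff y hy
    by_cases h : x ∈ M.carrier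
    · exact hg.1.injOn h (hyN.2 (hxy ▸ hxN.1 h)) hxy
    · have h' : y ∉ M.carrier := fun h' => h (hxN.2 (hxy ▸ hyN.1 h'))
      rcases hx with hx | rfl | ⟨a, ha, rfl⟩
      · exact (h hx).elim
      · rcases hy with hy | rfl | ⟨b, hb, rfl⟩
        · exact (h' hy).elim
        · rfl
        · rw [hc, hG b hb] at hxy
          exact ((hNG.2.1 _ (hup hb)).2 hxy.symm).elim
      · rcases hy with hy | rfl | ⟨b, hb, rfl⟩
        · exact (h' hy).elim
        · rw [hc, hG a ha] at hxy
          exact ((hNG.2.1 _ (hup ha)).2 hxy).elim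
        · rw [hG b hb, hG a ha, hNG.2.2 _ _ (hup ha) (hup hb),
            ← hiso (hmem ha) (hmem hb)] at hxy
          exact (hMG.2.2 a b ha hb).2 hxy
  · rintro y (hy | rfl | ⟨b, hb, rfl⟩)
    · obtain ⟨x, hx, rfl⟩ := hg.1.surjOn hy
      exact ⟨x, Or.inl hx, rfl⟩
    · exact ⟨c, Or.inr (Or.inl rfl), hc⟩
    · have hbm := fun i => hE.mem_left hk hN hb i
      have hba : g ∘ (fun i => Function.invFunOn g M.carrier (b i)) = b :=
        funext fun i => hg.apply_inv (hbm i)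
      have ham : ∀ i, Function.invFunOn g M.carrier (b i) ∈ M.carrier :=
        fun i => hg.inv.mapsTo (hbm i)
      have ha := (hiso ham ham).2 (by rw [hba]; exact hb)
      exact ⟨_, Or.inr (Or.inr ⟨_, ha, rfl⟩), by rw [hG _ ha, hba]⟩
  · by_cases h : E M a a
    · rw [nameOf_expandModel (hmem h) h, hG a h]
      exact nameOf_expandModel (fun i => hg.mapsTo (hmem h i)) (hup h)
    · rw [nameOf_expandModel_const ha h, hc]
      exact nameOf_expandModel_const (fun i => hmaps (ha i)) (hdom ha h)
  · rw [Model.isIso_iff] at hg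
    by_cases h : ∀ i, a i ∈ M.carrier
    · rw [oldEv_expandModel h, oldEv_expandModel fun i => hg.1.mapsTo (h i)]
      exact hg.2.1 F a h
    · rw [oldEv_expandModel_const ha h, oldEv_expandModel_const fun i => hmaps (ha i), hc]
      exact fun h' => h fun i => (hiff _ (ha i)).2 (h' i)
  · rw [Model.isIso_iff] at hg
    rw [oldHolds_expandModel, oldHolds_expandModel]
    by_cases h : ∀ i, a i ∈ M.carrier
    · exact hg.2.2 R a h
    · exact iff_of_false (fun h' => h h'.1) fun h' => h fun i => (hiff _ (ha i)).2 (h'.1 i)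
  · rw [newPred_expandModel, newPred_expandModel]
    exact hiff x hx

/-- The part of `T` generated by `M`. -/
noncomputable def restr (E : SeqRel τ lam) (T : Model (τ.expand lam)) (M : Model τ) :
    Model (τ.expand lam) :=
  expandModel E M (cst T) (nameOf T)

namespace IsWitness

variable {M N : Model τ} {S T : Model (τ.expand lam)}

theorem mem_iff (h : IsWitness k E M S) {x : ZFSet.{u}} : x ∈ M.carrier ↔ x ∈ newPred S := by
  rw [h.carrier_eq]

theorem oldEv_eq (hM : IsWitness k E M S) {F} {a : τ.fnArity F → ZFSet.{u}}
    (ha : ∀ i, a i ∈ M.carrier) : oldEv S F a = M.ev F a := by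
  have h1 := hM.fn_eq F (fun i => ⟨a i, hM.subset (ha i)⟩) (fun i => ⟨a i, ha i⟩) fun i => rfl
  exact (coe_oldFn _ _ _).symm.trans (h1.trans (Model.ev_coe _ _ _).symm)

theorem oldHolds_iff (hM : IsWitness k E M S) {R} {a : τ.rlArity R → ZFSet.{u}}
    (ha : ∀ i, a i ∈ S.carrier) : oldHolds S R a ↔ M.holds R a := by
  have h1 := hM.rel_iff R (fun i => ⟨a i, ha i⟩)
  refine (oldRel_iff S R _).symm.trans (h1.trans ⟨fun ⟨b, hb, h'⟩ => ?_,
    fun ⟨h, h'⟩ => ⟨fun i => ⟨a i, h i⟩, fun i => rfl, h'⟩⟩)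
  rw [← Model.holds_coe, funext hb] at h'
  exact h'

/-- The witness of a submodel is a submodel of the witness. -/
theorem sub (hM : IsWitness k E M S) (hN : IsWitness k E N T) (h : S.Sub T) : M.Sub N := by
  rw [expand_sub_iff] at h
  have hs : M.carrier ⊆ N.carrier := fun x hx =>
    hN.mem_iff.2 ((h.2.2.2.2.2 x (hM.subset hx)).1 (hM.mem_iff.1 hx))
  refine Model.sub_iff.2 ⟨hs, fun F a ha => ?_, fun R a ha => ?_⟩
  · rw [← hM.oldEv_eq ha, ← hN.oldEv_eq fun i => hs (ha i)]
    exact h.2.2.2.1 F a fun i => hM.subset (ha i)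
  · rw [← hM.oldHolds_iff fun i => hM.subset (ha i),
      ← hN.oldHolds_iff fun i => hN.subset (hs (ha i))]
    exact h.2.2.2.2.1 R a fun i => hM.subset (ha i)

theorem le_iff (hM : IsWitness k E M S) (hN : IsWitness k E N T) :
    (k.adjoin E).le S T ↔ S.Sub T ∧ k.le M N := by
  refine and_congr_right fun _ => ⟨?_, fun h => ⟨M, N, hM, hN, h⟩⟩
  rintro ⟨M', N', hM', hN', h⟩
  rwa [hM.unique hM', hN.unique hN']

/-- Submodels respect the new predicate, which is what separates old elements from new ones. -/
theorem mem_of_mem (hM : IsWitness k E M S) (hN : IsWitness k E N T) (h : S.Sub T) {x : ZFSet.{u}}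
    (hx : x ∈ S.carrier) : x ∈ M.carrier ↔ x ∈ N.carrier := by
  rw [hM.mem_iff, hN.mem_iff]
  exact (expand_sub_iff.1 h).2.2.2.2.2 x hx

theorem carrier_eq_union (hE : IsSmooth k E) (hk : k.IsEssAEC lam mu) (h : IsWitness k E M S) :
    S.carrier = M.carrier ∪ newElts E M (cst S) (nameOf S) := by
  conv_lhs => rw [h.eq_expandModel hE hk]
  rfl

theorem restr (hE : IsSmooth k E) (hk : k.IsEssAEC lam mu) (hN : IsWitness k E N T)
    (h : k.le M N) : IsWitness k E M (restr E T M) :=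
  isWitness_expandModel hE hk (hk.le_mem _ _ h).1 ((hN.naming hE hk).mono hE hk h)

theorem restr_le (hE : IsSmooth k E) (hk : k.IsEssAEC lam mu) (hN : IsWitness k E N T)
    (h : k.le M N) : (k.adjoin E).le (EssFrame.restr E T M) T := by
  rw [(hN.restr hE hk h).le_iff hN]
  refine ⟨?_, h⟩
  have h1 := expandModel_sub hE hk h (hN.naming hE hk) rfl fun a _ => rfl
  rw [← hN.eq_expandModel hE hk] at h1
  exact h1

/-- Inside `T` the constant and the names of the classes over `M` are already fixed, so there is no
choice for an expansion of `M`. -/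
theorem eq_restr (hE : IsSmooth k E) (hk : k.IsEssAEC lam mu) (hM : IsWitness k E M S)
    (hN : IsWitness k E N T) (hs : S.Sub T) (h : k.le M N) : S = EssFrame.restr E T M := by
  rw [hM.eq_expandModel hE hk]
  rw [expand_sub_iff] at hs
  refine expandModel_congr hE hk hM.mem ((hN.naming hE hk).mono hE hk h) hs.2.1.symm ?_
  exact fun a ha => (hs.2.2.1 a fun i => hM.subset (hE.mem_left hk hM.mem ha i)).symm

/-- An isomorphism between members of the expanded class is one between the witnesses. -/
theorem map (hE : IsSmooth k E) (hk : k.IsEssAEC lam mu) (hM : IsWitness k E M S)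
    {f : ZFSet.{u} → ZFSet.{u}} (hf : Model.IsIso f S T) :
    IsWitness k E (M.map f) T ∧ Model.IsIso f M (M.map f) := by
  have hi : Model.IsIso f M (M.map f) := Model.isIso_map (hf.1.injOn.mono hM.subset)
  have hn := hM.naming hE hk
  have hmem := fun {a} (ha : E M a a) i => hE.mem_left hk hM.mem ha i
  have hS := hM.eq_expandModel hE hk
  have hK : M.map f ∈ k.K := hk.iso_mem _ _ _ hi hM.mem
  have hinj := hf.1.injOn
  have hin : ∀ a, E M a a → nameOf S a ∈ S.carrier := fun a ha =>
    Model.ev_mem S (.inr .F) fun i => hM.subset (hmem ha i)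
  have hinv : ∀ {b : ModelClass.Idx lam → ZFSet.{u}}, (∀ i, b i ∈ (M.map f).carrier) →
      (∀ i, Function.invFunOn f M.carrier (b i) ∈ M.carrier) ∧
      f ∘ (fun i => Function.invFunOn f M.carrier (b i)) = b := fun {b} hb =>
    ⟨fun i => hi.inv.mapsTo (hb i), funext fun i => hi.apply_inv (hb i)⟩
  have hdown : ∀ {b b'}, E (M.map f) b b' → E M (fun i => Function.invFunOn f M.carrier (b i))
      (fun i => Function.invFunOn f M.carrier (b' i)) := by
    intro b b' h
    have h1 := hinv fun i => hE.mem_left hk hK h i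
    have h2 := hinv fun i => hE.mem_left hk hK (hE.symm _ hK _ _ h) i
    rw [hE.iso f M _ hM.mem hi _ _ h1.1 h2.1, h1.2, h2.2]
    exact h
  -- The names are transported: pull a tuple back along `f`, take its name in `S`, and push the name
  -- forward.
  have hn' : Naming E (M.map f) (f (cst S))
      (fun b => f (nameOf S fun i => Function.invFunOn f M.carrier (b i))) := by
    refine ⟨?_, fun b hb => ⟨?_, fun h => ?_⟩, fun a b ha hb => ?_⟩
    · rintro ⟨x, hx, h⟩
      exact hn.1 (hinj (hM.subset hx) (cst_mem S) h ▸ hx)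
    · rintro ⟨x, hx, h⟩
      exact (hn.2.1 _ (hdown hb)).1 (hinj (hM.subset hx) (hin _ (hdown hb)) h ▸ hx)
    · exact (hn.2.1 _ (hdown hb)).2 (hinj (hin _ (hdown hb)) (cst_mem S) h)
    · rw [hinj.eq_iff (hin _ (hdown ha)) (hin _ (hdown hb)), hn.2.2 _ _ (hdown ha) (hdown hb)]
      have h1 := hinv fun i => hE.mem_left hk hK ha i
      have h2 := hinv fun i => hE.mem_left hk hK hb i
      rw [hE.iso f M _ hM.mem hi _ _ h1.1 h2.1, h1.2, h2.2]
  have h1 := isIso_expandModel hE hk hM.mem hn hn' hi rfl fun a ha => by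
    change _ = f (nameOf S fun i => Function.invFunOn f M.carrier (f (a i)))
    congr 2
    funext i
    exact (hi.inv_apply (hmem ha i)).symm
  rw [← hS] at h1
  rw [hf.unique h1]
  exact ⟨isWitness_expandModel hE hk hK hn', hi⟩

theorem isIso (hE : IsSmooth k E) (hk : k.IsEssAEC lam mu) (hM : IsWitness k E M S)
    (hN : IsWitness k E N T) {f : ZFSet.{u} → ZFSet.{u}} (hf : Model.IsIso f S T) :
    Model.IsIso f M N := by
  obtain ⟨h1, h2⟩ := hM.map hE hk hf
  rwa [hN.unique h1]

/-- An isomorphism between witnesses extends to the members of the expanded class. -/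
theorem exists_isIso (hE : IsSmooth k E) (hk : k.IsEssAEC lam mu) (hM : IsWitness k E M S)
    (hN : IsWitness k E N T) {f : ZFSet.{u} → ZFSet.{u}} (hf : Model.IsIso f M N) :
    ∃ g, Model.IsIso g S T ∧ ∀ x ∈ M.carrier, g x = f x := by
  classical
  have hn := hM.naming hE hk
  have hn' := hN.naming hE hk
  have hmem := fun {a} (ha : E M a a) i => hE.mem_left hk hM.mem ha i
  have hup : ∀ {a b}, E M a b → E N (f ∘ a) (f ∘ b) := fun {a b} h =>
    (hE.iso f M N hM.mem hf a b (hE.mem_left hk hM.mem h)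
      (hE.mem_left hk hM.mem (hE.symm _ hM.mem _ _ h))).1 h
  -- The name of a class goes to the name of its image under `f`; by invariance of `E` the chosen
  -- representative does not matter. What is neither old nor a name goes to the constant.
  let g : ZFSet.{u} → ZFSet.{u} := fun x => if x ∈ M.carrier then f x else
    if h : ∃ a, E M a a ∧ nameOf S a = x then nameOf T (f ∘ h.choose) else cst T
  have hgM : ∀ x ∈ M.carrier, g x = f x := fun x hx => if_pos hx
  have hgc : g (cst S) = cst T := by
    have h1 : ¬ ∃ a, E M a a ∧ nameOf S a = cst S := fun ⟨a, ha, h⟩ => (hn.2.1 a ha).2 h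
    simp only [g, if_neg hn.1, dif_neg h1]
  have hgG : ∀ a, E M a a → g (nameOf S a) = nameOf T (g ∘ a) := by
    intro a ha
    have h1 : ∃ b, E M b b ∧ nameOf S b = nameOf S a := ⟨a, ha, rfl⟩
    have h2 : g ∘ a = f ∘ a := funext fun i => hgM _ (hmem ha i)
    rw [h2]
    simp only [g, if_neg (hn.2.1 a ha).1, dif_pos h1]
    have h3 := h1.choose_spec
    have h4 := (hn.2.2 _ _ h3.1 ha).1 h3.2
    exact (hn'.2.2 _ _ (hup h3.1) (hup ha)).2 (hup h4)
  refine ⟨g, ?_, hgM⟩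
  have := isIso_expandModel hE hk hM.mem hn hn' (hf.congr hgM) hgc hgG
  rwa [← hM.eq_expandModel hE hk, ← hN.eq_expandModel hE hk] at this

/-- An isomorphism that fixes a witness fixes the model that it witnesses. -/
theorem fix (hE : IsSmooth k E) (hk : k.IsEssAEC lam mu) {S' T' : Model (τ.expand lam)}
    {g : ZFSet.{u} → ZFSet.{u}} (hg : Model.IsIso g S' T') (hM : IsWitness k E M S)
    (h1 : S.Sub S') (h2 : S.Sub T) (h3 : T'.Sub T) (hfix : ∀ x ∈ M.carrier, g x = x) :
    ∀ x ∈ S.carrier, g x = x := by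
  have hmem := fun {a} (ha : E M a a) i => hE.mem_left hk hM.mem ha i
  rw [expand_sub_iff] at h1 h2 h3
  rw [expand_isIso_iff] at hg
  intro x hx
  rw [hM.carrier_eq_union hE hk] at hx
  -- An element of `S` is old, or the constant, or the value of the new function at a tuple from
  -- `M`; in the last two cases preservation of the symbols determines its image.
  rcases hx with hx | rfl | ⟨a, ha, rfl⟩
  · exact hfix x hx
  · rw [← h1.2.1, ← hg.2.1, ← h3.2.1, h2.2.1, h1.2.1]
  · have hS := fun i => hM.subset (hmem ha i)
    have hS' := fun i => h1.1 (hS i)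
    rw [← h1.2.2.1 a hS, ← hg.2.2.1 a hS', ← h3.2.2.1 _ fun i => hg.1.mapsTo (hS' i),
      h1.2.2.1 a hS, ← h2.2.2.1 a hS]
    congr 1
    funext i
    exact hfix _ (hmem ha i)

theorem isEmb (hE : IsSmooth k E) (hk : k.IsEssAEC lam mu) (hM : IsWitness k E M S)
    (hN : IsWitness k E N T) {f : ZFSet.{u} → ZFSet.{u}} (hf : (k.adjoin E).IsEmb f S T) :
    k.IsEmb f M N := by
  obtain ⟨T', h1, h2⟩ := hf
  obtain ⟨h3, h4⟩ := hM.map hE hk h1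
  exact ⟨_, h4, ((h3.le_iff hN).1 h2).2⟩

theorem exists_isEmb (hE : IsSmooth k E) (hk : k.IsEssAEC lam mu) (hM : IsWitness k E M S)
    (hN : IsWitness k E N T) {f : ZFSet.{u} → ZFSet.{u}} (hf : k.IsEmb f M N) :
    ∃ g, (k.adjoin E).IsEmb g S T ∧ ∀ x ∈ M.carrier, g x = f x := by
  obtain ⟨N', h1, h2⟩ := hf
  obtain ⟨g, h3, h4⟩ := hM.exists_isIso hE hk (hN.restr hE hk h2) h1
  exact ⟨g, ⟨_, h3, hN.restr_le hE hk h2⟩, h4⟩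

theorem fix_emb (hE : IsSmooth k E) (hk : k.IsEssAEC lam mu) {S' : Model (τ.expand lam)}
    {g : ZFSet.{u} → ZFSet.{u}} (hg : (k.adjoin E).IsEmb g S' T) (hM : IsWitness k E M S)
    (h1 : S.Sub S') (h2 : S.Sub T) (hfix : ∀ x ∈ M.carrier, g x = x) :
    ∀ x ∈ S.carrier, g x = x := by
  obtain ⟨T', h3, h4⟩ := hg
  exact hM.fix hE hk h3 h1 h2 h4.1 hfix

theorem small_dom (hE : IsSmooth k E) (hk : k.IsEssAEC lam mu) (hM : M ∈ k.K) :
    Small.{u} {a | E M a a} := by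
  have h1 : Small.{u} M.carrier := small_iff_mk_lt.2 ((hk.card_lt M hM).trans_le (bound_le_univ _))
  have h2 : Small.{u} (ModelClass.Idx lam → M.carrier) := inferInstance
  refine small_of_injective (β := ModelClass.Idx lam → M.carrier)
    (f := fun a i => ⟨a.1 i, hE.mem_left hk hM a.2 i⟩) fun a b h => Subtype.ext (funext fun i => ?_)
  exact congrArg Subtype.val (congrFun h i)

theorem small_carrier (hE : IsSmooth k E) (hk : k.IsEssAEC lam mu) (hM : IsWitness k E M S) :
    Small.{u} S.carrier := by
  have h1 : Small.{u} M.carrier :=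
    small_iff_mk_lt.2 ((hk.card_lt M hM.mem).trans_le (bound_le_univ _))
  have h2 := small_dom hE hk hM.mem
  rw [hM.carrier_eq_union hE hk, newElts, Set.insert_eq]
  infer_instance

end IsWitness

open Classical in
/-- A representative of the class of `a`. -/
noncomputable def classRep (E : SeqRel τ lam) (M : Model τ) (a : ModelClass.Idx lam → ZFSet.{u}) :
    ModelClass.Idx lam → ZFSet.{u} :=
  if ∃ b, E M a b then Classical.epsilon (E M a) else a

theorem classRep_spec {M : Model τ} {a : ModelClass.Idx lam → ZFSet.{u}} (h : E M a a) :
    E M a (classRep E M a) := by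
  have : ∃ b, E M a b := ⟨a, h⟩
  rw [classRep, if_pos this]
  exact Classical.epsilon_spec this

/-- Equivalent tuples define literally the same predicate, from which the choice operator picks the
same element. -/
theorem classRep_eq_iff (hE : IsSmooth k E) {M : Model τ} (hM : M ∈ k.K)
    {a b : ModelClass.Idx lam → ZFSet.{u}} (ha : E M a a) (hb : E M b b) :
    classRep E M a = classRep E M b ↔ E M a b := by
  constructor
  · intro h
    exact hE.trans M hM _ _ _ (classRep_spec ha)
      (h ▸ hE.symm M hM _ _ (classRep_spec hb))
  · intro h
    have h1 : E M a = E M b := funext fun c => propext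
      ⟨hE.trans M hM _ _ _ (hE.symm M hM _ _ h), hE.trans M hM _ _ _ h⟩
    rw [classRep, classRep, if_pos ⟨a, ha⟩, if_pos ⟨b, hb⟩, h1]

/-- Every member of the class has an expansion whose new elements avoid a given small set. -/
theorem exists_expansion (hE : IsSmooth k E) (hk : k.IsEssAEC lam mu) {M : Model τ}
    (hM : M ∈ k.K) (B : Set ZFSet.{u}) [Small.{u} B] :
    ∃ c G, Naming E M c G ∧ c ∉ B ∧ ∀ a, E M a a → G a ∉ B := by
  classical
  have h1 : Small.{u} M.carrier := small_iff_mk_lt.2 ((hk.card_lt M hM).trans_le (bound_le_univ _))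
  have h2 := IsWitness.small_dom hE hk hM
  have h3 : Small.{u} (Option {a | E M a a}) :=
    small_of_injective (Equiv.optionEquivSumPUnit.{u} {a | E M a a}).injective
  -- The value at `none` serves as the constant; the value at the representative of a class serves
  -- as its name.
  obtain ⟨g, hg, hgB⟩ := exists_fresh (α := Option {a | E M a a}) (B ∪ M.carrier)
  have hr : ∀ {a}, E M a a → E M (classRep E M a) (classRep E M a) := fun ha =>
    hE.refl_right hM (classRep_spec ha)
  let G := fun a => if h : E M a a then g (some ⟨classRep E M a, hr h⟩) else ∅
  have hG : ∀ {a} (h : E M a a), G a = g (some ⟨classRep E M a, hr h⟩) := fun h => dif_pos h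
  refine ⟨g none, G, ⟨?_, ?_, ?_⟩, ?_, ?_⟩
  · exact fun h => hgB _ (Or.inr h)
  · intro a ha
    rw [hG ha]
    exact ⟨fun h => hgB _ (Or.inr h), fun h => by simpa using hg h⟩
  · intro a b ha hb
    rw [hG ha, hG hb, hg.eq_iff, ← classRep_eq_iff hE hM ha hb]
    simp
  · exact fun h => hgB _ (Or.inl h)
  · intro a ha
    rw [hG ha]
    exact fun h => hgB _ (Or.inl h)

theorem exists_witnessed (hE : IsSmooth k E) (hk : k.IsEssAEC lam mu) {M : Model τ}
    (hM : M ∈ k.K) : ∃ S, IsWitness k E M S := by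
  obtain ⟨c, G, h, -⟩ := exists_expansion hE hk hM ∅
  exact ⟨_, isWitness_expandModel hE hk hM h⟩

/-- An expansion of `M` extends to one of `N`, if `N` contains no new elements over `M`; the
further new elements may avoid a small set. -/
theorem IsWitness.exists_lift (hE : IsSmooth k E) (hk : k.IsEssAEC lam mu) {M N : Model τ}
    {S : Model (τ.expand lam)} (hM : IsWitness k E M S) (hMN : k.le M N)
    (hd : ∀ x ∈ N.carrier, x ∈ S.carrier → x ∈ M.carrier) (B : Set ZFSet.{u}) [Small.{u} B] :
    ∃ T, IsWitness k E N T ∧ (k.adjoin E).le S T ∧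
      ∀ x ∈ T.carrier, x ∈ B → x ∈ N.carrier ∨ x ∈ S.carrier := by
  classical
  have hNK := (hk.le_mem _ _ hMN).2
  have hS : Small.{u} S.carrier := hM.small_carrier hE hk
  obtain ⟨c', G', hn', hc', hG'⟩ := exists_expansion hE hk hNK (B ∪ S.carrier)
  have hn := hM.naming hE hk
  have hmem := fun {a} (ha : E M a a) i => hE.mem_left hk hM.mem ha i
  have hin : ∀ {a}, E M a a → nameOf S a ∈ S.carrier := fun {a} ha =>
    Model.ev_mem S (.inr .F) fun i => hM.subset (hmem ha i)
  -- A class over `N` with a representative over `M` keeps the name it has in `S`; any other class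
  -- gets a fresh name, outside `S` and outside `B`.
  let G := fun a => if h : ∃ b, E M b b ∧ E N a b then nameOf S h.choose else G' a
  have hG1 : ∀ {a b}, E M b b → E N a b → G a = nameOf S b := by
    intro a b hb hab
    have h : ∃ b, E M b b ∧ E N a b := ⟨b, hb, hab⟩
    have h1 := h.choose_spec
    have h2 : G a = nameOf S h.choose := dif_pos h
    rw [h2, hn.2.2 _ _ h1.1 hb]
    exact hE.descend hk hMN (hmem h1.1) (hmem hb)
      (hE.trans N hNK _ _ _ (hE.symm N hNK _ _ h1.2) hab)
  have hG2 : ∀ {a}, (¬ ∃ b, E M b b ∧ E N a b) → G a = G' a := fun h => dif_neg h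
  have hmemN : ∀ {x}, x ∈ S.carrier → x ∉ M.carrier → x ∉ N.carrier :=
    fun h1 h2 h3 => h2 (hd _ h3 h1)
  have hnN : Naming E N (cst S) G := by
    refine ⟨hmemN (cst_mem S) hn.1, fun a ha => ?_, fun a b ha hb => ?_⟩
    · by_cases h : ∃ b, E M b b ∧ E N a b
      · obtain ⟨b, hb, hab⟩ := h
        rw [hG1 hb hab]
        exact ⟨hmemN (hin hb) (hn.2.1 b hb).1, (hn.2.1 b hb).2⟩
      · rw [hG2 h]
        exact ⟨(hn'.2.1 a ha).1, fun h' => hG' a ha (Or.inr (h' ▸ cst_mem S))⟩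
    · by_cases h : ∃ b, E M b b ∧ E N a b <;> by_cases h' : ∃ b', E M b' b' ∧ E N b b'
      · obtain ⟨a', ha', haa⟩ := h
        obtain ⟨b', hb', hbb⟩ := h'
        rw [hG1 ha' haa, hG1 hb' hbb, hn.2.2 _ _ ha' hb']
        constructor
        · exact fun h => hE.trans N hNK _ _ _ haa
            (hE.trans N hNK _ _ _ (hE.lift hk hMN h) (hE.symm N hNK _ _ hbb))
        · exact fun h => hE.descend hk hMN (hmem ha') (hmem hb')
            (hE.trans N hNK _ _ _ (hE.symm N hNK _ _ haa) (hE.trans N hNK _ _ _ h hbb))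
      · obtain ⟨a', ha', haa⟩ := h
        rw [hG1 ha' haa, hG2 h']
        refine iff_of_false (fun h => hG' b hb (Or.inr (h ▸ hin ha'))) fun h => h' ⟨a', ha', ?_⟩
        exact hE.trans N hNK _ _ _ (hE.symm N hNK _ _ h) haa
      · obtain ⟨b', hb', hbb⟩ := h'
        rw [hG1 hb' hbb, hG2 h]
        refine iff_of_false (fun h => hG' a ha (Or.inr (h ▸ hin hb'))) fun h' => h ⟨b', hb', ?_⟩
        exact hE.trans N hNK _ _ _ h' hbb
      · rw [hG2 h, hG2 h']
        exact hn'.2.2 a b ha hb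
  have hw := isWitness_expandModel hE hk hNK hnN
  refine ⟨_, hw, (hM.le_iff hw).2 ⟨?_, hMN⟩, ?_⟩
  · have := expandModel_sub hE hk hMN hnN rfl fun a ha => (hG1 ha (hE.lift hk hMN ha)).symm
    rwa [← hM.eq_expandModel hE hk] at this
  · rintro x (hx | rfl | ⟨a, ha, rfl⟩) hxB
    · exact Or.inl hx
    · exact Or.inr (cst_mem S)
    · by_cases h : ∃ b, E M b b ∧ E N a b
      · obtain ⟨b, hb, hab⟩ := h
        rw [hG1 hb hab]
        exact Or.inr (hin hb)
      · rw [hG2 h] at hxB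
        exact (hG' a ha (Or.inl hxB)).elim

theorem small_of_mem (hk : k.IsEssAEC lam mu) {M : Model τ} (hM : M ∈ k.K) :
    Small.{u} M.carrier :=
  small_iff_mk_lt.2 ((hk.card_lt M hM).trans_le (bound_le_univ _))

/-- Over an expansion of `M` there is an expansion of a copy of any model above `M`. -/
theorem IsWitness.exists_lift_copy (hE : IsSmooth k E) (hk : k.IsEssAEC lam mu) {M N : Model τ}
    {S : Model (τ.expand lam)} (hM : IsWitness k E M S) (hMN : k.le M N) :
    ∃ f N' T, Model.IsIso f N N' ∧ (∀ x ∈ M.carrier, f x = x) ∧ k.le M N' ∧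
      IsWitness k E N' T ∧ (k.adjoin E).le S T := by
  have hS : Small.{u} S.carrier := hM.small_carrier hE hk
  have h1 := small_of_mem hk hM.mem
  have h2 := small_of_mem hk (hk.le_mem _ _ hMN).2
  -- Moving `N` off `S`, while fixing `M`, makes it free of the new elements of `S`.
  obtain ⟨f, hf, hfM, hfN⟩ := exists_rename M.carrier N.carrier S.carrier
  have hi := Model.isIso_map hf
  have hle : k.le M (N.map f) := hk.iso_le f M N M _ hi (.of_fix hfM) hMN
  obtain ⟨T, hT, hST, -⟩ := hM.exists_lift hE hk hle (B := ∅) (by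
    rintro _ ⟨x, hx, rfl⟩ h
    by_contra hc
    exact hfN x hx (fun h' => hc ((hfM x h').symm ▸ h')) h)
  exact ⟨f, _, T, hi, hfM, hle, hT, hST⟩

end Adjoin

/-! ### Unions of chains and the axioms of an ess-AEC for the expanded class. -/

section AdjoinAEC

variable {τ : Vocab.{u}} {lam : Cardinal.{u}} {mu : WithTop Cardinal.{u}} {k : ModelClass τ}
  {E : SeqRel τ lam}

theorem ModelClass.IsEssAEC.aleph0_le_card (hk : k.IsEssAEC lam mu) {M : Model τ} (hM : M ∈ k.K) :
    ℵ₀ ≤ M.card :=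
  le_trans (by simpa using hk.infinite) (hk.card_ge M hM)

/-- Smallness bounds the number of names by the infinite cardinality of `M`, and the constant adds
one element. -/
theorem IsWitness.card_eq (hE : IsSmooth k E) (hsm : IsSmall k E) (hk : k.IsEssAEC lam mu)
    {M : Model τ} {S : Model (τ.expand lam)} (hM : IsWitness k E M S) : S.card = M.card := by
  have h0 := hk.aleph0_le_card hM.mem
  have hn := hM.naming hE hk
  apply le_antisymm
  · have h1 : #(nameOf S '' {a | E M a a}) ≤ M.card := by
      refine le_trans ?_ (hsm M hM.mem)
      refine mk_le_of_surjective
        (f := Quot.lift (fun a => (⟨nameOf S a.1, a.1, a.2, rfl⟩ : nameOf S '' {a | E M a a}))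
          fun a b h => Subtype.ext ((hn.2.2 _ _ a.2 b.2).2 h)) ?_
      rintro ⟨_, a, ha, rfl⟩
      exact ⟨Quot.mk _ ⟨a, ha⟩, rfl⟩
    rw [Model.card, hM.carrier_eq_union hE hk]
    refine (mk_union_le _ _).trans ((add_le_add le_rfl mk_insert_le).trans ?_)
    refine (add_le_add le_rfl (add_le_add h1 (one_le_aleph0.trans h0))).trans ?_
    rw [add_eq_self h0]
    exact (add_eq_self h0).le
  · exact mk_le_mk_of_subset hM.subset

theorem card_iUnion_le_of_increasing (hk : k.IsEssAEC lam mu) {i : Ordinal.{u}}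
    {M : Ordinal.{u} → Model τ} {N : Model τ} (h : ∀ j < i, k.le (M j) N) :
    (⋃ j ∈ Set.Iio i, (M j).carrier) ⊆ N.carrier :=
  Set.iUnion₂_subset fun j hj => (hk.le_sub _ _ (h j hj)).1

/-- A chain has an increasing continuous refinement with the same union. -/
theorem ModelClass.IncreasingBelow.exists_continuous (hk : k.IsEssAEC lam mu) {δ : Ordinal.{u}}
    (hδ : Order.IsSuccLimit δ) {M : Ordinal.{u} → Model τ} (hM : k.IncreasingBelow δ M)
    {U : Model τ} (hU : U ∈ k.K) (hc : U.carrier = ⋃ i ∈ Set.Iio δ, (M i).carrier)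
    (hle : ∀ i < δ, k.le (M i) U) :
    ∃ M' : Ordinal.{u} → Model τ, k.IncreasingContinuous δ M' ∧ M' δ = U ∧
      ∀ i < δ, k.le (M' i) (M i) := by
  classical
  -- At limit stages the model is replaced by the union of the earlier ones; the other stages below
  -- `δ` are kept.
  let P : Ordinal.{u} → Model τ → Prop := fun i V => Order.IsSuccLimit i ∧ V ∈ k.K ∧
    V.carrier = (⋃ j ∈ Set.Iio i, (M j).carrier) ∧ ∀ j < i, k.le (M j) V
  have hex : ∀ i ≤ δ, Order.IsSuccLimit i → ∃ V, P i V := by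
    intro i hi hl
    rcases hi.eq_or_lt with rfl | hi
    · exact ⟨U, hl, hU, hc, hle⟩
    · obtain ⟨V, ⟨h1, h2, h3⟩, -⟩ := hk.union i M hl (fun a b hab hb => hM a b hab (hb.trans hi)) <|
        (mk_le_mk_of_subset (card_iUnion_le_of_increasing hk fun j hj => hM j i hj.le hi)).trans_lt
          (hk.card_lt _ (hk.le_mem _ _ (hM i i le_rfl hi)).1)
      exact ⟨V, hl, h1, h2, h3⟩
  let M' : Ordinal.{u} → Model τ := fun i => if h : ∃ V, P i V then h.choose else M i
  have hlim : ∀ i ≤ δ, Order.IsSuccLimit i → P i (M' i) := by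
    intro i hi hl
    have h := hex i hi hl
    have : M' i = h.choose := dif_pos h
    rw [this]
    exact h.choose_spec
  have hnl : ∀ i, ¬ Order.IsSuccLimit i → M' i = M i := fun i h =>
    dif_neg fun ⟨V, hV⟩ => h hV.1
  have hbelow : ∀ i < δ, k.le (M' i) (M i) := by
    intro i hi
    by_cases hl : Order.IsSuccLimit i
    · obtain ⟨-, h1, h2, h3⟩ := hlim i hi.le hl
      exact hk.union_le i M _ _ hl (fun a b hab hb => hM a b hab (hb.trans hi)) h1 h2 h3
        fun j hj => hM j i hj.le hi
    · rw [hnl i hl]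
      exact hM i i le_rfl hi
  refine ⟨M', ⟨?_, ?_⟩, ?_, hbelow⟩
  · intro i j hij hj
    rcases hij.eq_or_lt with rfl | hij
    · by_cases hl : Order.IsSuccLimit i
      · exact hk.refl _ (hlim i hj hl).2.1
      · rcases hj.eq_or_lt with rfl | hj
        · exact (hl hδ).elim
        · exact hk.refl _ (hk.le_mem _ _ (hbelow i hj)).1
    · refine hk.trans _ _ _ (hbelow i (hij.trans_le hj)) ?_
      by_cases hl : Order.IsSuccLimit j
      · exact (hlim j hj hl).2.2.2 i hij
      · rw [hnl j hl]
        rcases hj.eq_or_lt with rfl | hj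
        · exact (hl hδ).elim
        · exact hM i j hij.le hj
  · intro j hj hl
    rw [(hlim j hj hl).2.2.1]
    apply Set.Subset.antisymm
    · refine Set.iUnion₂_subset fun i hi => ?_
      have h1 : Order.succ i < j := hl.succ_lt hi
      -- Stage `i` may have been shrunk, but the successor stage is still below `j` and unchanged,
      -- and it contains the original `M i`.
      refine Set.Subset.trans ?_ (Set.subset_biUnion_of_mem (u := fun i => (M' i).carrier) h1)
      have h2 : ¬ Order.IsSuccLimit (Order.succ i) := fun h =>
        (h.succ_lt (Order.lt_succ i)).ne rfl
      simp only [hnl _ h2]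
      exact (hk.le_sub _ _ (hM _ _ (Order.le_succ i) (h1.trans_le hj))).1
    · refine Set.iUnion₂_mono fun i hi => ?_
      exact (hk.le_sub _ _ (hbelow i (lt_of_lt_of_le hi hj))).1
  · obtain ⟨-, h1, h2, h3⟩ := hlim δ le_rfl hδ
    have := hk.union_le δ M _ U hδ hM h1 h2 h3 hle
    exact (hk.le_sub _ _ this).eq_of_subset (hc.trans h2.symm).subset

/-- Removes continuity of the chain from the continuity axiom: a representative found in the
continuous refinement lies in the original chain, whose members are larger. -/
theorem IsSmooth.exists_rep (hE : IsSmooth k E) (hk : k.IsEssAEC lam mu) {δ : Ordinal.{u}}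
    (hδ : Order.IsSuccLimit δ) {M : Ordinal.{u} → Model τ} (hM : k.IncreasingBelow δ M)
    {U : Model τ} (hU : U ∈ k.K) (hc : U.carrier = ⋃ i ∈ Set.Iio δ, (M i).carrier)
    (hle : ∀ i < δ, k.le (M i) U) {a : ModelClass.Idx lam → ZFSet.{u}} (ha : E U a a) :
    ∃ i < δ, ∃ b, E (M i) b b ∧ E U a b := by
  obtain ⟨M', h1, rfl, h3⟩ := hM.exists_continuous hk hδ hU hc hle
  obtain ⟨i, hi, b, hb, hab⟩ := hE.continuous δ M' hδ h1 a ha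
  exact ⟨i, hi, b, hE.lift hk (h3 i hi) hb, hab⟩

theorem IsWitness.le_of_le {S T : Model (τ.expand lam)} {M N : Model τ} (hM : IsWitness k E M S)
    (hN : IsWitness k E N T) (h : (k.adjoin E).le S T) : k.le M N :=
  ((hM.le_iff hN).1 h).2

theorem IsWitness.carrier_iUnion {δ : Ordinal.{u}} {S : Ordinal.{u} → Model (τ.expand lam)}
    {W : Ordinal.{u} → Model τ} (hW : ∀ i < δ, IsWitness k E (W i) (S i))
    {T : Model (τ.expand lam)} {U : Model τ}
    (hU : IsWitness k E U T) (hT : T.carrier = ⋃ i ∈ Set.Iio δ, (S i).carrier)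
    (hle : ∀ i < δ, (k.adjoin E).le (S i) T) : U.carrier = ⋃ i ∈ Set.Iio δ, (W i).carrier := by
  apply Set.Subset.antisymm
  · intro x hx
    have := hU.subset hx
    rw [hT] at this
    simp only [Set.mem_iUnion] at this ⊢
    obtain ⟨i, hi, hxi⟩ := this
    exact ⟨i, hi, ((hW i hi).mem_of_mem hU (hle i hi).1 hxi).2 hx⟩
  · refine Set.iUnion₂_subset fun i hi x hx => ?_
    exact ((hW i hi).mem_of_mem hU (hle i hi).1 ((hW i hi).subset hx)).1 hx

theorem pos_of_isSuccLimit {δ : Ordinal.{u}} (hδ : Order.IsSuccLimit δ) : 0 < δ := hδ.bot_lt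

/-- The witnesses satisfy the corresponding statement, so only names are at issue. Each class over
the union has a representative at some stage `i`, and both `T` and `L` name it as `S i` does. -/
theorem adjoin_union_le (hE : IsSmooth k E) (hk : k.IsEssAEC lam mu) {δ : Ordinal.{u}}
    (hδ : Order.IsSuccLimit δ) {S : Ordinal.{u} → Model (τ.expand lam)}
    (hS : (k.adjoin E).IncreasingBelow δ S) {T L : Model (τ.expand lam)}
    (hTK : T ∈ (k.adjoin E).K) (hT : T.carrier = ⋃ i ∈ Set.Iio δ, (S i).carrier)
    (hle : ∀ i < δ, (k.adjoin E).le (S i) T) (hle' : ∀ i < δ, (k.adjoin E).le (S i) L) :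
    (k.adjoin E).le T L := by
  obtain ⟨U, hU⟩ := hTK
  have hpos := pos_of_isSuccLimit hδ
  obtain ⟨V, hV⟩ : ∃ V, IsWitness k E V L := by
    obtain ⟨-, _, V, _, hV, _⟩ := hle' 0 hpos
    exact ⟨V, hV⟩
  have hex : ∀ i, ∃ W, i < δ → IsWitness k E W (S i) := fun i => by
    by_cases hi : i < δ
    · obtain ⟨-, W, _, hW, _, _⟩ := hle i hi
      exact ⟨W, fun _ => hW⟩
    · exact ⟨U, fun h => (hi h).elim⟩
  choose W hW using hex
  have hWinc : k.IncreasingBelow δ W := fun i j hij hj =>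
    (hW i (hij.trans_lt hj)).le_of_le (hW j hj) (hS i j hij hj)
  have hUc := hU.carrier_iUnion hW hT hle
  have hWU : ∀ i < δ, k.le (W i) U := fun i hi => (hW i hi).le_of_le hU (hle i hi)
  have hUV : k.le U V := hk.union_le δ W U V hδ hWinc hU.mem hUc hWU
    fun i hi => (hW i hi).le_of_le hV (hle' i hi)
  rw [hU.le_iff hV]
  refine ⟨?_, hUV⟩
  have hnU := hU.naming hE hk
  have hnV := hV.naming hE hk
  have hsub : (expandModel E U (cst T) (nameOf T)).Sub (expandModel E V (cst L) (nameOf L)) := by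
    refine expandModel_sub hE hk hUV hnV ?_ fun a ha => ?_
    · rw [(expand_sub_iff.1 (hle 0 hpos).1).2.1, (expand_sub_iff.1 (hle' 0 hpos).1).2.1]
    · obtain ⟨i, hi, b, hb, hab⟩ := hE.exists_rep hk hδ hWinc hU.mem hUc hWU ha
      have hbS := fun j => (hW i hi).subset (hE.mem_left hk (hW i hi).mem hb j)
      rw [(hnU.2.2 a b ha (hE.refl_right hU.mem hab)).2 hab,
        (hnV.2.2 a b (hE.lift hk hUV ha) (hE.lift hk hUV (hE.refl_right hU.mem hab))).2
          (hE.lift hk hUV hab), (expand_sub_iff.1 (hle i hi).1).2.2.1 b hbS,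
        (expand_sub_iff.1 (hle' i hi).1).2.2.1 b hbS]
  rwa [← hU.eq_expandModel hE hk, ← hV.eq_expandModel hE hk] at hsub

/-- A class over the union of the witnesses takes the name that some stage already gives to one of
its representatives. Continuity of `E` gives such a stage, and hence the new elements are exactly
those of the chain. -/
theorem adjoin_exists_union (hE : IsSmooth k E) (hk : k.IsEssAEC lam mu) {δ : Ordinal.{u}}
    (hδ : Order.IsSuccLimit δ) {S : Ordinal.{u} → Model (τ.expand lam)}
    (hS : (k.adjoin E).IncreasingBelow δ S) {W : Ordinal.{u} → Model τ}
    (hW : ∀ i < δ, IsWitness k E (W i) (S i)) {U : Model τ} (hU : U ∈ k.K)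
    (hUc : U.carrier = ⋃ i ∈ Set.Iio δ, (W i).carrier) (hWU : ∀ i < δ, k.le (W i) U) :
    ∃ T, IsWitness k E U T ∧ T.carrier = (⋃ i ∈ Set.Iio δ, (S i).carrier) ∧
      ∀ i < δ, (k.adjoin E).le (S i) T := by
  classical
  have hpos := pos_of_isSuccLimit hδ
  have hWinc : k.IncreasingBelow δ W := fun i j hij hj =>
    (hW i (hij.trans_lt hj)).le_of_le (hW j hj) (hS i j hij hj)
  have hmem : ∀ {i}, i < δ → ∀ {b}, E (W i) b b → ∀ j, b j ∈ (W i).carrier := fun {i} hi {b} hb =>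
    hE.mem_left hk (hW i hi).mem hb
  have hmono : ∀ {i j b}, i ≤ j → j < δ → E (W i) b b →
      nameOf (S j) b = nameOf (S i) b := fun {i j b} hij hj hb =>
    (expand_sub_iff.1 (hS i j hij hj).1).2.2.1 b
      fun l => (hW i (hij.trans_lt hj)).subset (hmem (hij.trans_lt hj) hb l)
  have hcst : ∀ i < δ, cst (S i) = cst (S 0) := fun i hi =>
    (expand_sub_iff.1 (hS 0 i zero_le hi).1).2.1
  -- Names from two stages are compared in the larger one. This makes the name independent of the
  -- stage and of the representative, and distinct classes get distinct names.
  have hcompat : ∀ {i j b b'}, i < δ → j < δ → E (W i) b b → E (W j) b' b' →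
      (nameOf (S i) b = nameOf (S j) b' ↔ E U b b') := by
    intro i j b b' hi hj hb hb'
    have hm : max i j < δ := max_lt hi hj
    have hbm := hE.lift hk (hWinc _ _ (le_max_left i j) hm) hb
    have hbm' := hE.lift hk (hWinc _ _ (le_max_right i j) hm) hb'
    rw [← hmono (le_max_left i j) hm hb, ← hmono (le_max_right i j) hm hb',
      ((hW _ hm).naming hE hk).2.2 b b' hbm hbm']
    exact ⟨hE.lift hk (hWU _ hm), hE.descend hk (hWU _ hm) (hmem hm hbm) (hmem hm hbm')⟩
  have hnot : ∀ {i x}, i < δ → x ∈ (S i).carrier → x ∉ (W i).carrier → x ∉ U.carrier := by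
    intro i x hi hx hxW hxU
    rw [hUc] at hxU
    simp only [Set.mem_iUnion] at hxU
    obtain ⟨j, hj, hxj⟩ := hxU
    replace hj : j < δ := hj
    have hm : max i j < δ := max_lt hi hj
    refine hxW (((hW i hi).mem_of_mem (hW _ hm) (hS i _ (le_max_left i j) hm).1 hx).2 ?_)
    exact (hk.le_sub _ _ (hWinc _ _ (le_max_right i j) hm)).1 hxj
  have hin : ∀ {i b}, i < δ → E (W i) b b → nameOf (S i) b ∈ (S i).carrier := fun {i b} hi hb =>
    Model.ev_mem (S i) (.inr .F) fun l => (hW i hi).subset (hmem hi hb l)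
  let G : (ModelClass.Idx lam → ZFSet.{u}) → ZFSet.{u} := fun a =>
    if h : ∃ p : Ordinal.{u} × (ModelClass.Idx lam → ZFSet.{u}),
      p.1 < δ ∧ E (W p.1) p.2 p.2 ∧ E U a p.2 then nameOf (S h.choose.1) h.choose.2 else ∅
  have hG : ∀ {a i b}, i < δ → E (W i) b b → E U a b → G a = nameOf (S i) b := by
    intro a i b hi hb hab
    have h : ∃ p : Ordinal.{u} × (ModelClass.Idx lam → ZFSet.{u}),
      p.1 < δ ∧ E (W p.1) p.2 p.2 ∧ E U a p.2 := ⟨(i, b), hi, hb, hab⟩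
    have h1 : G a = nameOf (S h.choose.1) h.choose.2 := dif_pos h
    obtain ⟨h2, h3, h4⟩ := h.choose_spec
    rw [h1, hcompat h2 hi h3 hb]
    exact hE.trans U hU _ _ _ (hE.symm U hU _ _ h4) hab
  have hrep := fun {a} (ha : E U a a) => hE.exists_rep hk hδ hWinc hU hUc hWU ha
  have hn : Naming E U (cst (S 0)) G := by
    refine ⟨hnot hpos (cst_mem _) ((hW 0 hpos).naming hE hk).1, fun a ha => ?_,
      fun a b ha hb => ?_⟩
    · obtain ⟨i, hi, b, hb, hab⟩ := hrep ha
      have hni := ((hW i hi).naming hE hk).2.1 b hb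
      rw [hG hi hb hab, ← hcst i hi]
      exact ⟨hnot hi (hin hi hb) hni.1, hni.2⟩
    · obtain ⟨i, hi, a', ha', haa⟩ := hrep ha
      obtain ⟨j, hj, b', hb', hbb⟩ := hrep hb
      rw [hG hi ha' haa, hG hj hb' hbb, hcompat hi hj ha' hb']
      constructor
      · exact fun h => hE.trans U hU _ _ _ haa
          (hE.trans U hU _ _ _ h (hE.symm U hU _ _ hbb))
      · exact fun h => hE.trans U hU _ _ _ (hE.symm U hU _ _ haa)
          (hE.trans U hU _ _ _ h hbb)
  have hw := isWitness_expandModel hE hk hU hn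
  have hle : ∀ i < δ, (k.adjoin E).le (S i) (expandModel E U (cst (S 0)) G) := by
    intro i hi
    refine ((hW i hi).le_iff hw).2 ⟨?_, hWU i hi⟩
    have := expandModel_sub hE hk (hWU i hi) hn (hcst i hi) fun a ha =>
      (hG hi ha (hE.lift hk (hWU i hi) ha)).symm
    rwa [← (hW i hi).eq_expandModel hE hk] at this
  refine ⟨_, hw, ?_, hle⟩
  apply Set.Subset.antisymm
  · rintro x (hx | rfl | ⟨a, ha, rfl⟩)
    · rw [hUc] at hx
      refine Set.iUnion₂_mono (fun i hi => ?_) hx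
      exact (hW i hi).subset
    · exact Set.mem_biUnion (show (0 : Ordinal.{u}) ∈ Set.Iio δ from hpos) (cst_mem _)
    · obtain ⟨i, hi, b, hb, hab⟩ := hrep ha
      rw [hG hi hb hab]
      exact Set.mem_biUnion (show i ∈ Set.Iio δ from hi) (hin hi hb)
  · exact Set.iUnion₂_subset fun i hi => (hle i hi).1.1

/-- Each element of `A` is present as soon as at most `lam` elements of the witness are: itself if
it is old, none for the constant, the range of a representing tuple for a name. Löwenheim–Skolem is
applied to the union of these sets. -/
theorem IsWitness.lowenheimSkolem (hE : IsSmooth k E) (hk : k.IsEssAEC lam mu)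
    {N : Model τ} {T : Model (τ.expand lam)} (hN : IsWitness k E N T)
    (A : Set ZFSet.{u}) (hA : A ⊆ T.carrier) :
    ∃ M, k.le M N ∧ A ⊆ (EssFrame.restr E T M).carrier ∧
      M.card ≤ Cardinal.lift.{u + 1, u} lam + #A := by
  classical
  have hinf : ℵ₀ ≤ lift.{u + 1, u} lam := by simpa using hk.infinite
  have hex : ∀ x : A, ∃ B : Set ZFSet.{u}, B ⊆ N.carrier ∧ #B ≤ lift.{u + 1, u} lam ∧
      ∀ M, k.le M N → B ⊆ M.carrier → x.1 ∈ (EssFrame.restr E T M).carrier := by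
    rintro ⟨x, hx⟩
    have := hA hx
    rw [hN.carrier_eq_union hE hk] at this
    rcases this with h | rfl | ⟨a, ha, rfl⟩
    · exact ⟨{x}, by simpa using h, by simpa using one_le_aleph0.trans hinf,
        fun M _ hB => Or.inl (hB rfl)⟩
    · exact ⟨∅, by simp, by simp, fun M _ _ => Or.inr (Or.inl rfl)⟩
    · have hm := fun i => hE.mem_left hk hN.mem ha i
      refine ⟨Set.range a, Set.range_subset_iff.2 hm, ?_, fun M hM hB => ?_⟩
      · have := mk_range_le_lift (f := a)
        rw [show lift.{u, u + 1} #(Set.range a) = #(Set.range a) from lift_id'.{u, u + 1} _] at this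
        simpa using this
      · have hm' : ∀ i, a i ∈ M.carrier := fun i => hB (Set.mem_range_self i)
        exact Or.inr (Or.inr ⟨a, hE.descend hk hM hm' hm' ha, rfl⟩)
  choose B hB1 hB2 hB3 using hex
  obtain ⟨M, h1, h2, h3⟩ := hk.lowenheimSkolem N (⋃ x, B x) hN.mem (Set.iUnion_subset hB1)
  refine ⟨M, h2, fun x hx => hB3 ⟨x, hx⟩ M h2 ((Set.subset_iUnion B ⟨x, hx⟩).trans h1), ?_⟩
  refine h3.trans ?_
  have h4 : #(⋃ x, B x) ≤ #A * lift.{u + 1, u} lam :=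
    (mk_iUnion_le_sum_mk).trans ((sum_le_sum _ _ hB2).trans (by simp))
  have h5 : #A * lift.{u + 1, u} lam ≤ lift.{u + 1, u} lam + #A := by
    rw [add_comm, add_eq_max' hinf]
    exact mul_le_max_of_aleph0_le_right hinf
  refine (add_le_add le_rfl (h4.trans h5)).trans ?_
  rw [← add_assoc, add_eq_self hinf]

/-- Adding names for the classes of a small smooth equivalence relation yields an essentially
abstract elementary class. -/
theorem adjoin_isEssAEC (hE : IsSmooth k E) (hsm : IsSmall k E) (hk : k.IsEssAEC lam mu) :
    (k.adjoin E).IsEssAEC lam mu where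
  infinite := hk.infinite
  lam_lt := hk.lam_lt
  fnArity_le := by
    rintro (F | (_ | _))
    · exact hk.fnArity_le F
    · change #(lam.ord.ToType) ≤ lam
      simp
    · change #PEmpty ≤ lam
      simp
  rlArity_le := by
    rintro (_ | R)
    · change #PUnit ≤ lam
      simpa using one_le_aleph0.trans hk.infinite
    · exact hk.rlArity_le R
  le_mem := by
    rintro S T ⟨-, M, N, hM, hN, -⟩
    exact ⟨⟨M, hM⟩, ⟨N, hN⟩⟩
  iso_mem := by
    rintro f S T hf ⟨M, hM⟩
    exact ⟨_, (hM.map hE hk hf).1⟩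
  iso_le := by
    rintro f S₁ T₁ S₂ T₂ hT hS ⟨hs, M, N, hM, hN, h⟩
    obtain ⟨h1, h2⟩ := hM.map hE hk hS
    obtain ⟨h3, h4⟩ := hN.map hE hk hT
    exact ⟨hT.sub hS hs, _, _, h1, h3, hk.iso_le _ _ _ _ _ h4 h2 h⟩
  card_ge := by
    rintro S ⟨M, hM⟩
    exact (hk.card_ge M hM.mem).trans (mk_le_mk_of_subset hM.subset)
  card_lt := by
    rintro S ⟨M, hM⟩
    rw [hM.card_eq hE hsm hk]
    exact hk.card_lt M hM.mem
  refl := by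
    rintro S ⟨M, hM⟩
    exact ⟨.refl S, M, M, hM, hM, hk.refl M hM.mem⟩
  trans := by
    rintro S₁ S₂ S₃ ⟨h1, M₁, M₂, hM₁, hM₂, h⟩ ⟨h2, M₂', M₃, hM₂', hM₃, h'⟩
    obtain rfl := hM₂.unique hM₂'
    exact ⟨h1.trans h2, M₁, M₃, hM₁, hM₃, hk.trans _ _ _ h h'⟩
  antisymm := fun S T h h' => h.1.eq_of_subset h'.1.1
  le_sub := fun S T h => h.1
  union := by
    intro δ S hδ hS hcard
    have hex : ∀ i, ∃ W, i < δ → IsWitness k E W (S i) := fun i => by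
      by_cases hi : i < δ
      · obtain ⟨-, W, _, hW, _, _⟩ := hS i i le_rfl hi
        exact ⟨W, fun _ => hW⟩
      · obtain ⟨-, W, _⟩ := hS 0 0 le_rfl (pos_of_isSuccLimit hδ)
        exact ⟨W, fun h => (hi h).elim⟩
    choose W hW using hex
    have hWinc : k.IncreasingBelow δ W := fun i j hij hj =>
      (hW i (hij.trans_lt hj)).le_of_le (hW j hj) (hS i j hij hj)
    obtain ⟨U, ⟨hU, hUc, hWU⟩, -⟩ := hk.union δ W hδ hWinc <| (mk_le_mk_of_subset
      (Set.iUnion₂_mono fun i hi => (hW i hi).subset)).trans_lt hcard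
    obtain ⟨T, hT, hTc, hST⟩ := adjoin_exists_union hE hk hδ hS hW hU hUc hWU
    refine ⟨T, ⟨⟨U, hT⟩, hTc, hST⟩, ?_⟩
    rintro T' ⟨hT', hTc', hST'⟩
    -- Two unions of the same chain are comparable and have the same universe.
    exact (adjoin_union_le hE hk hδ hS hT' hTc' hST' hST).1.eq_of_subset (hTc.trans hTc'.symm).subset
  union_le := fun δ S T L hδ hS hT hTc h h' => adjoin_union_le hE hk hδ hS hT hTc h h'
  coherent := by
    rintro S₁ S₂ T hs ⟨h1, M₁, N, hM₁, hN, h⟩ ⟨h2, M₂, N', hM₂, hN', h'⟩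
    obtain rfl := hN.unique hN'
    exact ⟨hs, M₁, M₂, hM₁, hM₂, hk.coherent _ _ _ (hM₁.sub hM₂ hs) h h'⟩
  lowenheimSkolem := by
    rintro T A ⟨N, hN⟩ hA
    obtain ⟨M, h1, h2, h3⟩ := hN.lowenheimSkolem hE hk A hA
    exact ⟨_, h2, hN.restr_le hE hk h1, by rwa [(hN.restr hE hk h1).card_eq hE hsm hk]⟩

/-- Adding names does not change the number of isomorphism types. -/
theorem numIso_adjoin (hE : IsSmooth k E) (hsm : IsSmall k E) (hk : k.IsEssAEC lam mu)
    (κ : Cardinal.{u}) : (k.adjoin E).numIso κ = k.numIso κ := by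
  have hex : ∀ S : {S : Model (τ.expand lam) // S ∈ (k.adjoin E).K ∧ S.card = lift.{u + 1, u} κ},
      ∃ M : {M : Model τ // M ∈ k.K ∧ M.card = lift.{u + 1, u} κ}, IsWitness k E M.1 S.1 := by
    rintro ⟨S, ⟨M, hM⟩, hc⟩
    exact ⟨⟨M, hM.mem, by rwa [← hM.card_eq hE hsm hk]⟩, hM⟩
  have hex' : ∀ M : {M : Model τ // M ∈ k.K ∧ M.card = lift.{u + 1, u} κ},
      ∃ S : {S : Model (τ.expand lam) // S ∈ (k.adjoin E).K ∧ S.card = lift.{u + 1, u} κ},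
        IsWitness k E M.1 S.1 := by
    rintro ⟨M, hM, hc⟩
    obtain ⟨S, hS⟩ := exists_witnessed hE hk hM
    exact ⟨⟨S, ⟨M, hS⟩, by rwa [hS.card_eq hE hsm hk]⟩, hS⟩
  choose W hW using hex
  choose X hX using hex'
  refine Cardinal.mk_congr ⟨Quot.map W ?_, Quot.map X ?_, ?_, ?_⟩
  · rintro S T ⟨f, hf⟩
    exact ⟨f, (hW S).isIso hE hk (hW T) hf⟩
  · rintro M N ⟨f, hf⟩
    obtain ⟨g, hg, -⟩ := (hX M).exists_isIso hE hk (hX N) hf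
    exact ⟨g, hg⟩
  · rintro ⟨S⟩
    refine Quot.sound ?_
    obtain ⟨g, hg, -⟩ := (hX (W S)).exists_isIso hE hk (hW S) (.refl _)
    exact ⟨g, hg⟩
  · rintro ⟨M⟩
    refine congrArg (Quot.mk _) (Subtype.ext ?_)
    exact (hW (X M)).unique (hX M)

end AdjoinAEC

/-! ### Löwenheim–Skolem submodels along a chain. -/

section Chains

variable {τ : Vocab.{u}} {lam : Cardinal.{u}} {mu : WithTop Cardinal.{u}} {k : ModelClass τ}

theorem mk_iUnion_Iio_le {i : Ordinal.{u}} {N : Ordinal.{u} → Set ZFSet.{u}}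
    {θ : Cardinal.{u + 1}} (hθ : ℵ₀ ≤ θ) (hi : lift.{u + 1, u} i.card ≤ θ)
    (hN : ∀ j < i, #(N j) ≤ θ) : #(⋃ j ∈ Set.Iio i, N j : Set ZFSet.{u}) ≤ θ := by
  rw [Set.biUnion_eq_iUnion]
  refine mk_iUnion_le_sum_mk.trans
    ((sum_le_sum _ (fun _ : Set.Iio i => θ) fun j : Set.Iio i => hN j.1 j.2).trans ?_)
  rw [sum_const', mk_Iio_ordinal]
  exact (mul_le_mul_left hi θ).trans (mul_eq_self hθ).le

/-- Löwenheim–Skolem for chains. -/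
theorem ModelClass.IncreasingBelow.exists_subchain (hk : k.IsEssAEC lam mu) {δ : Ordinal.{u}}
    {M : Ordinal.{u} → Model τ} (hM : k.IncreasingBelow δ M) {A : Ordinal.{u} → Set ZFSet.{u}}
    (hA : ∀ i < δ, A i ⊆ (M i).carrier) :
    ∃ N : Ordinal.{u} → Model τ, k.IncreasingBelow δ N ∧
      ∀ i < δ, k.le (N i) (M i) ∧ A i ⊆ (N i).carrier ∧
        ∀ θ : Cardinal.{u + 1}, lift.{u + 1, u} lam ≤ θ → lift.{u + 1, u} i.card ≤ θ →
          (∀ j ≤ i, #(A j) ≤ θ) → (N i).card ≤ θ := by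
  classical
  have hinf : ℵ₀ ≤ lift.{u + 1, u} lam := by simpa using hk.infinite
  -- The recursion takes for `N i` a Löwenheim–Skolem submodel of `M i` containing `A i` and `B`,
  -- the union of the earlier `N j`; coherence then makes the sequence increasing.
  let Q : Ordinal.{u} → Set ZFSet.{u} → Model τ → Prop := fun i B V =>
    A i ∪ B ⊆ V.carrier ∧ k.le V (M i) ∧
      V.card ≤ lift.{u + 1, u} lam + #(A i ∪ B : Set ZFSet.{u})
  let F : ∀ i : Ordinal.{u}, (∀ j, j < i → Model τ) → Model τ := fun i r =>
    if h : ∃ V, Q i (⋃ (j) (hj : j < i), (r j hj).carrier) V then h.choose else M i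
  let N : Ordinal.{u} → Model τ := WellFounded.fix Ordinal.lt_wf F
  have hN : ∀ i, N i = F i fun j _ => N j := fun i => WellFounded.fix_eq Ordinal.lt_wf F i
  have hQ : ∀ i < δ, Q i (⋃ j ∈ Set.Iio i, (N j).carrier) (N i) := by
    intro i
    induction i using WellFoundedLT.induction with
    | ind i ih =>
      intro hi
      have hB : A i ∪ (⋃ j ∈ Set.Iio i, (N j).carrier) ⊆ (M i).carrier :=
        Set.union_subset (hA i hi) <| Set.iUnion₂_subset fun j hj =>
          (hk.le_sub _ _ (hk.trans _ _ _ (ih j hj (hj.trans hi)).2.1 (hM j i (le_of_lt hj) hi))).1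
      have h : ∃ V, Q i (⋃ j ∈ Set.Iio i, (N j).carrier) V :=
        hk.lowenheimSkolem (M i) _ (hk.le_mem _ _ (hM i i le_rfl hi)).1 hB
      have h1 : N i = h.choose := (hN i).trans (dif_pos h)
      rw [h1]
      exact h.choose_spec
  refine ⟨N, fun i j hij hj => ?_, fun i hi => ⟨(hQ i hi).2.1,
    Set.subset_union_left.trans (hQ i hi).1, fun θ hθ => ?_⟩⟩
  · rcases hij.eq_or_lt with rfl | hij
    · exact hk.refl _ (hk.le_mem _ _ (hQ i hj).2.1).1
    · have h1 := hk.trans _ _ _ (hQ i (hij.trans hj)).2.1 (hM i j hij.le hj)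
      have h2 := (hQ j hj).2.1
      refine hk.coherent _ _ _ ((hk.le_sub _ _ h1).of_subset (hk.le_sub _ _ h2) ?_) h1 h2
      exact (Set.subset_biUnion_of_mem (u := fun i => (N i).carrier) (show i ∈ Set.Iio j from hij)).trans
        (Set.subset_union_right.trans (hQ j hj).1)
  · induction i using WellFoundedLT.induction with
    | ind i ih =>
      intro hiθ hAθ
      have h0 := hinf.trans hθ
      refine (hQ i hi).2.2.trans ?_
      refine (add_le_add hθ ((mk_union_le _ _).trans (add_le_add (hAθ i le_rfl)
        (mk_iUnion_Iio_le h0 hiθ fun j hj => ih j hj (hj.trans hi) ?_ ?_)))).trans ?_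
      · exact (lift_le.2 (Ordinal.card_le_card hj.le)).trans hiθ
      · exact fun l hl => hAθ l (hl.trans hj.le)
      · rw [add_eq_self h0, add_eq_self h0]

end Chains

/-! The class generated by the models of cardinality `lam` -/

section Up

variable {τ : Vocab.{u}} {lam : Cardinal.{u}} {mu : WithTop Cardinal.{u}} {k : ModelClass τ}
  {E : SeqRel τ lam}

/-- The whole universe is one of the subsets that a member of `D` must include. -/
theorem ModelClass.Generates.self_mem {M : Model τ} {D : Set (Model τ)} (h : k.Generates lam D M)
    (hM : M.card = lift.{u + 1, u} lam) : M ∈ D := by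
  obtain ⟨N, hN, hMN⟩ := h.2.1 M.carrier subset_rfl hM.le
  rwa [← (h.1 N hN).2.2.eq_of_subset hMN]

theorem generates_below (hk : k.IsEssAEC lam mu) {M N : Model τ} (h : k.le M N)
    (hM : M.card = lift.{u + 1, u} lam) (hN : N.card = lift.{u + 1, u} lam) :
    k.Generates lam {M} M ∧ k.Generates lam {M, N} N := by
  have hs := hk.le_sub _ _ h
  obtain ⟨hMK, hNK⟩ := hk.le_mem _ _ h
  refine ⟨⟨?_, ?_, ?_⟩, ?_, ?_, ?_⟩
  · rintro _ rfl
    exact ⟨hMK, hM, .refl _⟩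
  · exact fun A hA _ => ⟨M, rfl, hA⟩
  · rintro _ rfl _ rfl _
    exact hk.refl _ hMK
  · rintro _ (rfl | rfl)
    · exact ⟨hMK, hM, hs⟩
    · exact ⟨hNK, hN, .refl _⟩
  · exact fun A hA _ => ⟨N, Or.inr rfl, hA⟩
  · rintro _ (rfl | rfl) _ (rfl | rfl) h'
    · exact hk.refl _ hMK
    · exact h
    · rw [hs.eq_of_subset h']; exact hk.refl _ hNK
    · exact hk.refl _ hNK

theorem card_lt_univ_of_eq {M : Model τ} {κ : Cardinal.{u}} (hM : M.card = lift.{u + 1, u} κ) :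
    M.card < bound ⊤ := by
  rw [hM]; exact lift_lt_univ κ

/-- Models of cardinality `lam` belong to every system that generates them, so the order inside the
system compares them directly. -/
theorem up_le_iff (hk : k.IsEssAEC lam mu) {M N : Model τ} (hM : M.card = lift.{u + 1, u} lam)
    (hN : N.card = lift.{u + 1, u} lam) : (k.up lam).le M N ↔ k.le M N := by
  constructor
  · rintro ⟨-, -, D, D', hD, h, h'⟩
    exact h'.2.2 _ (hD (h.self_mem hM)) _ (h'.self_mem hN) (h'.1 _ (hD (h.self_mem hM))).2.2.1
  · intro h
    obtain ⟨h1, h2⟩ := generates_below hk h hM hN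
    exact ⟨card_lt_univ_of_eq hM, card_lt_univ_of_eq hN, _, _, by simp, h1, h2⟩

theorem up_mem_iff (hk : k.IsEssAEC lam mu) {M : Model τ} (hM : M.card = lift.{u + 1, u} lam) :
    M ∈ (k.up lam).K ↔ M ∈ k.K := by
  constructor
  · rintro ⟨-, D, h⟩
    exact (h.1 _ (h.self_mem hM)).1
  · intro h
    exact ⟨card_lt_univ_of_eq hM, _, (generates_below hk (hk.refl M h) hM hM).1⟩

/-- The members of `D` included in `N` generate `N`. -/
theorem ModelClass.Generates.up_le {M N : Model τ} {D : Set (Model τ)} (h : k.Generates lam D M)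
    (hM : M.card < bound ⊤) (hN : N ∈ D) : (k.up lam).le N M := by
  obtain ⟨h1, h2, h3⟩ := h
  obtain ⟨hNK, hNc, hNM⟩ := h1 N hN
  refine ⟨card_lt_univ_of_eq hNc, hM, {L ∈ D | L.carrier ⊆ N.carrier}, D, fun L hL => hL.1,
    ⟨?_, ?_, ?_⟩, h1, h2, h3⟩
  · rintro L ⟨hL, hLN⟩
    exact ⟨(h1 L hL).1, (h1 L hL).2.1, (h1 L hL).2.2.of_subset hNM hLN⟩
  · exact fun A hA _ => ⟨N, ⟨hN, subset_rfl⟩, hA⟩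
  · exact fun N₁ h₁ N₂ h₂ h => h3 N₁ h₁.1 N₂ h₂.1 h

/-- The models of cardinality `lam` below `M`. -/
def smallParts (k : ModelClass τ) (lam : Cardinal.{u}) (M : Model τ) : Set (Model τ) :=
  {N | (k.up lam).le N M ∧ N.card = lift.{u + 1, u} lam}

/-- A canonical generating system: it contains every other one, and coherence in the up-closure
orders it. It frees later arguments from the choice of a system. -/
theorem generates_smallParts (hk : k.IsEssAEC lam mu) (hu : (k.up lam).IsEssAEC lam ⊤)
    {M : Model τ} (hM : M ∈ (k.up lam).K) : k.Generates lam (smallParts k lam M) M := by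
  obtain ⟨hMc, D, hD⟩ := hM
  refine ⟨?_, fun A hA hAc => ?_, ?_⟩
  · rintro N ⟨hN, hNc⟩
    exact ⟨(up_mem_iff hk hNc).1 (hu.le_mem _ _ hN).1, hNc, hu.le_sub _ _ hN⟩
  · obtain ⟨N, hN, hAN⟩ := hD.2.1 A hA hAc
    exact ⟨N, ⟨hD.up_le hMc hN, (hD.1 N hN).2.1⟩, hAN⟩
  · rintro N₁ ⟨h₁, hc₁⟩ N₂ ⟨h₂, hc₂⟩ h
    exact (up_le_iff hk hc₁ hc₂).1 (hu.coherent _ _ _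
      ((hu.le_sub _ _ h₁).of_subset (hu.le_sub _ _ h₂) h) h₁ h₂)

/-- The extension of a relation to the class generated by the models of cardinality `lam`. -/
def upRel (k : ModelClass τ) (E : SeqRel τ lam) : SeqRel τ lam :=
  fun M a b => ∃ N ∈ smallParts k lam M, E N a b

theorem mk_Idx (lam : Cardinal.{u}) : #(ModelClass.Idx lam) = lam := by simp

theorem mk_range_le_of_le {ι : Type u} {κ : Cardinal.{u}} (a : ι → ZFSet.{u}) (h : #ι ≤ κ) :
    #(Set.range a) ≤ lift.{u + 1, u} κ := by
  have := mk_range_le_lift (f := a)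
  rw [show lift.{u, u + 1} #(Set.range a) = #(Set.range a) from lift_id'.{u, u + 1} _] at this
  exact this.trans (lift_le.2 h)

theorem mk_union_range_le {κ : Cardinal.{u}} (hκ : ℵ₀ ≤ κ) {A B : Set ZFSet.{u}}
    (hA : #A ≤ lift.{u + 1, u} κ) (hB : #B ≤ lift.{u + 1, u} κ) :
    #(A ∪ B : Set ZFSet.{u}) ≤ lift.{u + 1, u} κ :=
  (mk_union_le _ _).trans ((add_le_add hA hB).trans (add_eq_self (by simpa using hκ)).le)

theorem seq_card (hk : k.IsEssAEC lam mu) {N : Model τ} (hN : N ∈ k.K)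
    {a : ModelClass.Idx lam → ZFSet.{u}} (h : N.carrier = Set.range a) :
    N.card = lift.{u + 1, u} lam := by
  refine le_antisymm ?_ (hk.card_ge N hN)
  rw [Model.card, h]
  exact mk_range_le_of_le a (mk_Idx lam).le

/-- Any small part that contains both sequences decides `upRel`. -/
theorem upRel_iff (hk : k.IsEssAEC lam mu) (hu : (k.up lam).IsEssAEC lam ⊤) (hE : IsSmooth k E)
    {M N : Model τ} (hN : N ∈ smallParts k lam M) {a b : ModelClass.Idx lam → ZFSet.{u}}
    (ha : ∀ i, a i ∈ N.carrier) (hb : ∀ i, b i ∈ N.carrier) : upRel k E M a b ↔ E N a b := by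
  refine ⟨?_, fun h => ⟨N, hN, h⟩⟩
  rintro ⟨L, hL, h⟩
  obtain ⟨h1, h2, h3⟩ := generates_smallParts hk hu (hu.le_mem _ _ hN.1).2
  -- The relation is lifted from `L` to a common small part `P` and then descends to `N`.
  obtain ⟨P, hP, hsub⟩ := h2 (N.carrier ∪ L.carrier)
    (Set.union_subset (h1 N hN).2.2.1 (h1 L hL).2.2.1)
    (mk_union_range_le hk.infinite hN.2.le hL.2.le)
  have hNP := h3 N hN P hP (Set.subset_union_left.trans hsub)
  have hLP := h3 L hL P hP (Set.subset_union_right.trans hsub)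
  exact hE.descend hk hNP ha hb (hE.lift hk hLP h)

theorem upRel_mem (hk : k.IsEssAEC lam mu) (hu : (k.up lam).IsEssAEC lam ⊤) (hE : IsSmooth k E)
    {M : Model τ} {a b : ModelClass.Idx lam → ZFSet.{u}}
    (h : upRel k E M a b) (i) : a i ∈ M.carrier := by
  obtain ⟨N, hN, h⟩ := h
  exact (hu.le_sub _ _ hN.1).1
    (hE.mem_left hk ((up_mem_iff hk hN.2).1 (hu.le_mem _ _ hN.1).1) h i)

theorem exists_smallPart (hk : k.IsEssAEC lam mu) (hu : (k.up lam).IsEssAEC lam ⊤) {M : Model τ}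
    (hM : M ∈ (k.up lam).K) (a b c : ModelClass.Idx lam → ZFSet.{u})
    (ha : ∀ i, a i ∈ M.carrier) (hb : ∀ i, b i ∈ M.carrier) (hc : ∀ i, c i ∈ M.carrier) :
    ∃ N ∈ smallParts k lam M, (∀ i, a i ∈ N.carrier) ∧ (∀ i, b i ∈ N.carrier) ∧
      ∀ i, c i ∈ N.carrier := by
  have hr := fun a : ModelClass.Idx lam → ZFSet.{u} => mk_range_le_of_le a (mk_Idx lam).le
  obtain ⟨N, hN, hsub⟩ := (generates_smallParts hk hu hM).2.1
    (Set.range a ∪ (Set.range b ∪ Set.range c))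
    (Set.union_subset (Set.range_subset_iff.2 ha)
      (Set.union_subset (Set.range_subset_iff.2 hb) (Set.range_subset_iff.2 hc)))
    (mk_union_range_le hk.infinite (hr a) (mk_union_range_le hk.infinite (hr b) (hr c)))
  exact ⟨N, hN, fun i => hsub (Or.inl ⟨i, rfl⟩), fun i => hsub (Or.inr (Or.inl ⟨i, rfl⟩)),
    fun i => hsub (Or.inr (Or.inr ⟨i, rfl⟩))⟩

theorem upRel_eq (hk : k.IsEssAEC lam mu) (hu : (k.up lam).IsEssAEC lam ⊤) (hE : IsSmooth k E)
    {M : Model τ} (hM : M ∈ k.K) (hc : M.card = lift.{u + 1, u} lam) : upRel k E M = E M := by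
  have hMM : M ∈ smallParts k lam M := ⟨hu.refl _ ((up_mem_iff hk hc).2 hM), hc⟩
  funext a b
  refine propext ⟨fun h => ?_, fun h => ⟨M, hMM, h⟩⟩
  have hb : ∀ i, b i ∈ M.carrier := by
    obtain ⟨N, hN, h'⟩ := h
    have hNK := (up_mem_iff hk hN.2).1 (hu.le_mem _ _ hN.1).1
    exact upRel_mem hk hu hE ⟨N, hN, hE.symm N hNK _ _ h'⟩
  exact (upRel_iff hk hu hE hMM (upRel_mem hk hu hE h) hb).1 h

theorem smallParts_mono (hu : (k.up lam).IsEssAEC lam ⊤) {M N : Model τ}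
    (h : (k.up lam).le M N) : smallParts k lam M ⊆ smallParts k lam N :=
  fun _ hL => ⟨hu.trans _ _ _ hL.1 h, hL.2⟩

theorem upRel_symm (hk : k.IsEssAEC lam mu) (hu : (k.up lam).IsEssAEC lam ⊤) (hE : IsSmooth k E)
    {M : Model τ} {a b : ModelClass.Idx lam → ZFSet.{u}} (h : upRel k E M a b) :
    upRel k E M b a := by
  obtain ⟨N, hN, h⟩ := h
  exact ⟨N, hN, hE.symm N ((up_mem_iff hk hN.2).1 (hu.le_mem _ _ hN.1).1) _ _ h⟩

/-- If the cofinality of the chain exceeds `lam`, a sequence of length `lam` lies in one stage.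
Otherwise a cofinal subchain can be thinned to models of cardinality `lam` whose union still
contains the sequence, and continuity of `E` applies there. -/
theorem upRel_continuous (hk : k.IsEssAEC lam mu) (hu : (k.up lam).IsEssAEC lam ⊤)
    (hE : IsSmooth k E) {δ : Ordinal.{u}} {M : Ordinal.{u} → Model τ} (hδ : Order.IsSuccLimit δ)
    (hM : (k.up lam).IncreasingContinuous δ M) {a : ModelClass.Idx lam → ZFSet.{u}}
    (ha : upRel k E (M δ) a a) :
    ∃ i < δ, ∃ b, upRel k E (M i) b b ∧ upRel k E (M δ) a b := by
  classical
  have hMδ : M δ ∈ (k.up lam).K := (hu.le_mem _ _ (hM.1 δ δ le_rfl le_rfl)).1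
  have ham := upRel_mem hk hu hE ha
  rcases lt_or_ge lam δ.cof with hcof | hcof
  · have hex : ∀ j, ∃ i < δ, a j ∈ (M i).carrier := fun j => by
      have := ham j
      rw [hM.2 δ le_rfl hδ] at this
      simpa using this
    choose f hf hfa using hex
    have hsup : (⨆ j, f j) < δ :=
      Ordinal.iSup_lt_of_lt_cof (by rwa [mk_Idx]) hf
    have hle := hM.1 _ δ hsup.le le_rfl
    have ham' : ∀ j, a j ∈ (M (⨆ j, f j)).carrier := fun j =>
      (hu.le_sub _ _ (hM.1 _ _ (Ordinal.le_iSup f j) hsup.le)).1 (hfa j)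
    obtain ⟨N, hN, haN, -⟩ := exists_smallPart hk hu (hu.le_mem _ _ hle).1 a a a ham' ham' ham'
    exact ⟨_, hsup, a,
      ⟨N, hN, (upRel_iff hk hu hE (smallParts_mono hu hle hN) haN haN).1 ha⟩, ha⟩
  · obtain ⟨f, hf⟩ := Ordinal.exists_isFundamentalSeq (o := δ) rfl
    have ho : Order.IsSuccLimit δ.cof.ord := isSuccLimit_ord (Ordinal.aleph0_le_cof_iff.2 (Ordinal.one_lt_cof_iff.2 hδ))
    let g : Ordinal.{u} → Ordinal.{u} := fun i => if h : i < δ.cof.ord then f ⟨i, h⟩ else 0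
    have hg : ∀ i (h : i < δ.cof.ord), g i = f ⟨i, h⟩ := fun i h => dif_pos h
    have hgδ : ∀ i < δ.cof.ord, g i < δ := fun i h => by rw [hg i h]; exact (f ⟨i, h⟩).2
    have hgM : (k.up lam).IncreasingBelow δ.cof.ord (fun i => M (g i)) := by
      intro i j hij hj
      refine hM.1 _ _ ?_ (hgδ j hj).le
      rw [hg i (hij.trans_lt hj), hg j hj]
      exact hf.strictMono.monotone hij
    -- Each thinned model retains the entries of `a` present at its stage. Since `g` is cofinal, the
    -- union retains all of them; since the length is at most `lam`, the union has cardinality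
    -- `lam`.
    obtain ⟨N, hN, hNM⟩ := hgM.exists_subchain hu (A := fun i => Set.range a ∩ (M (g i)).carrier)
      fun i _ => Set.inter_subset_right
    have hinf : ℵ₀ ≤ lift.{u + 1, u} lam := by simpa using hk.infinite
    have hcard : ∀ i ≤ δ.cof.ord, lift.{u + 1, u} i.card ≤ lift.{u + 1, u} lam := fun i hi =>
      lift_le.2 <| (Ordinal.card_le_card hi).trans (by simpa using hcof)
    have hNc : ∀ i < δ.cof.ord, (N i).card = lift.{u + 1, u} lam := fun i hi =>
      le_antisymm ((hNM i hi).2.2 _ le_rfl (hcard i hi.le) fun j _ =>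
        (mk_le_mk_of_subset Set.inter_subset_left).trans (mk_range_le_of_le a (mk_Idx lam).le))
        (hu.card_ge _ (hu.le_mem _ _ (hNM i hi).1).1)
    have hNδ : ∀ i < δ.cof.ord, (k.up lam).le (N i) (M δ) := fun i hi =>
      hu.trans _ _ _ (hNM i hi).1 (hM.1 _ _ (hgδ i hi).le le_rfl)
    obtain ⟨V, ⟨hV, hVc, hNV⟩, -⟩ := hu.union _ N ho hN <| (mk_le_mk_of_subset
      (card_iUnion_le_of_increasing hu hNδ)).trans_lt (hu.card_lt _ hMδ)
    have hVδ := hu.union_le _ N V (M δ) ho hN hV hVc hNV hNδ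
    have hVcard : V.card = lift.{u + 1, u} lam := by
      refine le_antisymm ?_ (hu.card_ge V hV)
      rw [Model.card, hVc]
      exact mk_iUnion_Iio_le hinf (hcard _ le_rfl) fun j hj => (hNc j hj).le
    have haV : ∀ j, a j ∈ V.carrier := fun j => by
      have := ham j
      rw [hM.2 δ le_rfl hδ] at this
      simp only [Set.mem_iUnion] at this
      obtain ⟨i, hi, haj⟩ := this
      obtain ⟨_, ⟨⟨l, hl⟩, rfl⟩, hil⟩ := hf.isCofinal_range ⟨i, hi⟩
      have hil : i ≤ g l := by rw [hg l hl]; exact hil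
      rw [hVc]
      exact Set.mem_biUnion (show l ∈ Set.Iio _ from hl) ((hNM l hl).2.1
        ⟨⟨j, rfl⟩, (hu.le_sub _ _ (hM.1 _ _ hil (hgδ l hl).le)).1 haj⟩)
    have hVs : V ∈ smallParts k lam (M δ) := ⟨hVδ, hVcard⟩
    obtain ⟨i, hi, b, hb, hab⟩ := hE.exists_rep hk ho (M := N) (U := V)
      (fun i j hij hj => (up_le_iff hk (hNc i (hij.trans_lt hj)) (hNc j hj)).1 (hN i j hij hj))
      ((up_mem_iff hk hVcard).1 hV) hVc (fun i hi => (up_le_iff hk (hNc i hi) hVcard).1 (hNV i hi))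
      ((upRel_iff hk hu hE hVs haV haV).1 ha)
    exact ⟨g i, hgδ i hi, b, ⟨N i, ⟨(hNM i hi).1, hNc i hi⟩, hb⟩, V, hVs, hab⟩

theorem smallParts_map (hu : (k.up lam).IsEssAEC lam ⊤) {M M' N : Model τ}
    {f : ZFSet.{u} → ZFSet.{u}} (hf : Model.IsIso f M M') (hN : N ∈ smallParts k lam M) :
    Model.IsIso f N (N.map f) ∧ N.map f ∈ smallParts k lam M' := by
  have h1 := hf.restrict_map (hu.le_sub _ _ hN.1)
  exact ⟨h1, hu.iso_le _ _ _ _ _ hf h1 hN.1, by rw [← h1.card_eq]; exact hN.2⟩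

/-- The extension of a smooth equivalence relation is smooth. -/
theorem upRel_isSmooth (hk : k.IsEssAEC lam mu) (hu : (k.up lam).IsEssAEC lam ⊤)
    (hE : IsSmooth k E) : IsSmooth (k.up lam) (upRel k E) where
  mem_seq := by
    rintro M hM a b ⟨N, hN, h⟩
    have hNK := (up_mem_iff hk hN.2).1 (hu.le_mem _ _ hN.1).1
    have key : ∀ {c}, c ∈ k.seq lam N → c ∈ (k.up lam).seq lam M := by
      rintro c ⟨L, hL, hc⟩
      have hLc := seq_card hk (hk.le_mem _ _ hL).1 hc
      exact ⟨L, hu.trans _ _ _ ((up_le_iff hk hLc hN.2).2 hL) hN.1, hc⟩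
    have := hE.mem_seq N hNK a b h
    exact ⟨key this.1, key this.2⟩
  symm := fun M _ a b h => upRel_symm hk hu hE h
  trans := by
    intro M hM a b c h h'
    have ha := upRel_mem hk hu hE h
    have hb := upRel_mem hk hu hE h'
    have hc := upRel_mem hk hu hE (upRel_symm hk hu hE h')
    obtain ⟨N, hN, haN, hbN, hcN⟩ := exists_smallPart hk hu hM a b c ha hb hc
    rw [upRel_iff hk hu hE hN haN hbN] at h
    rw [upRel_iff hk hu hE hN hbN hcN] at h'
    exact ⟨N, hN, hE.trans N ((up_mem_iff hk hN.2).1 (hu.le_mem _ _ hN.1).1) _ _ _ h h'⟩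
  restrict := by
    intro M₁ M₂ hM a ha b hb
    have ham := ModelClass.seq_mem hu ha
    have hbm := ModelClass.seq_mem hu hb
    obtain ⟨N, hN, haN, hbN, -⟩ :=
      exists_smallPart hk hu (hu.le_mem _ _ hM).1 a b b ham hbm hbm
    rw [upRel_iff hk hu hE hN haN hbN, upRel_iff hk hu hE (smallParts_mono hu hM hN) haN hbN]
  iso := by
    intro f M₁ M₂ hM hf a b ha hb
    obtain ⟨N, hN, haN, hbN, -⟩ := exists_smallPart hk hu hM a b b ha hb hb
    obtain ⟨h1, h2⟩ := smallParts_map hu hf hN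
    rw [upRel_iff hk hu hE hN haN hbN, upRel_iff (a := f ∘ a) (b := f ∘ b) hk hu hE h2
      (fun i => h1.mapsTo (haN i)) (fun i => h1.mapsTo (hbN i))]
    exact hE.iso f N _ ((up_mem_iff hk hN.2).1 (hu.le_mem _ _ hN.1).1) h1 a b haN hbN
  continuous := fun δ M hδ hM a ha => upRel_continuous hk hu hE hδ hM ha

/-- Sets of representatives, unlike quotients, can be collected along a chain of models. -/
theorem exists_classReps (hE : IsSmooth k E) (hsm : IsSmall k E) {M : Model τ} (hM : M ∈ k.K) :
    ∃ R : Set (ModelClass.Idx lam → ZFSet.{u}), #R ≤ M.card ∧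
      ∀ a, E M a a → ∃ b ∈ R, E M a b := by
  refine ⟨Set.range fun q : Quot (fun a b : {a // E M a a} => E M a.1 b.1) => q.out.1,
    mk_range_le.trans (hsm M hM), fun a ha => ⟨_, ⟨Quot.mk _ ⟨a, ha⟩, rfl⟩, ?_⟩⟩
  have h1 : Equivalence fun a b : {a // E M a a} => E M a.1 b.1 :=
    ⟨fun a => a.2, fun h => hE.symm M hM _ _ h, fun h h' => hE.trans M hM _ _ _ h h'⟩
  have h2 := Quot.out_eq (Quot.mk (fun a b : {a // E M a a} => E M a.1 b.1) ⟨a, ha⟩)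
  exact hE.symm M hM _ _ (h1.eqvGen_iff.1 (Quot.eqvGen_exact h2))

/-- The extension of a small smooth equivalence relation is small. -/
theorem upRel_isSmall (hk : k.IsEssAEC lam mu) (hu : (k.up lam).IsEssAEC lam ⊤)
    (hE : IsSmooth k E) (hsm : IsSmall k E) : IsSmall (k.up lam) (upRel k E) := by
  have hE' := upRel_isSmooth hk hu hE
  -- Induction on the cardinality. At `lam` the relation is `E`; above `lam`, the model is the union
  -- of an increasing chain of `κ` smaller models, and the union of their sets of representatives
  -- works by continuity.
  have key : ∀ κ : Cardinal.{u}, ∀ M ∈ (k.up lam).K, M.card = lift.{u + 1, u} κ →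
      ∃ R : Set (ModelClass.Idx lam → ZFSet.{u}), #R ≤ lift.{u + 1, u} κ ∧
      ∀ a, upRel k E M a a → ∃ b ∈ R, upRel k E M a b := by
    intro κ
    induction κ using WellFoundedLT.induction with
    | ind κ ih =>
      intro M hM hc
      have hge : lam ≤ κ := lift_le.1 ((hu.card_ge M hM).trans hc.le)
      rcases hge.eq_or_lt with rfl | hlt
      · rw [upRel_eq hk hu hE ((up_mem_iff hk hc).1 hM) hc, ← hc]
        exact exists_classReps hE hsm ((up_mem_iff hk hc).1 hM)
      have hκ : ℵ₀ ≤ κ := hk.infinite.trans hge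
      have hlim : Order.IsSuccLimit κ.ord := isSuccLimit_ord hκ
      have hcards : #(Set.Iio κ.ord) = #M.carrier := by
        rw [mk_Iio_ordinal, card_ord]; exact hc.symm
      obtain ⟨e⟩ := Cardinal.eq.1 hcards
      classical
      -- Stage `i` receives the `i`-th element of an enumeration of `M`, so its cardinality stays at
      -- most the maximum of `lam` and that of `i`, which is below `κ`.
      let A : Ordinal.{u} → Set ZFSet.{u} := fun i => {x | ∃ h : i < κ.ord, x = e ⟨i, h⟩}
      obtain ⟨N, hN, hNM⟩ := ModelClass.IncreasingBelow.exists_subchain hu (δ := κ.ord)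
        (M := fun _ => M) (fun _ _ _ _ => hu.refl M hM) (A := A) (by
          rintro i hi x ⟨h, rfl⟩
          exact (e _).2)
      have hNc : M.carrier = ⋃ i ∈ Set.Iio κ.ord, (N i).carrier := by
        apply Set.Subset.antisymm
        · intro x hx
          obtain ⟨⟨i, hi⟩, hie⟩ := e.surjective ⟨x, hx⟩
          exact Set.mem_biUnion hi ((hNM i hi).2.1 ⟨hi, by rw [hie]⟩)
        · exact card_iUnion_le_of_increasing hu fun i hi => (hNM i hi).1
      have hex : ∀ i : Set.Iio κ.ord, ∃ R : Set (ModelClass.Idx lam → ZFSet.{u}),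
          #R ≤ lift.{u + 1, u} κ ∧
            ∀ a, upRel k E (N i) a a → ∃ b ∈ R, upRel k E (N i) a b := by
        rintro ⟨i, hi⟩
        have hcard : (N i).card ≤ lift.{u + 1, u} (max lam i.card) := by
          refine (hNM i hi).2.2 _ (lift_le.2 (le_max_left _ _)) (lift_le.2 (le_max_right _ _)) ?_
          intro j _
          refine le_trans (mk_le_one_iff_set_subsingleton.2 ?_)
            (one_le_aleph0.trans (aleph0_le_lift.2 (hk.infinite.trans (le_max_left _ _))))
          rintro x ⟨_, rfl⟩ y ⟨_, rfl⟩
          rfl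
        obtain ⟨κ', hκ'⟩ := lt_univ.1 (hcard.trans_lt (lift_lt_univ _))
        have hlt' : κ' < κ := by
          have h1 : κ' ≤ max lam i.card := lift_le.1 (hκ' ▸ hcard)
          exact h1.trans_lt (max_lt hlt (lt_ord.1 hi))
        obtain ⟨R, hR, hR'⟩ := ih κ' hlt' (N i) (hu.le_mem _ _ (hNM i hi).1).1 hκ'
        exact ⟨R, hR.trans (lift_le.2 hlt'.le), hR'⟩
      choose R hR hR' using hex
      refine ⟨⋃ i, R i, ?_, fun a ha => ?_⟩
      · refine mk_iUnion_le_sum_mk.trans ((sum_le_sum _ _ hR).trans ?_)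
        rw [sum_const', mk_Iio_ordinal, card_ord]
        exact (mul_eq_self (by simpa using hκ)).le
      · obtain ⟨i, hi, b, hb, hab⟩ := hE'.exists_rep hu hlim hN hM hNc (fun i hi => (hNM i hi).1) ha
        obtain ⟨b', hb', hbb⟩ := hR' ⟨i, hi⟩ b hb
        exact ⟨b', Set.mem_iUnion.2 ⟨_, hb'⟩,
          hE'.trans M hM _ _ _ hab (hE'.lift hu (hNM i hi).1 hbb)⟩
  intro M hM
  obtain ⟨κ, hκ⟩ := lt_univ.1 (hu.card_lt M hM)
  obtain ⟨R, hR, hR'⟩ := key κ M hM hκ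
  have h1 : ∀ q : Quot (fun a b : {a // upRel k E M a a} => upRel k E M a.1 b.1),
      ∃ b : R, ∃ h : upRel k E M b.1 b.1, q = Quot.mk _ ⟨b.1, h⟩ := by
    rintro ⟨a, ha⟩
    obtain ⟨b, hb, hab⟩ := hR' a ha
    exact ⟨⟨b, hb⟩, hE'.refl_right hM hab, Quot.sound hab⟩
  choose r hr hq using h1
  rw [hκ]
  refine (mk_le_of_injective (f := r) fun p q h => ?_).trans hR
  rw [hq p, hq q]
  congr 2
  rw [h]

end Up

/-! ### Adding names commutes with the up-closure. -/

section UpAdjoin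

variable {τ : Vocab.{u}} {lam : Cardinal.{u}} {mu : WithTop Cardinal.{u}} {k : ModelClass τ}
  {E : SeqRel τ lam}

theorem ModelClass.Generates.cover {M : Model τ} {D : Set (Model τ)} (h : k.Generates lam D M)
    {ι : Type u} (hι : #ι ≤ lam) {a : ι → ZFSet.{u}} (ha : ∀ i, a i ∈ M.carrier) :
    ∃ N ∈ D, ∀ i, a i ∈ N.carrier := by
  obtain ⟨N, hN, h⟩ := h.2.1 (Set.range a) (Set.range_subset_iff.2 ha) (mk_range_le_of_le a hι)
  exact ⟨N, hN, fun i => h ⟨i, rfl⟩⟩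

theorem ModelClass.Generates.cover_one {M : Model τ} {D : Set (Model τ)} (hlam : ℵ₀ ≤ lam)
    (h : k.Generates lam D M) {x : ZFSet.{u}} (hx : x ∈ M.carrier) : ∃ N ∈ D, x ∈ N.carrier := by
  obtain ⟨N, hN, h⟩ := h.cover (ι := PUnit) (a := fun _ => x)
    (by simpa using one_le_aleph0.trans hlam) (fun _ => hx)
  exact ⟨N, hN, h ⟨⟩⟩

/-- Arities are at most `lam`, so every tuple lies in one member of `D`, which is a submodel of both
`M` and `N`. -/
theorem ModelClass.Generates.sub_of_subset (hk : k.IsEssAEC lam mu) {M N : Model τ}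
    {D D' : Set (Model τ)} (h : k.Generates lam D M) (h' : k.Generates lam D' N) (hD : D ⊆ D') :
    M.Sub N := by
  have hs : M.carrier ⊆ N.carrier := fun x hx => by
    obtain ⟨L, hL, hxL⟩ := h.cover_one hk.infinite hx
    exact (h'.1 L (hD hL)).2.2.1 hxL
  refine Model.sub_iff.2 ⟨hs, fun F a ha => ?_, fun R a ha => ?_⟩
  · obtain ⟨L, hL, haL⟩ := h.cover (hk.fnArity_le F) ha
    rw [(Model.sub_iff.1 (h.1 L hL).2.2).2.1 F a haL,
      (Model.sub_iff.1 (h'.1 L (hD hL)).2.2).2.1 F a haL]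
  · obtain ⟨L, hL, haL⟩ := h.cover (hk.rlArity_le R) ha
    rw [← (Model.sub_iff.1 (h.1 L hL).2.2).2.2 R a haL,
      ← (Model.sub_iff.1 (h'.1 L (hD hL)).2.2).2.2 R a haL]

theorem isWitness_of_untyped {M : Model τ} {S : Model (τ.expand lam)} (hM : M ∈ k.K)
    (hc : M.carrier = newPred S)
    (hF : ∀ F (a : τ.fnArity F → ZFSet.{u}), (∀ i, a i ∈ M.carrier) → oldEv S F a = M.ev F a)
    (hF' : ∀ F (a : τ.fnArity F → ZFSet.{u}), (∀ i, a i ∈ S.carrier) →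
      (¬ ∀ i, a i ∈ M.carrier) → oldEv S F a = cst S)
    (hR : ∀ R (a : τ.rlArity R → ZFSet.{u}), (∀ i, a i ∈ S.carrier) →
      (oldHolds S R a ↔ M.holds R a))
    (hn : Naming E M (cst S) (nameOf S))
    (hn' : ∀ a : ModelClass.Idx lam → ZFSet.{u}, (∀ i, a i ∈ S.carrier) → ¬ E M a a →
      nameOf S a = cst S)
    (hcov : ∀ x ∈ S.carrier, x ∉ M.carrier → x ≠ cst S →
      ∃ a : ModelClass.Idx lam → ZFSet.{u}, (∀ i, a i ∈ S.carrier) ∧ E M a a ∧ nameOf S a = x) :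
    IsWitness k E M S where
  mem := hM
  carrier_eq := hc
  rel_iff := fun R a => by
    refine (oldRel_iff S R a).trans ((hR R _ fun i => (a i).2).trans
      ⟨fun ⟨h, h'⟩ => ⟨fun i => ⟨a i, h i⟩, fun i => rfl, h'⟩, fun ⟨b, hb, h'⟩ => ?_⟩)
    rw [← Model.holds_coe, funext hb] at h'
    exact h'
  fn_eq := fun F a b hab => by
    refine (coe_oldFn S F a).trans ?_
    rw [← funext hab, ← Model.ev_coe]
    exact hF F _ fun i => (b i).2
  fn_eq_const := fun F a ⟨i, hi⟩ =>
    Subtype.ext ((coe_oldFn S F a).trans (hF' F _ (fun i => (a i).2) fun h => hi (h i)))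
  newFun_new := fun a ha => by
    rw [← Subtype.coe_ne_coe, coe_newFun]
    exact hn.2.1 _ ha
  newFun_eq_iff := fun a b ha hb => by
    rw [← Subtype.coe_inj, coe_newFun, coe_newFun]
    exact hn.2.2 _ _ ha hb
  newFun_const := fun a ha => by
    rw [← Subtype.coe_inj, coe_newFun]
    exact hn' _ (fun i => (a i).2) ha
  const_notMem := hn.1
  covered := fun ⟨x, hx⟩ hxM hxc => by
    rw [← Subtype.coe_ne_coe] at hxc
    obtain ⟨a, ha, h1, h2⟩ := hcov x hx hxM hxc
    exact ⟨fun i => ⟨a i, ha i⟩, h1, Subtype.ext ((coe_newFun S _).trans h2)⟩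

theorem IsWitness.nameOf_const (hE : IsSmooth k E) (hk : k.IsEssAEC lam mu) {M : Model τ}
    {S : Model (τ.expand lam)} (hM : IsWitness k E M S)
    {a : ModelClass.Idx lam → ZFSet.{u}} (ha : ∀ i, a i ∈ S.carrier) (h : ¬ E M a a) :
    nameOf S a = cst S := by
  rw [hM.eq_expandModel hE hk] at ha
  conv_lhs => rw [hM.eq_expandModel hE hk]
  exact nameOf_expandModel_const ha h

theorem IsWitness.oldEv_const (hE : IsSmooth k E) (hk : k.IsEssAEC lam mu) {M : Model τ}
    {S : Model (τ.expand lam)} (hM : IsWitness k E M S) {F}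
    {a : τ.fnArity F → ZFSet.{u}} (ha : ∀ i, a i ∈ S.carrier) (h : ¬ ∀ i, a i ∈ M.carrier) :
    oldEv S F a = cst S := by
  rw [hM.eq_expandModel hE hk] at ha
  conv_lhs => rw [hM.eq_expandModel hE hk]
  exact oldEv_expandModel_const ha h

/-- The witnesses of a generating system. -/
def witnessesOf (k : ModelClass τ) (E : SeqRel τ lam) (D : Set (Model (τ.expand lam))) :
    Set (Model τ) :=
  {N | ∃ T ∈ D, IsWitness k E N T}

/-- The order axiom is the delicate one: inclusion of witnesses must give inclusion of the
expansions. It does, because the new elements of the smaller expansion are the constant of `S` and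
values in `S` of the new function at tuples from the larger witness. -/
theorem generates_witnessesOf (hk : k.IsEssAEC lam mu)
    (hE : IsSmooth k E) (hsm : IsSmall k E) {S : Model (τ.expand lam)}
    {D : Set (Model (τ.expand lam))} (hD : (k.adjoin E).Generates lam D S) {M : Model τ}
    (hc : M.carrier = newPred S)
    (hF : ∀ F (a : τ.fnArity F → ZFSet.{u}), (∀ i, a i ∈ M.carrier) → oldEv S F a = M.ev F a)
    (hR : ∀ R (a : τ.rlArity R → ZFSet.{u}), (∀ i, a i ∈ S.carrier) →
      (oldHolds S R a ↔ M.holds R a)) : k.Generates lam (witnessesOf k E D) M := by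
  refine ⟨?_, fun A hA hAc => ?_, ?_⟩
  · rintro N ⟨T, hT, hN⟩
    have hTS := expand_sub_iff.1 (hD.1 T hT).2.2
    refine ⟨hN.mem, by rw [← hN.card_eq hE hsm hk]; exact (hD.1 T hT).2.1, ?_⟩
    have hs : N.carrier ⊆ M.carrier := fun x hx => by
      rw [hc]
      exact (hTS.2.2.2.2.2 x (hN.subset hx)).1 (hN.mem_iff.1 hx)
    refine Model.sub_iff.2 ⟨hs, fun F a ha => ?_, fun R a ha => ?_⟩
    · rw [← hF F a fun i => hs (ha i), ← hN.oldEv_eq ha]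
      exact hTS.2.2.2.1 F a fun i => hN.subset (ha i)
    · have haT := fun i => hN.subset (ha i)
      rw [← hN.oldHolds_iff haT, ← hR R a fun i => hTS.1 (haT i)]
      exact hTS.2.2.2.2.1 R a haT
  · rw [hc] at hA
    obtain ⟨T, hT, hAT⟩ := hD.2.1 A (hA.trans (newPred_subset S)) hAc
    obtain ⟨N, hN⟩ := (hD.1 T hT).1
    refine ⟨N, ⟨T, hT, hN⟩, fun x hx => hN.mem_iff.2 ?_⟩
    exact ((expand_sub_iff.1 (hD.1 T hT).2.2).2.2.2.2.2 x (hAT hx)).2 (hA hx)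
  · rintro N₁ ⟨T₁, hT₁, hN₁⟩ N₂ ⟨T₂, hT₂, hN₂⟩ h
    have h1 := expand_sub_iff.1 (hD.1 T₁ hT₁).2.2
    have h2 := expand_sub_iff.1 (hD.1 T₂ hT₂).2.2
    refine hN₁.le_of_le hN₂ (hD.2.2 T₁ hT₁ T₂ hT₂ ?_)
    rw [hN₁.carrier_eq_union hE hk]
    rintro x (hx | rfl | ⟨a, ha, rfl⟩)
    · exact hN₂.subset (h hx)
    · rw [← h1.2.1, h2.2.1]
      exact cst_mem T₂
    · have hm := hE.mem_left hk hN₁.mem ha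
      rw [← h1.2.2.1 a fun i => hN₁.subset (hm i), h2.2.2.1 a fun i => hN₂.subset (h (hm i))]
      exact Model.ev_mem T₂ (.inr .F) fun i => hN₂.subset (h (hm i))

/-- A model generated by expansions is an expansion of a generated model. -/
theorem exists_witness_of_generates (hk : k.IsEssAEC lam mu) (hu : (k.up lam).IsEssAEC lam ⊤)
    (hE : IsSmooth k E) (hsm : IsSmall k E) {S : Model (τ.expand lam)} (hS : S.card < bound ⊤)
    {D : Set (Model (τ.expand lam))} (hD : (k.adjoin E).Generates lam D S) :
    ∃ M, IsWitness (k.up lam) (upRel k E) M S ∧ k.Generates lam (witnessesOf k E D) M := by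
  have hwit : ∀ T ∈ D, ∃ N, IsWitness k E N T := fun T hT => (hD.1 T hT).1
  have hsub := fun T (hT : T ∈ D) => expand_sub_iff.1 (hD.1 T hT).2.2
  have hpred : ∀ {T N}, T ∈ D → IsWitness k E N T → ∀ x ∈ T.carrier,
      (x ∈ N.carrier ↔ x ∈ newPred S) := fun {T N} hT hN x hx =>
    hN.mem_iff.trans ((hsub T hT).2.2.2.2.2 x hx)
  have hlam := hk.infinite
  have hclosed : ∀ F (a : τ.fnArity F → ZFSet.{u}), (∀ i, a i ∈ newPred S) →
      oldEv S F a ∈ newPred S := by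
    intro F a ha
    obtain ⟨T, hT, haT⟩ := hD.cover (hk.fnArity_le F) fun i => newPred_subset S (ha i)
    obtain ⟨N, hN⟩ := hwit T hT
    have haN : ∀ i, a i ∈ N.carrier := fun i => (hpred hT hN _ (haT i)).2 (ha i)
    rw [(hsub T hT).2.2.2.1 F a haT, hN.oldEv_eq haN]
    exact (hpred hT hN _ (hN.subset (N.ev_mem F haN))).1 (N.ev_mem F haN)
  -- The only possible witness: the part of `S` in the new predicate. Every tuple of length at most
  -- `lam` lies in one member of `D`, so the clauses for `S` can be checked there.
  let M : Model τ := Model.ofEv (newPred S) (oldEv S) hclosed (oldHolds S)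
  have hc : M.carrier = newPred S := rfl
  have hF : ∀ F (a : τ.fnArity F → ZFSet.{u}), (∀ i, a i ∈ M.carrier) →
      oldEv S F a = M.ev F a := fun F a ha => (Model.ofEv_ev ha).symm
  have hR : ∀ R (a : τ.rlArity R → ZFSet.{u}), (∀ i, a i ∈ S.carrier) →
      (oldHolds S R a ↔ M.holds R a) := by
    intro R a ha
    refine ⟨fun h => ?_, fun h => h.2⟩
    obtain ⟨T, hT, haT⟩ := hD.cover (hk.rlArity_le R) ha
    obtain ⟨N, hN⟩ := hwit T hT
    have h1 := (hN.oldHolds_iff haT).1 (((hsub T hT).2.2.2.2.1 R a haT).2 h)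
    exact (Model.ofEv_holds fun i => (hpred hT hN _ (haT i)).1 (h1.1 i)).2 h
  have hgen := generates_witnessesOf hk hE hsm hD hc hF hR
  have hMcard : M.card < bound ⊤ := (mk_le_mk_of_subset (newPred_subset S)).trans_lt hS
  have hMK : M ∈ (k.up lam).K := ⟨hMcard, _, hgen⟩
  have hpart : ∀ {T N}, T ∈ D → IsWitness k E N T → N ∈ smallParts k lam M := fun hT hN =>
    ⟨hgen.up_le hMcard ⟨_, hT, hN⟩, by rw [← hN.card_eq hE hsm hk]; exact (hD.1 _ hT).2.1⟩
  have hcov : ∀ a b : ModelClass.Idx lam → ZFSet.{u}, (∀ i, a i ∈ S.carrier) →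
      (∀ i, b i ∈ S.carrier) → ∃ T ∈ D, ∃ N, IsWitness k E N T ∧ (∀ i, a i ∈ T.carrier) ∧
        ∀ i, b i ∈ T.carrier := by
    intro a b ha hb
    obtain ⟨T, hT, h⟩ := hD.cover (ι := ModelClass.Idx lam ⊕ ModelClass.Idx lam)
      (a := Sum.elim a b) (by simp [add_eq_self hlam]) (by rintro (i | i); exacts [ha i, hb i])
    obtain ⟨N, hN⟩ := hwit T hT
    exact ⟨T, hT, N, hN, fun i => h (.inl i), fun i => h (.inr i)⟩
  have hiff : ∀ {T N}, T ∈ D → IsWitness k E N T → ∀ {a b : ModelClass.Idx lam → ZFSet.{u}},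
      (∀ i, a i ∈ T.carrier) → (∀ i, b i ∈ T.carrier) → (upRel k E M a b ↔ E N a b) := by
    intro T N hT hN a b ha hb
    constructor
    · intro h
      have h1 := upRel_mem hk hu hE h
      have h2 := upRel_mem hk hu hE (upRel_symm hk hu hE h)
      exact (upRel_iff hk hu hE (hpart hT hN) (fun i => (hpred hT hN _ (ha i)).2 (h1 i))
        fun i => (hpred hT hN _ (hb i)).2 (h2 i)).1 h
    · exact fun h => ⟨N, hpart hT hN, h⟩
  have hmem : ∀ {a}, upRel k E M a a → ∀ i, a i ∈ S.carrier := fun h i =>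
    newPred_subset S (upRel_mem hk hu hE h i)
  refine ⟨M, isWitness_of_untyped hMK hc hF ?_ hR ⟨?_, ?_, ?_⟩ ?_ ?_, hgen⟩
  · intro F a ha h
    obtain ⟨T, hT, haT⟩ := hD.cover (hk.fnArity_le F) ha
    obtain ⟨N, hN⟩ := hwit T hT
    rw [(hsub T hT).2.2.2.1 F a haT, (hsub T hT).2.1]
    exact hN.oldEv_const hE hk haT fun h' => h fun i => (hpred hT hN _ (haT i)).1 (h' i)
  · obtain ⟨T, hT, hcT⟩ := hD.cover_one hlam (cst_mem S)
    obtain ⟨N, hN⟩ := hwit T hT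
    rw [hc, ← hpred hT hN _ hcT, (hsub T hT).2.1]
    exact (hN.naming hE hk).1
  · intro a ha
    obtain ⟨T, hT, N, hN, haT, -⟩ := hcov a a (hmem ha) (hmem ha)
    have h1 := (hiff hT hN haT haT).1 ha
    have h2 := (hN.naming hE hk).2.1 a h1
    rw [(hsub T hT).2.2.1 a haT, (hsub T hT).2.1, hc, ← hpred hT hN]
    · exact h2
    · exact Model.ev_mem T (.inr .F) haT
  · intro a b ha hb
    obtain ⟨T, hT, N, hN, haT, hbT⟩ := hcov a b (hmem ha) (hmem hb)
    rw [(hsub T hT).2.2.1 a haT, (hsub T hT).2.2.1 b hbT, hiff hT hN haT hbT]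
    exact (hN.naming hE hk).2.2 a b ((hiff hT hN haT haT).1 ha) ((hiff hT hN hbT hbT).1 hb)
  · intro a ha h
    obtain ⟨T, hT, N, hN, haT, -⟩ := hcov a a ha ha
    rw [(hsub T hT).2.2.1 a haT, (hsub T hT).2.1]
    exact hN.nameOf_const hE hk haT fun h' => h ((hiff hT hN haT haT).2 h')
  · intro x hx hxM hxc
    obtain ⟨T, hT, hxT⟩ := hD.cover_one hlam hx
    obtain ⟨N, hN⟩ := hwit T hT
    rw [(hsub T hT).2.1] at hxc
    have := hxT
    rw [hN.carrier_eq_union hE hk] at this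
    rcases this with h | h | ⟨a, ha, rfl⟩
    · exact (hxM ((hpred hT hN _ hxT).1 h)).elim
    · exact (hxc h).elim
    · have haT : ∀ i, a i ∈ T.carrier := fun i => hN.subset (hE.mem_left hk hN.mem ha i)
      exact ⟨a, fun i => (hsub T hT).1 (haT i), (hiff hT hN haT haT).2 ha,
        (hsub T hT).2.2.1 a haT⟩

/-- The restrictions of `S` to the small parts of its witness. -/
def smallRestrs (k : ModelClass τ) (E : SeqRel τ lam) (S : Model (τ.expand lam)) (M : Model τ) :
    Set (Model (τ.expand lam)) :=
  {T | ∃ N ∈ smallParts k lam M, T = restr (upRel k E) S N}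

/-- On models of cardinality `lam` the relations `upRel k E` and `E` coincide, so expansions for one
are expansions for the other. -/
theorem isWitness_of_smallPart (hk : k.IsEssAEC lam mu) (hu : (k.up lam).IsEssAEC lam ⊤)
    (hE : IsSmooth k E) {S : Model (τ.expand lam)} {M N : Model τ}
    (hM : IsWitness (k.up lam) (upRel k E) M S) (hN : N ∈ smallParts k lam M) :
    IsWitness k E N (restr (upRel k E) S N) := by
  have hNK := (up_mem_iff hk hN.2).1 (hu.le_mem _ _ hN.1).1
  have heq := upRel_eq hk hu hE hNK hN.2
  have h1 : restr (upRel k E) S N = expandModel E N (cst S) (nameOf S) := by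
    -- An expansion of `N` uses only the value of the relation at `N`, which a constant family
    -- exposes to rewriting.
    change expandModel (fun _ => upRel k E N) N (cst S) (nameOf S) = _
    rw [heq]
    rfl
  have h2 := (hM.naming (upRel_isSmooth hk hu hE) hu).mono (upRel_isSmooth hk hu hE) hu hN.1
  rw [h1]
  refine isWitness_expandModel hE hk hNK ?_
  unfold Naming at h2 ⊢
  rwa [heq] at h2

/-- Löwenheim–Skolem for the expansion `S`, applied in the up-closure, covers every small subset;
the order comes from that of the small parts of the witness. -/
theorem generates_smallRestrs (hk : k.IsEssAEC lam mu) (hu : (k.up lam).IsEssAEC lam ⊤)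
    (hE : IsSmooth k E) (hsm : IsSmall k E) {S : Model (τ.expand lam)} {M : Model τ}
    (hM : IsWitness (k.up lam) (upRel k E) M S) :
    (k.adjoin E).Generates lam (smallRestrs k E S M) S := by
  have hE' := upRel_isSmooth hk hu hE
  have hw := fun {N} hN => isWitness_of_smallPart (N := N) hk hu hE hM hN
  have hw' := fun {N} (hN : N ∈ smallParts k lam M) => hM.restr hE' hu hN.1
  have hsub := fun {N} (hN : N ∈ smallParts k lam M) => (hM.restr_le hE' hu hN.1).1
  refine ⟨?_, fun A hA hAc => ?_, ?_⟩
  · rintro _ ⟨N, hN, rfl⟩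
    exact ⟨⟨N, hw hN⟩, by rw [(hw hN).card_eq hE hsm hk]; exact hN.2, hsub hN⟩
  · obtain ⟨N, h1, h2, h3⟩ := hM.lowenheimSkolem hE' hu A hA
    refine ⟨_, ⟨N, ⟨h1, le_antisymm (h3.trans ?_) (hu.card_ge N (hu.le_mem _ _ h1).1)⟩, rfl⟩, h2⟩
    exact (add_le_add le_rfl hAc).trans (add_eq_self (by simpa using hk.infinite)).le
  · rintro _ ⟨N₁, h₁, rfl⟩ _ ⟨N₂, h₂, rfl⟩ h
    have hs : N₁.carrier ⊆ N₂.carrier := fun x hx =>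
      ((hw' h₂).mem_of_mem hM (hsub h₂) (h ((hw h₁).subset hx))).2
        ((hu.le_sub _ _ h₁.1).1 hx)
    exact ((hw h₁).le_iff (hw h₂)).2 ⟨(hsub h₁).of_subset (hsub h₂) h,
      (generates_smallParts hk hu hM.mem).2.2 _ h₁ _ h₂ hs⟩

/-- Adding names commutes with the passage to the generated class. -/
theorem up_adjoin (hk : k.IsEssAEC lam mu) (hu : (k.up lam).IsEssAEC lam ⊤)
    (hE : IsSmooth k E) (hsm : IsSmall k E) :
    (k.adjoin E).up lam = (k.up lam).adjoin (upRel k E) := by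
  have hE' := upRel_isSmooth hk hu hE
  have hk' := adjoin_isEssAEC hE hsm hk
  have hu' := adjoin_isEssAEC hE' (upRel_isSmall hk hu hE hsm) hu
  have hK : ((k.adjoin E).up lam).K = ((k.up lam).adjoin (upRel k E)).K := by
    apply Set.Subset.antisymm
    · rintro S ⟨hS, D, hD⟩
      obtain ⟨M, hM, -⟩ := exists_witness_of_generates hk hu hE hsm hS hD
      exact ⟨M, hM⟩
    · rintro S ⟨M, hM⟩
      exact ⟨hu'.card_lt S ⟨M, hM⟩, _, generates_smallRestrs hk hu hE hsm hM⟩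
  have hle : ((k.adjoin E).up lam).le = ((k.up lam).adjoin (upRel k E)).le := by
    funext S T
    apply propext
    constructor
    · rintro ⟨hS, hT, D, D', hDD, hD, hD'⟩
      obtain ⟨M, hM, hMD⟩ := exists_witness_of_generates hk hu hE hsm hS hD
      obtain ⟨N, hN, hND⟩ := exists_witness_of_generates hk hu hE hsm hT hD'
      refine ⟨hD.sub_of_subset hk' hD' hDD, M, N, hM, hN, hu.card_lt M hM.mem,
        hu.card_lt N hN.mem, _, _, ?_, hMD, hND⟩
      rintro L ⟨R, hR, hL⟩
      exact ⟨R, hDD hR, hL⟩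
    · rintro ⟨hST, M, N, hM, hN, h⟩
      refine ⟨hu'.card_lt S ⟨M, hM⟩, hu'.card_lt T ⟨N, hN⟩, _, _, ?_,
        generates_smallRestrs hk hu hE hsm hM, generates_smallRestrs hk hu hE hsm hN⟩
      -- The canonical systems are nested: a small part of `M` is one of `N`, and restricting `S` or
      -- `T` to it gives the same expansion.
      rintro _ ⟨L, hL, rfl⟩
      refine ⟨L, smallParts_mono hu h hL, ?_⟩
      exact (hM.restr hE' hu hL.1).eq_restr hE' hu hN
        ((hM.restr_le hE' hu hL.1).1.trans hST) (hu.trans _ _ _ hL.1 h)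
  cases h1 : (k.adjoin E).up lam
  cases h2 : (k.up lam).adjoin (upRel k E)
  rw [h1, h2] at hK hle
  congr

end UpAdjoin

/-! ### Embeddings and orbital types under amalgamation. -/

section Types

variable {τ : Vocab.{u}} {lam : Cardinal.{u}} {mu : WithTop Cardinal.{u}} {k : ModelClass τ}

theorem ModelClass.IsEmb.comp (hk : k.IsEssAEC lam mu) {N L L' : Model τ}
    {f g : ZFSet.{u} → ZFSet.{u}} (hg : k.IsEmb g L L') (hf : k.IsEmb f N L) :
    k.IsEmb (g ∘ f) N L' := by
  obtain ⟨N', h1, h2⟩ := hf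
  obtain ⟨L'', h3, h4⟩ := hg
  have h5 := h3.restrict_map (hk.le_sub _ _ h2)
  exact ⟨_, h5.comp h1, hk.trans _ _ _ (hk.iso_le _ _ _ _ _ h3 h5 h2) h4⟩

theorem ModelClass.IsEmb.id_of_le {M N : Model τ} (h : k.le M N) : k.IsEmb id M N :=
  ⟨M, .refl M, h⟩

theorem ModelClass.IsEmb.of_iso (hk : k.IsEssAEC lam mu) {M N : Model τ} (hM : M ∈ k.K)
    {f : ZFSet.{u} → ZFSet.{u}} (h : Model.IsIso f M N) : k.IsEmb f M N :=
  ⟨N, h, hk.refl N (hk.iso_mem _ _ _ h hM)⟩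

theorem ModelClass.IsEmb.le_of_fix (hk : k.IsEssAEC lam mu) {M N L : Model τ}
    {f : ZFSet.{u} → ZFSet.{u}} (hf : k.IsEmb f N L) (hMN : k.le M N)
    (hfix : ∀ x ∈ M.carrier, f x = x) : k.le M L := by
  obtain ⟨N', h1, h2⟩ := hf
  exact hk.trans _ _ _ (hk.iso_le _ _ _ _ _ h1 (.of_fix hfix) hMN) h2

/-- An isomorphism extends to an isomorphism of any model above its domain. -/
theorem exists_extend_iso (hk : k.IsEssAEC lam mu) {N₁ N₂ L : Model τ}
    {φ : ZFSet.{u} → ZFSet.{u}} (hφ : Model.IsIso φ N₁ N₂) (hL : k.le N₁ L) :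
    ∃ ψ L', Model.IsIso ψ L L' ∧ (∀ x ∈ N₁.carrier, ψ x = φ x) ∧ k.le N₂ L' := by
  classical
  have h1 := small_of_mem hk (hk.le_mem _ _ hL).1
  have h2 := small_of_mem hk (hk.le_mem _ _ hL).2
  have h3 := small_of_mem hk (hk.iso_mem _ _ _ hφ (hk.le_mem _ _ hL).1)
  obtain ⟨ρ, hρ, -, hρN⟩ := exists_rename N₁.carrier L.carrier N₂.carrier
  let ψ : ZFSet.{u} → ZFSet.{u} := fun x => if x ∈ N₁.carrier then φ x else ρ x
  have hψ1 : ∀ {x}, x ∈ N₁.carrier → ψ x = φ x := fun h => if_pos h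
  have hψ2 : ∀ {x}, x ∉ N₁.carrier → ψ x = ρ x := fun h => if_neg h
  have hinj : Set.InjOn ψ L.carrier := by
    intro x hx y hy hxy
    by_cases h : x ∈ N₁.carrier <;> by_cases h' : y ∈ N₁.carrier
    · rw [hψ1 h, hψ1 h'] at hxy
      exact hφ.1.injOn h h' hxy
    · rw [hψ1 h, hψ2 h'] at hxy
      exact (hρN y hy h' (hxy ▸ hφ.mapsTo h)).elim
    · rw [hψ2 h, hψ1 h'] at hxy
      exact (hρN x hx h (hxy ▸ hφ.mapsTo h')).elim
    · rw [hψ2 h, hψ2 h'] at hxy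
      exact hρ hx hy hxy
  have hi := Model.isIso_map hinj
  exact ⟨ψ, _, hi, fun x hx => hψ1 hx, hk.iso_le _ _ _ _ _ hi (hφ.congr fun x hx => hψ1 hx) hL⟩

/-- The amalgamation property. -/
def ModelClass.Amalgamates (k : ModelClass τ) : Prop :=
  ∀ M₀ M₁ M₂, k.le M₀ M₁ → k.le M₀ M₂ → ∃ M₃ f₁ f₂,
    k.IsEmb f₁ M₁ M₃ ∧ k.IsEmb f₂ M₂ M₃ ∧ ∀ x ∈ M₀.carrier, f₁ x = x ∧ f₂ x = x

/-- Extending the isomorphism between the two images of `N` to `L₁` makes one image a common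
submodel, to which amalgamation applies. -/
theorem ModelClass.Amalgamates.emb (hA : k.Amalgamates) (hk : k.IsEssAEC lam mu)
    {N L₁ L₂ : Model τ} {f g : ZFSet.{u} → ZFSet.{u}} (hf : k.IsEmb f N L₁)
    (hg : k.IsEmb g N L₂) : ∃ L h₁ h₂, k.IsEmb h₁ L₁ L ∧ k.IsEmb h₂ L₂ L ∧
      ∀ x ∈ N.carrier, h₁ (f x) = g x ∧ h₂ (g x) = g x := by
  obtain ⟨N₁, hf, hN₁⟩ := hf
  obtain ⟨N₂, hg, hN₂⟩ := hg
  obtain ⟨ψ, L', hψ, hψN, hle⟩ := exists_extend_iso hk (hg.comp hf.inv) hN₁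
  obtain ⟨L, h₁, h₂, e₁, e₂, hfix⟩ := hA N₂ L' L₂ hle hN₂
  refine ⟨L, h₁ ∘ ψ, h₂, e₁.comp hk (.of_iso hk (hk.le_mem _ _ hN₁).2 hψ), e₂, fun x hx => ?_⟩
  have h3 : ψ (f x) = g x := by
    rw [hψN _ (hf.mapsTo hx)]
    exact congrArg g (hf.inv_apply hx)
  have h4 := hfix _ (hg.mapsTo hx)
  rw [Function.comp_apply, h3]
  exact h4

/-- Transitivity amalgamates the two common extensions over the middle model. Hence the generated
equivalence relation in the definition of types needs only one step. -/
theorem ModelClass.Amalgamates.atomicEq_equivalence (hA : k.Amalgamates)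
    (hk : k.IsEssAEC lam mu) (M : Model τ) : Equivalence (k.AtomicEq M) := by
  refine ⟨fun x => ?_, ?_, ?_⟩
  · have := hk.refl _ (hk.le_mem _ _ x.le).2
    exact ⟨x.N, id, id, .id_of_le this, .id_of_le this, fun _ _ => ⟨rfl, rfl⟩, rfl⟩
  · rintro x y ⟨L, f, g, hf, hg, h, h'⟩
    exact ⟨L, g, f, hg, hf, fun z hz => (h z hz).symm, h'.symm⟩
  · rintro x y z ⟨L₁, f₁, g₁, hf₁, hg₁, h₁, e₁⟩ ⟨L₂, f₂, g₂, hf₂, hg₂, h₂, e₂⟩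
    obtain ⟨L, i, j, hi, hj, hij⟩ := hA.emb hk hg₁ hf₂
    refine ⟨L, i ∘ f₁, j ∘ g₂, hi.comp hk hf₁, hj.comp hk hg₂, fun w hw => ?_, ?_⟩
    · have h3 := hij w ((hk.le_sub _ _ y.le).1 hw)
      rw [(h₁ w hw).2, (h₂ w hw).1] at h3
      simp only [Function.comp_apply, (h₁ w hw).1, (h₂ w hw).2]
      exact h3
    · simp only [Function.comp_apply, e₁, ← e₂]
      exact (hij _ y.mem).1.trans (hij _ y.mem).2.symm

theorem ModelClass.Amalgamates.ortp_eq_iff (hA : k.Amalgamates)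
    (hk : k.IsEssAEC lam mu) {M N N' : Model τ} {a a' : ZFSet.{u}} {h : k.le M N}
    {h' : k.le M N'} {ha : a ∈ N.carrier} {ha' : a' ∈ N'.carrier} :
    k.ortp h ha = k.ortp h' ha' ↔ k.AtomicEq M ⟨N, a, h, ha⟩ ⟨N', a', h', ha'⟩ :=
  ⟨fun e => (hA.atomicEq_equivalence hk M).eqvGen_iff.1 (Quot.eqvGen_exact e),
    fun e => Quot.sound e⟩

theorem ModelClass.ortp_eq_of_iso (hk : k.IsEssAEC lam mu) {M N N' : Model τ} {a : ZFSet.{u}}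
    {f : ZFSet.{u} → ZFSet.{u}} (h : k.le M N) (ha : a ∈ N.carrier) (hf : Model.IsIso f N N')
    (hfix : ∀ x ∈ M.carrier, f x = x) :
    k.ortp h ha = k.ortp ((IsEmb.of_iso hk (hk.le_mem _ _ h).2 hf).le_of_fix hk h hfix)
      (hf.mapsTo ha) := by
  have hN := (hk.le_mem _ _ h).2
  exact Quot.sound ⟨N', f, id, .of_iso hk hN hf, .id_of_le (hk.refl _ (hk.iso_mem _ _ _ hf hN)),
    fun x hx => ⟨hfix x hx, rfl⟩, rfl⟩

theorem ModelClass.IsTypeOf.iso (hk : k.IsEssAEC lam mu) {M N N' : Model τ} {a : ZFSet.{u}}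
    {f : ZFSet.{u} → ZFSet.{u}} {p : k.Typ M} (h : k.IsTypeOf p a N) (hf : Model.IsIso f N N')
    (hfix : ∀ x ∈ M.carrier, f x = x) : k.IsTypeOf p (f a) N' := by
  obtain ⟨h, ha, rfl⟩ := h
  exact ⟨_, _, k.ortp_eq_of_iso hk h ha hf hfix⟩

theorem ModelClass.IsTypeOf.unique {M N : Model τ} {a : ZFSet.{u}} {p q : k.Typ M}
    (h : k.IsTypeOf p a N) (h' : k.IsTypeOf q a N) : p = q := by
  obtain ⟨_, _, rfl⟩ := h
  obtain ⟨_, _, rfl⟩ := h'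
  rfl

end Types

/-! ### Types over an expansion and types over its witness. -/

section AdjoinTypes

variable {τ : Vocab.{u}} {lam : Cardinal.{u}} {mu : WithTop Cardinal.{u}} {k : ModelClass τ}
  {E : SeqRel τ lam}

/-- Amalgamate the witnesses, expand a copy of the amalgam over `S₀`, and lift the embeddings. They
fix the witness of `S₀`, hence `S₀` itself. -/
theorem adjoin_amalgamates (hE : IsSmooth k E) (hk : k.IsEssAEC lam mu) (hA : k.Amalgamates) :
    (k.adjoin E).Amalgamates := by
  rintro S₀ S₁ S₂ h₁ ⟨h₂, M₀, M₂, hM₀, hM₂, hle₂⟩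
  obtain ⟨M₁, hM₁⟩ : ∃ M₁, IsWitness k E M₁ S₁ := by
    obtain ⟨-, _, M₁, _, hM₁, -⟩ := h₁
    exact ⟨M₁, hM₁⟩
  obtain ⟨h₁, hle₁⟩ := (hM₀.le_iff hM₁).1 h₁
  obtain ⟨L, f₁, f₂, e₁, e₂, hfix⟩ := hA M₀ M₁ M₂ hle₁ hle₂
  obtain ⟨h, L', T, hh, hhfix, hle, hT, hST⟩ := hM₀.exists_lift_copy hE hk
    (e₁.le_of_fix hk hle₁ fun x hx => (hfix x hx).1)
  have hL : L ∈ k.K := by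
    obtain ⟨_, -, h⟩ := e₁
    exact (hk.le_mem _ _ h).2
  obtain ⟨g₁, hg₁, hgf₁⟩ := hM₁.exists_isEmb hE hk hT
    ((ModelClass.IsEmb.of_iso hk hL hh).comp hk e₁)
  obtain ⟨g₂, hg₂, hgf₂⟩ := hM₂.exists_isEmb hE hk hT
    ((ModelClass.IsEmb.of_iso hk hL hh).comp hk e₂)
  refine ⟨T, g₁, g₂, hg₁, hg₂, fun x hx => ⟨?_, ?_⟩⟩
  · refine hM₀.fix_emb hE hk hg₁ h₁ hST.1 (fun x hx => ?_) x hx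
    rw [hgf₁ x ((hk.le_sub _ _ hle₁).1 hx), Function.comp_apply, (hfix x hx).1, hhfix x hx]
  · refine hM₀.fix_emb hE hk hg₂ h₂ hST.1 (fun x hx => ?_) x hx
    rw [hgf₂ x ((hk.le_sub _ _ hle₂).1 hx), Function.comp_apply, (hfix x hx).2, hhfix x hx]

theorem IsWitness.emb_mem_iff {M N : Model τ}
    {S T : Model (τ.expand lam)} (hM : IsWitness k E M S) (hN : IsWitness k E N T)
    {f : ZFSet.{u} → ZFSet.{u}} (hf : (k.adjoin E).IsEmb f S T) {x : ZFSet.{u}}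
    (hx : x ∈ S.carrier) : x ∈ M.carrier ↔ f x ∈ N.carrier := by
  obtain ⟨T', hf, hT'⟩ := hf
  rw [hM.mem_iff, hN.mem_iff, (expand_isIso_iff.1 hf).2.2.2.2.2 x hx]
  exact (expand_sub_iff.1 hT'.1).2.2.2.2.2 _ (hf.mapsTo hx)

theorem exists_witness_right {S T : Model (τ.expand lam)} (h : (k.adjoin E).le S T) :
    ∃ N, IsWitness k E N T := by
  obtain ⟨-, _, N, _, hN, -⟩ := h
  exact ⟨N, hN⟩

/-- Two pointed extensions of an expansion are identified in a common extension iff this holds for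
the witnesses. -/
theorem atomicEq_adjoin_iff (hE : IsSmooth k E) (hk : k.IsEssAEC lam mu)
    {M N N' : Model τ} {S T T' : Model (τ.expand lam)} (hM : IsWitness k E M S)
    (hN : IsWitness k E N T) (hN' : IsWitness k E N' T') {a a' : ZFSet.{u}}
    (h : (k.adjoin E).le S T) (h' : (k.adjoin E).le S T') (ha : a ∈ T.carrier)
    (ha' : a' ∈ T'.carrier) (haN : a ∈ N.carrier) :
    (k.adjoin E).AtomicEq S ⟨T, a, h, ha⟩ ⟨T', a', h', ha'⟩ ↔
      ∃ haN' : a' ∈ N'.carrier, k.AtomicEq M ⟨N, a, hM.le_of_le hN h, haN⟩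
        ⟨N', a', hM.le_of_le hN' h', haN'⟩ := by
  constructor
  · rintro ⟨L, f, g, hf, hg, hfix, heq⟩
    obtain ⟨K, hK⟩ : ∃ K, IsWitness k E K L := by
      obtain ⟨_, -, hL⟩ := hf
      exact exists_witness_right hL
    refine ⟨(hN'.emb_mem_iff hK hg ha').2 ?_, K, f, g, hN.isEmb hE hk hK hf,
      hN'.isEmb hE hk hK hg, fun z hz => hfix z (hM.subset hz), heq⟩
    have := (hN.emb_mem_iff hK hf ha).1 haN
    change f a = g a' at heq
    rwa [← heq]
  · rintro ⟨haN', L, f, g, hf, hg, hfix, heq⟩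
    have hMN := hM.le_of_le hN h
    have hMN' := hM.le_of_le hN' h'
    -- As `f` fixes `M`, the common extension `L` is above `M`, so a copy of it can be expanded over
    -- `S`.
    obtain ⟨i, L', P, hi, hifix, hle, hP, hSP⟩ := hM.exists_lift_copy hE hk
      (hf.le_of_fix hk hMN fun x hx => (hfix x hx).1)
    have hL : L ∈ k.K := by
      obtain ⟨_, -, h⟩ := hf
      exact (hk.le_mem _ _ h).2
    obtain ⟨f', hf', hff⟩ := hN.exists_isEmb hE hk hP
      ((ModelClass.IsEmb.of_iso hk hL hi).comp hk hf)
    obtain ⟨g', hg', hgg⟩ := hN'.exists_isEmb hE hk hP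
      ((ModelClass.IsEmb.of_iso hk hL hi).comp hk hg)
    refine ⟨P, f', g', hf', hg', fun x hx => ⟨?_, ?_⟩, ?_⟩
    · refine hM.fix_emb hE hk hf' h.1 hSP.1 (fun x hx => ?_) x hx
      rw [hff x ((hk.le_sub _ _ hMN).1 hx), Function.comp_apply, (hfix x hx).1, hifix x hx]
    · refine hM.fix_emb hE hk hg' h'.1 hSP.1 (fun x hx => ?_) x hx
      rw [hgg x ((hk.le_sub _ _ hMN').1 hx), Function.comp_apply, (hfix x hx).2, hifix x hx]
    · change f a = g a' at heq
      change f' a = g' a'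
      rw [hff a haN, hgg a' haN', Function.comp_apply, Function.comp_apply, heq]

/-- The type `q` over an expansion comes from the type `p` over the witness. -/
def TypeCorr (k : ModelClass τ) (E : SeqRel τ lam) {M : Model τ} {S : Model (τ.expand lam)}
    (p : k.Typ M) (q : (k.adjoin E).Typ S) : Prop :=
  ∃ a N T, IsWitness k E N T ∧ k.IsTypeOf p a N ∧ (k.adjoin E).IsTypeOf q a T

theorem typeCorr_of_mem {M N : Model τ} {S T : Model (τ.expand lam)} (hM : IsWitness k E M S)
    (hN : IsWitness k E N T) {q : (k.adjoin E).Typ S} {a : ZFSet.{u}}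
    (hq : (k.adjoin E).IsTypeOf q a T) (ha : a ∈ N.carrier) :
    ∃ p : k.Typ M, TypeCorr k E p q ∧ k.IsTypeOf p a N := by
  have hle := hM.le_of_le hN hq.1
  exact ⟨k.ortp hle ha, ⟨a, N, T, hN, ⟨hle, ha, rfl⟩, hq⟩, hle, ha, rfl⟩

/-- A class with amalgamation and a small smooth equivalence relation for it. -/
structure Expandable (k : ModelClass τ) (E : SeqRel τ lam) (mu : WithTop Cardinal.{u}) :
    Prop where
  smooth : IsSmooth k E
  small : IsSmall k E
  aec : k.IsEssAEC lam mu
  amalg : k.Amalgamates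

theorem Expandable.aec_adjoin (H : Expandable k E mu) : (k.adjoin E).IsEssAEC lam mu :=
  adjoin_isEssAEC H.smooth H.small H.aec

theorem Expandable.amalg_adjoin (H : Expandable k E mu) : (k.adjoin E).Amalgamates :=
  adjoin_amalgamates H.smooth H.aec H.amalg

theorem IsWitness.ortp_eq_iff (H : Expandable k E mu) {M N N' : Model τ}
    {S T T' : Model (τ.expand lam)} (hM : IsWitness k E M S)
    (hN : IsWitness k E N T) (hN' : IsWitness k E N' T') {a a' : ZFSet.{u}}
    (h : (k.adjoin E).le S T) (h' : (k.adjoin E).le S T') (ha : a ∈ T.carrier)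
    (ha' : a' ∈ T'.carrier) (haN : a ∈ N.carrier) :
    (k.adjoin E).ortp h ha = (k.adjoin E).ortp h' ha' ↔
      ∃ haN' : a' ∈ N'.carrier, k.ortp (hM.le_of_le hN h) haN =
        k.ortp (hM.le_of_le hN' h') haN' := by
  rw [H.amalg_adjoin.ortp_eq_iff H.aec_adjoin,
    atomicEq_adjoin_iff H.smooth H.aec hM hN hN' h h' ha ha' haN]
  exact exists_congr fun _ => (H.amalg.ortp_eq_iff H.aec).symm

namespace TypeCorr

variable {M N : Model τ} {S T : Model (τ.expand lam)}

/-- The correspondence is defined by one common realization; since equality of types passes between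
expansions and witnesses, every realization serves. -/
theorem isTypeOf_iff (H : Expandable k E mu) (hM : IsWitness k E M S) (hN : IsWitness k E N T)
    {p : k.Typ M} {q : (k.adjoin E).Typ S} (h : TypeCorr k E p q) {a : ZFSet.{u}} :
    (k.adjoin E).IsTypeOf q a T ↔ (k.adjoin E).le S T ∧ k.IsTypeOf p a N := by
  obtain ⟨b, N₀, T₀, hN₀, ⟨hle, hb, rfl⟩, ⟨hle', hb', rfl⟩⟩ := h
  constructor
  · rintro ⟨h, ha, heq⟩
    obtain ⟨haN, heq⟩ := (hM.ortp_eq_iff H hN₀ hN hle' h hb' ha hb).1 heq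
    exact ⟨h, _, haN, heq⟩
  · rintro ⟨h, _, haN, heq⟩
    exact ⟨h, hN.subset haN, (hM.ortp_eq_iff H hN₀ hN hle' h hb' _ hb).2 ⟨haN, heq⟩⟩

theorem eq_iff (H : Expandable k E mu) (hM : IsWitness k E M S) {p p' : k.Typ M}
    {q q' : (k.adjoin E).Typ S} (h : TypeCorr k E p q) (h' : TypeCorr k E p' q') :
    p = p' ↔ q = q' := by
  constructor
  · rintro rfl
    obtain ⟨b, N, T, hN, h1, h2⟩ := h
    exact h2.unique ((h'.isTypeOf_iff H hM hN).2 ⟨h2.1, h1⟩)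
  · rintro rfl
    obtain ⟨b, N, T, hN, h1, h2⟩ := h
    exact h1.unique ((h'.isTypeOf_iff H hM hN).1 h2).2

theorem exists_up (H : Expandable k E mu) (hM : IsWitness k E M S) (p : k.Typ M) :
    ∃ q : (k.adjoin E).Typ S, TypeCorr k E p q := by
  obtain ⟨N, a, hle, ha⟩ := p
  obtain ⟨f, N', T, hf, hfix, hle', hT, hST⟩ := hM.exists_lift_copy H.smooth H.aec hle
  refine ⟨(k.adjoin E).ortp hST (hT.subset (hf.mapsTo ha)), f a, N', T, hT, ?_, hST, _, rfl⟩
  exact ModelClass.IsTypeOf.iso H.aec ⟨hle, ha, rfl⟩ hf hfix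

theorem extends_iff (H : Expandable k E mu) (hM : IsWitness k E M S)
    {M₁ : Model τ} {S₁ : Model (τ.expand lam)} (hM₁ : IsWitness k E M₁ S₁)
    (hS : (k.adjoin E).le S S₁) {p : k.Typ M} {q : (k.adjoin E).Typ S} (h : TypeCorr k E p q)
    {p₁ : k.Typ M₁} {q₁ : (k.adjoin E).Typ S₁} (h₁ : TypeCorr k E p₁ q₁) :
    k.Extends p p₁ ↔ (k.adjoin E).Extends q q₁ := by
  have hle := hM.le_of_le hM₁ hS
  constructor
  · rintro ⟨-, a, N, ha₁, ha⟩
    obtain ⟨f, N', T, hf, hfix, hle', hT, hST⟩ := hM₁.exists_lift_copy H.smooth H.aec ha₁.1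
    refine ⟨hS, f a, T, (h₁.isTypeOf_iff H hM₁ hT).2 ⟨hST, ha₁.iso H.aec hf hfix⟩,
      (h.isTypeOf_iff H hM hT).2 ⟨H.aec_adjoin.trans _ _ _ hS hST, ha.iso H.aec hf ?_⟩⟩
    exact fun x hx => hfix x ((H.aec.le_sub _ _ hle).1 hx)
  · rintro ⟨-, a, T, ha₁, ha⟩
    obtain ⟨N, hN⟩ := exists_witness_right ha.1
    exact ⟨hle, a, N, ((h₁.isTypeOf_iff H hM₁ hN).1 ha₁).2, ((h.isTypeOf_iff H hM hN).1 ha).2⟩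

/-- An element realizing the extension also realizes the smaller type, and is therefore an old
element. -/
theorem of_extends (H : Expandable k E mu) (hM : IsWitness k E M S)
    {M₁ : Model τ} {S₁ : Model (τ.expand lam)} (hM₁ : IsWitness k E M₁ S₁)
    {p : k.Typ M} {q : (k.adjoin E).Typ S} (h : TypeCorr k E p q)
    {q₁ : (k.adjoin E).Typ S₁} (hq : (k.adjoin E).Extends q q₁) :
    ∃ p₁ : k.Typ M₁, TypeCorr k E p₁ q₁ := by
  obtain ⟨-, a, T, ha₁, ha⟩ := hq
  obtain ⟨N, hN⟩ := exists_witness_right ha.1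
  obtain ⟨-, haN, -⟩ := ((h.isTypeOf_iff H hM hN).1 ha).2
  obtain ⟨p₁, h1, -⟩ := typeCorr_of_mem hM₁ hN ha₁ haN
  exact ⟨p₁, h1⟩

end TypeCorr

theorem IsWitness.sameType_iff (H : Expandable k E mu) {M N N' : Model τ}
    {S T T' : Model (τ.expand lam)} (hM : IsWitness k E M S)
    (hN : IsWitness k E N T) (hN' : IsWitness k E N' T') {a a' : ZFSet.{u}}
    (h : (k.adjoin E).le S T) (h' : (k.adjoin E).le S T') (haN : a ∈ N.carrier) :
    (k.adjoin E).SameType S a T a' T' ↔ k.SameType M a N a' N' := by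
  constructor
  · rintro ⟨q, h1, h2⟩
    obtain ⟨p, hp, h3⟩ := typeCorr_of_mem hM hN h1 haN
    exact ⟨p, h3, ((hp.isTypeOf_iff H hM hN').1 h2).2⟩
  · rintro ⟨p, h1, h2⟩
    obtain ⟨q, hq⟩ := TypeCorr.exists_up H hM p
    exact ⟨q, (hq.isTypeOf_iff H hM hN).2 ⟨h, h1⟩, (hq.isTypeOf_iff H hM hN').2 ⟨h', h2⟩⟩

end AdjoinTypes

/-! ### Witnesses of continuous chains; comparison of restrictions. -/

section Chains

variable {τ : Vocab.{u}} {lam : Cardinal.{u}} {mu : WithTop Cardinal.{u}} {k : ModelClass τ}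
  {E : SeqRel τ lam}

theorem ModelClass.IncreasingContinuous.exists_witnesses
    {δ : Ordinal.{u}} {S : Ordinal.{u} → Model (τ.expand lam)}
    (hS : (k.adjoin E).IncreasingContinuous δ S) :
    ∃ W : Ordinal.{u} → Model τ, (∀ i ≤ δ, IsWitness k E (W i) (S i)) ∧
      k.IncreasingContinuous δ W := by
  have hex : ∀ i, ∃ W, i ≤ δ → IsWitness k E W (S i) := fun i => by
    by_cases hi : i ≤ δ
    · obtain ⟨W, hW⟩ := exists_witness_right (hS.1 i i le_rfl hi)
      exact ⟨W, fun _ => hW⟩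
    · obtain ⟨W, hW⟩ := exists_witness_right (hS.1 δ δ le_rfl le_rfl)
      exact ⟨W, fun h => (hi h).elim⟩
  choose W hW using hex
  refine ⟨W, hW, fun i j hij hj => (hW i (hij.trans hj)).le_of_le (hW j hj) (hS.1 i j hij hj),
    fun j hj hl => ?_⟩
  exact (hW j hj).carrier_iUnion (fun i hi => hW i (hi.le.trans hj)) (hS.2 j hj hl)
    fun i hi => hS.1 i j hi.le hj

theorem restr_mono (hE : IsSmooth k E) (hk : k.IsEssAEC lam mu) {M N L : Model τ}
    {T : Model (τ.expand lam)} (hL : IsWitness k E L T) (hMN : k.le M N) (hNL : k.le N L) :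
    (k.adjoin E).le (restr E T M) (restr E T N) :=
  ((hL.restr hE hk (hk.trans _ _ _ hMN hNL)).le_iff (hL.restr hE hk hNL)).2
    ⟨expandModel_sub hE hk hMN ((hL.naming hE hk).mono hE hk hNL) rfl fun _ _ => rfl, hMN⟩

/-- An expansion below `T` is below the restriction of `T` to any model above its witness. -/
theorem IsWitness.le_restr (hE : IsSmooth k E) (hk : k.IsEssAEC lam mu) {M N L : Model τ}
    {S T : Model (τ.expand lam)} (hM : IsWitness k E M S) (hL : IsWitness k E L T)
    (hST : (k.adjoin E).le S T) (hMN : k.le M N) (hNL : k.le N L) :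
    (k.adjoin E).le S (EssFrame.restr E T N) := by
  rw [hM.eq_restr hE hk hL hST.1 (hk.trans _ _ _ hMN hNL)]
  exact restr_mono hE hk hL hMN hNL

end Chains

/-! ### Goodness of the expanded frame. -/

section Good

variable {τ : Vocab.{u}} {lam : Cardinal.{u}} {mu : WithTop Cardinal.{u}} {s : Frame τ}
  {E : SeqRel τ lam}

theorem Frame.IsGood.expandable (hs : s.IsGood lam mu) (hE : IsSmooth s.k E)
    (hsm : IsSmall s.k E) : Expandable s.k E mu :=
  ⟨hE, hsm, hs.essAEC, hs.amalgamation⟩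

/-- Expansions of isomorphic models are isomorphic, so universality and closure under unions are
inherited from the witnesses. -/
theorem isSuperlimit_adjoin (H : Expandable s.k E mu) {χ : Cardinal.{u}} {M : Model τ}
    (hM : s.k.IsSuperlimit χ M) {S : Model (τ.expand lam)} (hS : IsWitness s.k E M S) :
    (s.k.adjoin E).IsSuperlimit χ S := by
  obtain ⟨hE, hsm, hk, hA⟩ := H
  obtain ⟨hMK, hc, ⟨N, hMN, hne⟩, huniv, hchain⟩ := hM
  refine ⟨⟨M, hS⟩, by rw [hS.card_eq hE hsm hk, hc], ?_, ?_, ?_⟩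
  · obtain ⟨f, N', T, hf, hfix, hle, hT, hST⟩ := hS.exists_lift_copy hE hk hMN
    refine ⟨T, hST, ?_⟩
    rintro rfl
    obtain rfl := hS.unique hT
    -- If the extension were not proper, the copy of `N` would be `M`; an injection of `N` into `M`
    -- that fixes `M` forces `N = M`.
    refine hne ((hk.le_sub _ _ hMN).eq_of_subset fun x hx => ?_)
    have h1 := hf.mapsTo hx
    have h2 := hfix _ h1
    rwa [← hf.1.injOn ((hk.le_sub _ _ hMN).1 h1) hx h2]
  · rintro T ⟨N, hN⟩ hTc
    rw [hN.card_eq hE hsm hk] at hTc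
    obtain ⟨f, hf⟩ := huniv N hN.mem hTc
    obtain ⟨g, hg, -⟩ := hN.exists_isEmb hE hk hS hf
    exact ⟨g, hg⟩
  · rintro δ S' T hδ hδχ hinc hiso ⟨U, hU⟩ hTc hle
    have hex : ∀ i, ∃ W, i < δ → IsWitness s.k E W (S' i) := fun i => by
      by_cases hi : i < δ
      · obtain ⟨W, hW⟩ := exists_witness_right (hinc i i le_rfl hi)
        exact ⟨W, fun _ => hW⟩
      · exact ⟨M, fun h => (hi h).elim⟩
    choose W hW using hex
    obtain ⟨f, hf⟩ := hchain δ W U hδ hδχ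
      (fun i j hij hj => (hW i (hij.trans_lt hj)).le_of_le (hW j hj) (hinc i j hij hj))
      (fun i hi => by
        obtain ⟨f, hf⟩ := hiso i hi
        exact ⟨f, hS.isIso hE hk (hW i hi) hf⟩) hU.mem (hU.carrier_iUnion hW hTc hle)
      fun i hi => (hW i hi).le_of_le hU (hle i hi)
    obtain ⟨g, hg, -⟩ := hS.exists_isIso hE hk hU hf
    exact ⟨g, hg⟩

variable {M N : Model τ} {S T : Model (τ.expand lam)}

theorem isBasic_adjoin_iff (hs : s.IsGood lam mu) (H : Expandable s.k E mu)
    (hM : IsWitness s.k E M S) (hN : IsWitness s.k E N T) {a : ZFSet.{u}} :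
    (s.adjoin E).IsBasic S T a ↔ (s.k.adjoin E).le S T ∧ s.IsBasic M N a := by
  constructor
  · rintro ⟨h, ha, T', a', ⟨h', ha', heq⟩, M', N', hM', hN', -, -, hle, haN', hb⟩
    obtain rfl := hM.unique hM'
    obtain ⟨haN, heq'⟩ := (hM.ortp_eq_iff H hN' hN h' h ha' ha haN').1 heq.symm
    exact ⟨h, hM.le_of_le hN h, haN, heq' ▸ hb⟩
  · rintro ⟨h, hb⟩
    have hna := hs.bs_nonalgebraic M N a hb
    obtain ⟨hle, haN, hb'⟩ := id hb
    exact ⟨h, hN.subset haN, T, a, ⟨h, hN.subset haN, rfl⟩, M, N, hM, hN, hle, hna, hb⟩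

theorem mem_of_isBasic_adjoin (hs : s.IsGood lam mu) (H : Expandable s.k E mu)
    (h : (s.adjoin E).IsBasic S T a) :
    ∃ M N, IsWitness s.k E M S ∧ IsWitness s.k E N T ∧ (s.k.adjoin E).le S T ∧
      s.IsBasic M N a := by
  have hle : (s.k.adjoin E).le S T := h.1
  obtain ⟨N, hN⟩ := exists_witness_right hle
  obtain ⟨-, M, _, hM, -, -⟩ := id hle
  exact ⟨M, N, hM, hN, (isBasic_adjoin_iff hs H hM hN).1 h⟩

theorem TypeCorr.mem_bs_iff (hs : s.IsGood lam mu) (H : Expandable s.k E mu)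
    (hM : IsWitness s.k E M S) {p : s.k.Typ M} {q : (s.k.adjoin E).Typ S}
    (h : TypeCorr s.k E p q) : q ∈ (s.adjoin E).bs S ↔ p ∈ s.bs M := by
  constructor
  · rintro ⟨T, a, hq, M', N, hM', hN, hle, -, hMN, haN, hb⟩
    obtain rfl := hM.unique hM'
    obtain ⟨_, _, rfl⟩ := ((h.isTypeOf_iff H hM hN).1 hq).2
    exact hb
  · intro hp
    obtain ⟨a, N, T, hN, ⟨hle, ha, rfl⟩, hq⟩ := h
    have hb : s.IsBasic M N a := ⟨hle, ha, hp⟩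
    exact ⟨T, a, hq, M, N, hM, hN, hle, hs.bs_nonalgebraic M N a hb, hb⟩

theorem exists_typeCorr_of_mem_bs (hM : IsWitness s.k E M S) {q : (s.k.adjoin E).Typ S}
    (hq : q ∈ (s.adjoin E).bs S) : ∃ p : s.k.Typ M, TypeCorr s.k E p q := by
  obtain ⟨T, a, hq, M', N, hM', hN, hle, -, hMN, haN, hb⟩ := hq
  obtain ⟨p, hp, -⟩ := typeCorr_of_mem hM hN hq haN
  exact ⟨p, hp⟩

theorem nf_adjoin_iff {M₀ M₁ M₃ : Model τ} {S₀ S₁ S₃ : Model (τ.expand lam)}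
    (h₀ : IsWitness s.k E M₀ S₀) (h₁ : IsWitness s.k E M₁ S₁) (h₃ : IsWitness s.k E M₃ S₃)
    {a : ZFSet.{u}} : (s.adjoin E).nf S₀ S₁ a S₃ ↔
      (s.k.adjoin E).le S₀ S₁ ∧ (s.k.adjoin E).le S₁ S₃ ∧ s.nf M₀ M₁ a M₃ := by
  constructor
  · rintro ⟨h, h', N₀, N₁, N₃, k₀, k₁, k₃, hn⟩
    rw [h₀.unique k₀, h₁.unique k₁, h₃.unique k₃]
    exact ⟨h, h', hn⟩
  · rintro ⟨h, h', hn⟩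
    exact ⟨h, h', M₀, M₁, M₃, h₀, h₁, h₃, hn⟩

/-- One side of symmetry is equivalent to its version for the witnesses, and the other side is an
instance with the elements exchanged. Upwards, `M₃'` is copied over `M₃` and expanded, and the
expansion of the image of `M₁` is cut out by restriction. -/
theorem nf_symm_adjoin_aux (hs : s.IsGood lam mu) (H : Expandable s.k E mu)
    {M₀ M₃ : Model τ} {S₀ S₃ : Model (τ.expand lam)}
    (h₀ : IsWitness s.k E M₀ S₀) (h₃ : IsWitness s.k E M₃ S₃) {a₁ a₂ : ZFSet.{u}}
    (hle : (s.k.adjoin E).le S₀ S₃) (ha₁ : a₁ ∈ M₃.carrier) (ha₂ : a₂ ∈ M₃.carrier) :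
    (∃ S₁ S₃', (s.k.adjoin E).le S₀ S₁ ∧ (s.k.adjoin E).le S₁ S₃' ∧ a₁ ∈ S₁.carrier ∧
      (s.k.adjoin E).le S₃ S₃' ∧ (s.adjoin E).nf S₀ S₁ a₂ S₃') ↔
    (∃ M₁ M₃', s.k.le M₀ M₁ ∧ s.k.le M₁ M₃' ∧ a₁ ∈ M₁.carrier ∧ s.k.le M₃ M₃' ∧
        s.nf M₀ M₁ a₂ M₃') := by
  have hE := H.smooth
  have hk := H.aec
  constructor
  · rintro ⟨S₁, S₃', e₁, e₂, ha, e₃, hn⟩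
    obtain ⟨M₁, h₁⟩ := exists_witness_right e₁
    obtain ⟨M₃', h₃'⟩ := exists_witness_right e₃
    refine ⟨M₁, M₃', h₀.le_of_le h₁ e₁, h₁.le_of_le h₃' e₂, ?_, h₃.le_of_le h₃' e₃,
      ((nf_adjoin_iff h₀ h₁ h₃').1 hn).2.2⟩
    exact (h₁.mem_of_mem h₃' e₂.1 ha).2 ((hk.le_sub _ _ (h₃.le_of_le h₃' e₃)).1 ha₁)
  · rintro ⟨M₁, M₃', e₁, e₂, ha, e₃, hn⟩
    obtain ⟨f, N, T, hf, hfix, hle', hT, hST⟩ := h₃.exists_lift_copy hE hk e₃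
    have hf₁ := hf.restrict_map (hk.le_sub _ _ e₂)
    have hfix₀ : ∀ x ∈ M₀.carrier, f x = x := fun x hx =>
      hfix x ((hk.le_sub _ _ (h₀.le_of_le h₃ hle)).1 hx)
    have e₁' := hk.iso_le _ _ _ _ _ hf₁ (.of_fix hfix₀) e₁
    have e₂' := hk.iso_le _ _ _ _ _ hf hf₁ e₂
    have hr := hT.restr hE hk e₂'
    have hle₁ := h₀.le_restr hE hk hT (H.aec_adjoin.trans _ _ _ hle hST) e₁' e₂'
    have hle₂ := hT.restr_le hE hk e₂'
    refine ⟨_, T, hle₁, hle₂, hr.subset ⟨a₁, ha, hfix a₁ ha₁⟩, hST,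
      (nf_adjoin_iff h₀ hr hT).2 ⟨hle₁, hle₂, ?_⟩⟩
    have := hs.nf_iso f _ _ _ _ _ _ _ hf hf₁ (.of_fix hfix₀) hn
    rwa [hfix a₂ ha₂] at this

/-- A copy of the amalgam of the witnesses is expanded over `S₀`; its restrictions to the two images
receive the lifted isomorphisms. -/
theorem nf_amalgamation_adjoin (hs : s.IsGood lam mu) (H : Expandable s.k E mu)
    {S₀ S₁ S₂ : Model (τ.expand lam)} {a₁ a₂ : ZFSet.{u}} (hb₁ : (s.adjoin E).IsBasic S₀ S₁ a₁)
    (hb₂ : (s.adjoin E).IsBasic S₀ S₂ a₂) :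
    ∃ S₃ T₁ T₂ f₁ f₂, (s.k.adjoin E).le S₀ S₃ ∧ Model.IsIso f₁ S₁ T₁ ∧ Model.IsIso f₂ S₂ T₂ ∧
      (s.k.adjoin E).le T₁ S₃ ∧ (s.k.adjoin E).le T₂ S₃ ∧
      (∀ x ∈ S₀.carrier, f₁ x = x ∧ f₂ x = x) ∧
      (s.adjoin E).nf S₀ T₂ (f₁ a₁) S₃ ∧ (s.adjoin E).nf S₀ T₁ (f₂ a₂) S₃ := by
  have hE := H.smooth
  have hk := H.aec
  obtain ⟨M₀, M₁, hM₀, hM₁, hle₁, hb₁⟩ := mem_of_isBasic_adjoin hs H hb₁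
  obtain ⟨M₀', M₂, hM₀', hM₂, hle₂, hb₂⟩ := mem_of_isBasic_adjoin hs H hb₂
  obtain rfl := hM₀.unique hM₀'
  obtain ⟨M₃, N₁, N₂, f₁, f₂, hle, i₁, i₂, e₁, e₂, hfix, n₁, n₂⟩ :=
    hs.nf_amalgamation M₀ M₁ M₂ a₁ a₂ hb₁ hb₂
  obtain ⟨h, M₃', T, hh, hhfix, hle', hT, hST⟩ := hM₀.exists_lift_copy hE hk hle
  have j₁ := hh.restrict_map (hk.le_sub _ _ e₁)
  have j₂ := hh.restrict_map (hk.le_sub _ _ e₂)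
  have e₁' := hk.iso_le _ _ _ _ _ hh j₁ e₁
  have e₂' := hk.iso_le _ _ _ _ _ hh j₂ e₂
  have r₁ := hT.restr hE hk e₁'
  have r₂ := hT.restr hE hk e₂'
  obtain ⟨g₁, hg₁, hgf₁⟩ := hM₁.exists_isIso hE hk r₁ (j₁.comp i₁)
  obtain ⟨g₂, hg₂, hgf₂⟩ := hM₂.exists_isIso hE hk r₂ (j₂.comp i₂)
  have n₁' := hs.nf_iso h _ _ _ _ _ _ _ hh j₂ (.of_fix hhfix) n₁
  have n₂' := hs.nf_iso h _ _ _ _ _ _ _ hh j₁ (.of_fix hhfix) n₂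
  have b₁ := hM₀.le_restr hE hk hT hST (hs.nf_basic _ _ _ _ n₂').1 e₁'
  have b₂ := hM₀.le_restr hE hk hT hST (hs.nf_basic _ _ _ _ n₁').1 e₂'
  have c₁ := hT.restr_le hE hk e₁'
  have c₂ := hT.restr_le hE hk e₂'
  have ha₁ : a₁ ∈ M₁.carrier := hb₁.2.1
  have ha₂ : a₂ ∈ M₂.carrier := hb₂.2.1
  refine ⟨T, _, _, g₁, g₂, hST, hg₁, hg₂, c₁, c₂, fun x hx => ⟨?_, ?_⟩,
    (nf_adjoin_iff hM₀ r₂ hT).2 ⟨b₂, c₂, ?_⟩, (nf_adjoin_iff hM₀ r₁ hT).2 ⟨b₁, c₁, ?_⟩⟩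
  · refine hM₀.fix hE hk hg₁ hle₁.1 hST.1 c₁.1 (fun x hx => ?_) x hx
    rw [hgf₁ x ((hk.le_sub _ _ hb₁.1).1 hx), Function.comp_apply, (hfix x hx).1, hhfix x hx]
  · refine hM₀.fix hE hk hg₂ hle₂.1 hST.1 c₂.1 (fun x hx => ?_) x hx
    rw [hgf₂ x ((hk.le_sub _ _ hb₂.1).1 hx), Function.comp_apply, (hfix x hx).2, hhfix x hx]
  · rw [hgf₁ a₁ ha₁]; exact n₁'
  · rw [hgf₂ a₂ ha₂]; exact n₂'

theorem nf_extension_adjoin (hs : s.IsGood lam mu) (H : Expandable s.k E mu)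
    {S T L : Model (τ.expand lam)} {a : ZFSet.{u}} (hST : (s.k.adjoin E).le S T)
    (hb : (s.adjoin E).IsBasic S L a) :
    ∃ b L', (s.adjoin E).nf S T b L' ∧ (s.k.adjoin E).SameType S a L b L' := by
  have hE := H.smooth
  have hk := H.aec
  obtain ⟨M, K, hM, hK, hSL, hb⟩ := mem_of_isBasic_adjoin hs H hb
  obtain ⟨N, hN⟩ := exists_witness_right hST
  have hMN := hM.le_of_le hN hST
  obtain ⟨b, K', hn, p, hp₁, hp₂⟩ := hs.nf_extension M N a K hMN hb
  obtain ⟨-, hNK, -⟩ := hs.nf_basic _ _ _ _ hn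
  obtain ⟨f, K'', L', hf, hfix, hle, hL', hTL'⟩ := hN.exists_lift_copy hE hk hNK
  have hfixM : ∀ x ∈ M.carrier, f x = x := fun x hx => hfix x ((hk.le_sub _ _ hMN).1 hx)
  refine ⟨f b, L', (nf_adjoin_iff hM hN hL').2 ⟨hST, hTL',
    hs.nf_iso f _ _ _ _ _ _ _ hf (.of_fix hfix) (.of_fix hfixM) hn⟩, ?_⟩
  exact (hM.sameType_iff H hK hL' hSL (H.aec_adjoin.trans _ _ _ hST hTL') hb.2.1).2
    ⟨p, hp₁, hp₂.iso hk hf hfixM⟩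

theorem IsWitness.eq_of_eq (hE : IsSmooth s.k E) (hk : s.k.IsEssAEC lam mu)
    (hM : IsWitness s.k E M S) (hN : IsWitness s.k E N T) (hST : S.Sub T) (h : M = N) :
    S = T := by
  subst h
  rw [hM.eq_restr hE hk hN hST (hk.refl M hM.mem), ← hN.eq_restr hE hk hN (.refl T) (hk.refl M hM.mem)]

/-- The frame obtained by adding names for the classes of a small smooth equivalence relation is
good. -/
theorem adjoin_isGood (hs : s.IsGood lam mu) (hE : IsSmooth s.k E) (hsm : IsSmall s.k E) :
    (s.adjoin E).IsGood lam mu := by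
  have H := hs.expandable hE hsm
  have hk := hs.essAEC
  have hk' := H.aec_adjoin
  constructor
  · exact hk'
  · change ((s.k.adjoin E).up lam).IsEssAEC lam ⊤
    rw [up_adjoin hk hs.essAEC_up hE hsm]
    exact adjoin_isEssAEC (upRel_isSmooth hk hs.essAEC_up hE)
      (upRel_isSmall hk hs.essAEC_up hE hsm) hs.essAEC_up
  · intro χ h h'
    obtain ⟨M, hM⟩ := hs.superlimit χ h h'
    obtain ⟨S, hS⟩ := exists_witnessed hE hk hM.1
    exact ⟨S, isSuperlimit_adjoin H hM hS⟩
  · exact (numIso_adjoin hE hsm hk lam).trans_le hs.numIso_le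
  · exact H.amalg_adjoin
  · rintro S₁ ⟨M₁, h₁⟩ S₂ ⟨M₂, h₂⟩
    obtain ⟨M₃, f₁, f₂, e₁, e₂⟩ := hs.jointEmbedding M₁ h₁.mem M₂ h₂.mem
    have h₃ : M₃ ∈ s.k.K := by
      obtain ⟨_, -, h⟩ := e₁
      exact (hk.le_mem _ _ h).2
    obtain ⟨S₃, hS₃⟩ := exists_witnessed hE hk h₃
    obtain ⟨g₁, hg₁, -⟩ := h₁.exists_isEmb hE hk hS₃ e₁
    obtain ⟨g₂, hg₂, -⟩ := h₂.exists_isEmb hE hk hS₃ e₂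
    exact ⟨S₃, g₁, g₂, hg₁, hg₂⟩
  · rintro S ⟨M, hM⟩
    obtain ⟨N, hMN, hne⟩ := hs.no_maximal M hM.mem
    obtain ⟨f, N', T, hf, hfix, hle, hT, hST⟩ := hM.exists_lift_copy hE hk hMN
    refine ⟨T, hST, ?_⟩
    rintro rfl
    obtain rfl := hM.unique hT
    refine hne ((hk.le_sub _ _ hMN).eq_of_subset fun x hx => ?_)
    have h1 := hf.mapsTo hx
    have h2 := hfix _ h1
    rwa [← hf.1.injOn ((hk.le_sub _ _ hMN).1 h1) hx h2]
  · intro f S T S' T' a hf hf' hb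
    obtain ⟨M, N, hM, hN, hle, hb⟩ := mem_of_isBasic_adjoin hs H hb
    obtain ⟨h1, h2⟩ := hM.map hE hk hf'
    obtain ⟨h3, h4⟩ := hN.map hE hk hf
    exact (isBasic_adjoin_iff hs H h1 h3).2 ⟨hk'.iso_le _ _ _ _ _ hf hf' hle,
      hs.bs_iso f M N _ _ a h4 h2 hb⟩
  · intro S T a hb ha
    obtain ⟨M, N, hM, hN, hle, hb⟩ := mem_of_isBasic_adjoin hs H hb
    exact hs.bs_nonalgebraic M N a hb ((hM.mem_of_mem hN hle.1 ha).2 hb.2.1)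
  · rintro S T ⟨hST, M, N, hM, hN, hMN⟩ hne
    have hle := (hM.le_iff hN).2 ⟨hST, hMN⟩
    obtain ⟨a, haN, haM, hb⟩ := hs.bs_density M N hMN fun h => hne (hM.eq_of_eq hE hk hN hST h)
    exact ⟨a, hN.subset haN, fun h => haM ((hM.mem_of_mem hN hST h).2 haN),
      (isBasic_adjoin_iff hs H hM hN).2 ⟨hle, hb⟩⟩
  · rintro S ⟨M, hM⟩
    have hex : ∀ q : (s.adjoin E).bs S, ∃ p : s.bs M, TypeCorr s.k E p.1 q.1 := by
      rintro ⟨q, hq⟩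
      obtain ⟨p, hp⟩ := exists_typeCorr_of_mem_bs hM hq
      exact ⟨⟨p, (hp.mem_bs_iff hs H hM).1 hq⟩, hp⟩
    -- The correspondence is injective on basic types, so stability of the witness bounds their
    -- number.
    choose r hr using hex
    refine (mk_le_of_injective (f := r) fun q q' h => Subtype.ext ?_).trans
      ((hs.bs_stability M hM.mem).trans (mk_le_mk_of_subset hM.subset))
    exact ((hr q).eq_iff H hM (hr q')).1 (congrArg Subtype.val h)
  · rintro S₀ S₁ a S₃ ⟨e₁, e₂, M₀, M₁, M₃, h₀, h₁, h₃, hn⟩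
    obtain ⟨k₁, k₂, k₃, k₄, k₅, k₆⟩ := hs.nf_basic _ _ _ _ hn
    exact ⟨e₁, e₂, h₃.subset k₃, fun h => k₄ ((h₁.mem_of_mem h₃ e₂.1 h).2 k₃),
      (isBasic_adjoin_iff hs H h₀ h₃).2 ⟨hk'.trans _ _ _ e₁ e₂, k₅⟩,
      (isBasic_adjoin_iff hs H h₁ h₃).2 ⟨e₂, k₆⟩⟩
  · rintro f S₀ S₁ a S₃ S₀' S₁' S₃' f₃ f₁ f₀ ⟨e₁, e₂, M₀, M₁, M₃, h₀, h₁, h₃, hn⟩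
    obtain ⟨k₀, i₀⟩ := h₀.map hE hk f₀
    obtain ⟨k₁, i₁⟩ := h₁.map hE hk f₁
    obtain ⟨k₃, i₃⟩ := h₃.map hE hk f₃
    exact (nf_adjoin_iff k₀ k₁ k₃).2 ⟨hk'.iso_le _ _ _ _ _ f₁ f₀ e₁,
      hk'.iso_le _ _ _ _ _ f₃ f₁ e₂, hs.nf_iso f _ _ _ _ _ _ _ i₃ i₁ i₀ hn⟩
  · intro S₀ a S₃ hle ha
    obtain ⟨-, M₀, M₃, h₀, h₃, hM⟩ := id hle
    rw [nf_adjoin_iff h₀ h₀ h₃, isBasic_adjoin_iff hs H h₀ h₃]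
    constructor
    · rintro ⟨-, h, hn⟩
      exact ⟨h, (hs.nf_basic _ _ _ _ hn).2.2.2.2.1⟩
    · rintro ⟨h, hb⟩
      exact ⟨hk'.refl _ ⟨M₀, h₀⟩, h, (hs.nf_self _ _ _ hM hb.2.1).2 hb⟩
  · rintro S₀ S₀' S₁' S₁ S₃ S₃' S₃'' a e₁ e₂ e₃ e₄ e₅ e₆ hsub ⟨-, -, M₀, M₁, M₃, h₀, h₁, h₃, hn⟩
    obtain ⟨M₀', h₀'⟩ := exists_witness_right e₁
    obtain ⟨M₁', h₁'⟩ := exists_witness_right e₂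
    obtain ⟨M₃', h₃'⟩ := exists_witness_right e₅
    obtain ⟨M₃'', h₃''⟩ : ∃ M, IsWitness s.k E M S₃'' := by
      obtain ⟨-, M, _, hM, -, -⟩ := e₆
      exact ⟨M, hM⟩
    have l₁ := h₁.le_of_le h₃ e₄
    have l₅ := h₃.le_of_le h₃' e₅
    have e₁₃ := hk'.trans _ _ _ e₄ e₅
    -- Here `S₃''` need not be above `S₃`; coherence inside `S₃'` puts it above `S₁`.
    have e₁₃'' : (s.k.adjoin E).le S₁ S₃'' := hk'.coherent _ _ _
      (e₁₃.1.of_subset e₆.1 (Set.subset_union_left.trans hsub)) e₁₃ e₆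
    have ha : a ∈ M₃''.carrier := (h₃''.mem_of_mem h₃' e₆.1 (hsub (Or.inr rfl))).2
      ((hk.le_sub _ _ l₅).1 (hs.nf_basic _ _ _ _ hn).2.2.1)
    have l₁₃ := h₁.le_of_le h₃'' e₁₃''
    obtain ⟨n₁, n₂⟩ := hs.nf_mono M₀ M₀' M₁' M₁ M₃ M₃' M₃'' a (h₀.le_of_le h₀' e₁)
      (h₀'.le_of_le h₁' e₂) (h₁'.le_of_le h₁ e₃) l₁ l₅ (h₃''.le_of_le h₃' e₆)
      (Set.union_subset (hk.le_sub _ _ l₁₃).1 (by simpa using ha)) hn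
    exact ⟨(nf_adjoin_iff h₀' h₁' h₃').2 ⟨e₂, hk'.trans _ _ _ e₃ e₁₃, n₁⟩,
      (nf_adjoin_iff h₀' h₁' h₃'').2 ⟨e₂, hk'.trans _ _ _ e₃ e₁₃'', n₂⟩⟩
  · intro δ S T a hδ hS hb
    obtain ⟨W, hW, hWc⟩ := ModelClass.IncreasingContinuous.exists_witnesses hS
    obtain ⟨M, N, hM, hN, hle, hb⟩ := mem_of_isBasic_adjoin hs H hb
    obtain rfl := (hW δ le_rfl).unique hM
    obtain ⟨i, hi, hn⟩ := hs.nf_localChar δ W N a hδ hWc hb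
    exact ⟨i, hi, fun j hij hj => (nf_adjoin_iff (hW j hj.le) hM hN).2
      ⟨hS.1 j δ hj.le le_rfl, hle, hn j hij hj⟩⟩
  · rintro S₀ S₀' S₀'' S₃ a e₁ e₂ e₃ ⟨-, -, M₀', M₀'', M₃, h₀', h₀'', h₃, n₁⟩ n₂
    obtain ⟨-, M₀, _, h₀, -, -⟩ := id e₁
    have n₂' := ((nf_adjoin_iff h₀ h₀' h₃).1 n₂).2.2
    exact (nf_adjoin_iff h₀ h₀'' h₃).2 ⟨hk'.trans _ _ _ e₁ e₂, e₃,
      hs.nf_trans _ _ _ _ _ (h₀.le_of_le h₀' e₁) (h₀'.le_of_le h₀'' e₂) (h₀''.le_of_le h₃ e₃) n₁ n₂'⟩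
  · rintro S₀ S₁ a T a' T' ⟨e₁, e₂, M₀, M₁, N, h₀, h₁, h, n₁⟩ n₂ ht
    have e₂' : (s.k.adjoin E).le S₁ T' := n₂.2.1
    obtain ⟨N', h'⟩ := exists_witness_right e₂'
    have n₂' := ((nf_adjoin_iff h₀ h₁ h').1 n₂).2.2
    have ha := (hs.nf_basic _ _ _ _ n₁).2.2.1
    exact (h₁.sameType_iff H h h' e₂ e₂' ha).2 <| hs.nf_unique _ _ _ _ _ _ n₁ n₂' <|
      (h₀.sameType_iff H h h' (hk'.trans _ _ _ e₁ e₂) (hk'.trans _ _ _ e₁ e₂') ha).1 ht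
  · intro S₀ S₃ a₁ a₂ hb₁ hb₂
    obtain ⟨M₀, M₃, h₀, h₃, hle, hb₁⟩ := mem_of_isBasic_adjoin hs H hb₁
    have hb₂ := ((isBasic_adjoin_iff hs H h₀ h₃).1 hb₂).2
    exact (nf_symm_adjoin_aux hs H h₀ h₃ hle hb₁.2.1 hb₂.2.1).trans
      ((hs.nf_symm M₀ M₃ a₁ a₂ hb₁ hb₂).trans
        (nf_symm_adjoin_aux hs H h₀ h₃ hle hb₂.2.1 hb₁.2.1).symm)
  · exact fun S T a L hST hb => nf_extension_adjoin hs H hST hb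
  · intro δ S T a hδ hS hle ha hn
    obtain ⟨W, hW, hWc⟩ := ModelClass.IncreasingContinuous.exists_witnesses hS
    obtain ⟨N, hN⟩ := exists_witness_right hle
    have hpos := pos_of_isSuccLimit hδ
    have hn' : ∀ i < δ, s.nf (W 0) (W i) a N := fun i hi =>
      ((nf_adjoin_iff (hW 0 hpos.le) (hW i hi.le) hN).1 (hn i hi)).2.2
    refine (nf_adjoin_iff (hW 0 hpos.le) (hW δ le_rfl) hN).2 ⟨hS.1 0 δ hpos.le le_rfl, hle, ?_⟩
    exact hs.nf_continuity δ W N a hδ hWc ((hW δ le_rfl).le_of_le hN hle)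
      (hs.nf_basic _ _ _ _ (hn' 0 hpos)).2.2.1 hn'
  · exact fun S₀ S₁ S₂ a₁ a₂ hb₁ hb₂ => nf_amalgamation_adjoin hs H hb₁ hb₂

end Good

/-! ### Primes, orthogonality and regular types. -/

section PrimesRegulars

variable {τ : Vocab.{u}} {lam : Cardinal.{u}} {mu : WithTop Cardinal.{u}} {s : Frame τ}
  {E : SeqRel τ lam} {M N : Model τ} {S T : Model (τ.expand lam)}

/-- The prime model over `M` is copied off `S` and expanded. Its embedding into the witness of
another realization, precomposed with the inverse of the copying map, lifts to the expansions. -/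
theorem adjoin_hasPrimes (hs : s.IsGood lam mu) (H : Expandable s.k E mu) (hp : s.HasPrimes) :
    (s.adjoin E).HasPrimes := by
  have hE := H.smooth
  have hk := H.aec
  rintro S ⟨M, hM⟩ q hq
  obtain ⟨p, hpq⟩ := exists_typeCorr_of_mem_bs hM hq
  obtain ⟨N, a, ha, hb, hprime⟩ := hp M hM.mem p ((hpq.mem_bs_iff hs H hM).1 hq)
  obtain ⟨f, N', T, hf, hfix, hle, hT, hST⟩ := hM.exists_lift_copy hE hk hb.1
  have haN : a ∈ N.carrier := hb.2.1
  have hb' := hs.bs_iso f M N M N' a hf (.of_fix hfix) hb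
  have hbT := (isBasic_adjoin_iff hs H hM hT).2 ⟨hST, hb'⟩
  refine ⟨T, f a, (hpq.isTypeOf_iff H hM hT).2 ⟨hST, ha.iso hk hf hfix⟩, hbT, ?_⟩
  intro T₁ a₁ hb₁ ht
  have hST₁ : (s.k.adjoin E).le S T₁ := hb₁.1
  obtain ⟨N₁, hT₁⟩ := exists_witness_right hST₁
  obtain ⟨p', hp', hp₁⟩ := (hM.sameType_iff H hT hT₁ hST hST₁ (hf.mapsTo haN)).1 ht
  obtain rfl := (ha.iso hk hf hfix).unique hp'
  obtain ⟨g, hg, hgfix, hga⟩ := hprime N₁ a₁ ((isBasic_adjoin_iff hs H hM hT₁).1 hb₁).2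
    ⟨p, ha, hp₁⟩
  obtain ⟨i, hi, hig⟩ := hT.exists_isEmb hE hk hT₁
    (hg.comp hk (.of_iso hk (hk.le_mem _ _ hle).2 hf.inv))
  have key : ∀ x ∈ N.carrier, i (f x) = g x := fun x hx => by
    rw [hig _ (hf.mapsTo hx), Function.comp_apply, hf.inv_apply hx]
  refine ⟨i, hi, hM.fix_emb hE hk hi hST.1 hST₁.1 fun x hx => ?_, by rw [key a haN, hga]⟩
  have := key x ((hk.le_sub _ _ hb.1).1 hx)
  rwa [hfix x hx, hgfix x hx] at this

theorem TypeCorr.doesNotFork_iff (hs : s.IsGood lam mu) (H : Expandable s.k E mu)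
    (hM : IsWitness s.k E M S) {M₁ : Model τ} {S₁ : Model (τ.expand lam)}
    (hM₁ : IsWitness s.k E M₁ S₁) (hS : (s.k.adjoin E).le S S₁) {p : s.k.Typ M₁}
    {q : (s.k.adjoin E).Typ S₁} (h : TypeCorr s.k E p q) :
    (s.adjoin E).DoesNotFork S q ↔ s.DoesNotFork M p := by
  constructor
  · rintro ⟨a, T, ha, hn⟩
    have hle : (s.k.adjoin E).le S₁ T := ha.1
    obtain ⟨N, hN⟩ := exists_witness_right hle
    exact ⟨a, N, ((h.isTypeOf_iff H hM₁ hN).1 ha).2, ((nf_adjoin_iff hM hM₁ hN).1 hn).2.2⟩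
  · rintro ⟨a, N, ha, hn⟩
    obtain ⟨f, N', T, hf, hfix, hle, hT, hST⟩ := hM₁.exists_lift_copy H.smooth H.aec ha.1
    have hfixM : ∀ x ∈ M.carrier, f x = x := fun x hx =>
      hfix x ((H.aec.le_sub _ _ (hM.le_of_le hM₁ hS)).1 hx)
    exact ⟨f a, T, (h.isTypeOf_iff H hM₁ hT).2 ⟨hST, ha.iso H.aec hf hfix⟩,
      (nf_adjoin_iff hM hM₁ hT).2 ⟨hS, hST,
        hs.nf_iso f _ _ _ _ _ _ _ hf (.of_fix hfix) (.of_fix hfixM) hn⟩⟩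

/-- Uniqueness triples of the expanded frame restrict to uniqueness triples of the witnesses. -/
theorem IsWitness.isUniqTriple (hs : s.IsGood lam mu) (H : Expandable s.k E mu)
    (hM : IsWitness s.k E M S) (hN : IsWitness s.k E N T) {a : ZFSet.{u}}
    (h : (s.adjoin E).IsUniqTriple S T a) : s.IsUniqTriple M N a := by
  have hE := H.smooth
  have hk := H.aec
  obtain ⟨hST, hb⟩ := (isBasic_adjoin_iff hs H hM hN).1 h.1
  refine ⟨hb, fun M' N₁ N₂ f₁ f₂ hM' hN₁ hN₂ hf₁ hf₂ hfix hn₁ hn₂ => ?_⟩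
  have haN : a ∈ N.carrier := hb.2.1
  have hMN := (hk.le_sub _ _ hb.1).1
  have i1 := small_of_mem hk hM.mem
  have i2 := small_of_mem hk (hk.le_mem _ _ hN₁).2
  have i3 := small_of_mem hk (hk.le_mem _ _ hN₂).2
  have i4 := hM.small_carrier hE hk
  -- One renaming is used for both amalgams, so that the copy of `M'` is the same in each.
  obtain ⟨r, hr, hrM, hrS⟩ := exists_rename M.carrier (N₁.carrier ∪ N₂.carrier) S.carrier
  have r₁ : Model.IsIso r N₁ (N₁.map r) := Model.isIso_map (hr.mono Set.subset_union_left)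
  have r₂ : Model.IsIso r N₂ (N₂.map r) := Model.isIso_map (hr.mono Set.subset_union_right)
  have r' := r₁.restrict_map (hk.le_sub _ _ hN₁)
  have e' : s.k.le M (M'.map r) := hk.iso_le _ _ _ _ _ r' (.of_fix hrM) hM'
  have e₁ := hk.iso_le _ _ _ _ _ r₁ r' hN₁
  have e₂ := hk.iso_le _ _ _ _ _ r₂ r' hN₂
  have hd : ∀ x ∈ N₁.carrier ∪ N₂.carrier, r x ∈ S.carrier → r x ∈ M.carrier := by
    intro x hx h
    by_contra hc
    exact hrS x hx (fun h' => hc ((hrM x h').symm ▸ h')) h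
  have i5 : Small.{u} ((N₁.map r).carrier ∪ (N₂.map r).carrier : Set ZFSet.{u}) := by
    have := small_of_mem hk (hk.le_mem _ _ e₁).2
    have := small_of_mem hk (hk.le_mem _ _ e₂).2
    infer_instance
  -- The names added over the copy of `M'` must avoid both renamed amalgams; otherwise these could
  -- not be expanded over `S'`.
  obtain ⟨S', hS', hSS', hB⟩ := hM.exists_lift hE hk e' (by
    rintro _ ⟨x, hx, rfl⟩
    exact hd x (Or.inl ((hk.le_sub _ _ hN₁).1 hx))) ((N₁.map r).carrier ∪ (N₂.map r).carrier)
  have hd' : ∀ x ∈ N₁.carrier ∪ N₂.carrier, r x ∈ S'.carrier → r x ∈ (M'.map r).carrier := by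
    intro x hx h
    have hx' : r x ∈ (N₁.map r).carrier ∪ (N₂.map r).carrier :=
      hx.imp (fun h => ⟨x, h, rfl⟩) fun h => ⟨x, h, rfl⟩
    exact (hB _ h hx').elim id fun h => (hk.le_sub _ _ e').1 (hd x hx h)
  obtain ⟨T₁, hT₁, hST₁, -⟩ := hS'.exists_lift hE hk e₁ (by
    rintro _ ⟨x, hx, rfl⟩
    exact hd' x (Or.inl hx)) ∅
  obtain ⟨T₂, hT₂, hST₂, -⟩ := hS'.exists_lift hE hk e₂ (by
    rintro _ ⟨x, hx, rfl⟩
    exact hd' x (Or.inr hx)) ∅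
  obtain ⟨g₁, hg₁, hgf₁⟩ := hN.exists_isEmb hE hk hT₁
    ((ModelClass.IsEmb.of_iso hk (hk.le_mem _ _ hN₁).2 r₁).comp hk hf₁)
  obtain ⟨g₂, hg₂, hgf₂⟩ := hN.exists_isEmb hE hk hT₂
    ((ModelClass.IsEmb.of_iso hk (hk.le_mem _ _ hN₂).2 r₂).comp hk hf₂)
  have n₁ := hs.nf_iso r _ _ _ _ _ _ _ r₁ r' (.of_fix hrM) hn₁
  have n₂ := hs.nf_iso r _ _ _ _ _ _ _ r₂ r' (.of_fix hrM) hn₂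
  obtain ⟨L, j₁, j₂, hj₁, hj₂, hjfix, hj⟩ := h.2 S' T₁ T₂ g₁ g₂ hSS' hST₁ hST₂ hg₁ hg₂
    (fun x hx => ⟨hM.fix_emb hE hk hg₁ hST.1 (hSS'.1.trans hST₁.1) (fun x hx => by
        rw [hgf₁ x (hMN hx), Function.comp_apply, (hfix x hx).1, hrM x hx]) x hx,
      hM.fix_emb hE hk hg₂ hST.1 (hSS'.1.trans hST₂.1) (fun x hx => by
        rw [hgf₂ x (hMN hx), Function.comp_apply, (hfix x hx).2, hrM x hx]) x hx⟩)
    ((nf_adjoin_iff hM hS' hT₁).2 ⟨hSS', hST₁, by rw [hgf₁ a haN]; exact n₁⟩)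
    ((nf_adjoin_iff hM hS' hT₂).2 ⟨hSS', hST₂, by rw [hgf₂ a haN]; exact n₂⟩)
  obtain ⟨K, hK⟩ : ∃ K, IsWitness s.k E K L := by
    obtain ⟨_, -, h⟩ := hj₁
    exact exists_witness_right h
  have hj₁' := hT₁.isEmb hE hk hK hj₁
  have hj₂' := hT₂.isEmb hE hk hK hj₂
  have hfix' : ∀ x ∈ (M'.map r).carrier, j₁ x = x ∧ j₂ x = x :=
    fun x hx => hjfix x (hS'.subset hx)
  -- Undoes the renaming on `M'`, which the resulting maps have to fix pointwise.
  obtain ⟨ψ, K', hψ, hψM, -⟩ := exists_extend_iso hk r'.inv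
    (hj₁'.le_of_fix hk e₁ fun x hx => (hfix' x hx).1)
  have hKK := hK.mem
  have c := ModelClass.IsEmb.of_iso hk hKK hψ
  refine ⟨K', ψ ∘ j₁ ∘ r, ψ ∘ j₂ ∘ r,
    c.comp hk (hj₁'.comp hk (.of_iso hk (hk.le_mem _ _ hN₁).2 r₁)),
    c.comp hk (hj₂'.comp hk (.of_iso hk (hk.le_mem _ _ hN₂).2 r₂)), fun x hx => ?_, fun x hx => ?_⟩
  · have h1 := hfix' _ (r'.mapsTo hx)
    have h2 := hψM _ (r'.mapsTo hx)
    rw [r'.inv_apply hx] at h2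
    simp only [Function.comp_apply, h1.1, h1.2, h2, and_self]
  · have h1 := hj x (hN.subset hx)
    rw [hgf₁ x hx, hgf₂ x hx] at h1
    exact congrArg ψ h1

namespace TypeCorr

/-- A uniqueness triple over `S` gives one over `M`, and the unique extension there corresponds to a
unique extension upstairs. Since uniqueness triples are only hypotheses here, the converse transfer
is not needed. -/
theorem weaklyOrthogonal (hs : s.IsGood lam mu) (H : Expandable s.k E mu)
    (hM : IsWitness s.k E M S) {p q : s.k.Typ M} {p' q' : (s.k.adjoin E).Typ S}
    (hp : TypeCorr s.k E p p') (hq : TypeCorr s.k E q q') (h : s.WeaklyOrthogonal p q) :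
    (s.adjoin E).WeaklyOrthogonal p' q' := by
  intro T b hu hb
  have hST : (s.k.adjoin E).le S T := hb.1
  obtain ⟨N, hN⟩ := exists_witness_right hST
  obtain ⟨r, hr, hru⟩ := h N b (hM.isUniqTriple hs H hN hu) ((hq.isTypeOf_iff H hM hN).1 hb).2
  obtain ⟨r', hrr⟩ := exists_up H hN r
  refine ⟨r', (hp.extends_iff H hM hN hST hrr).1 hr, fun t' ht' => ?_⟩
  obtain ⟨t, ht⟩ := hp.of_extends H hM hN ht'
  exact (ht.eq_iff H hN hrr).1 (hru t ((hp.extends_iff H hM hN hST ht).2 ht'))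

theorem orthogonal (hs : s.IsGood lam mu) (H : Expandable s.k E mu)
    (hM : IsWitness s.k E M S) {p q : s.k.Typ M} {p' q' : (s.k.adjoin E).Typ S}
    (hp : TypeCorr s.k E p p') (hq : TypeCorr s.k E q q') (h : s.Orthogonal p q) :
    (s.adjoin E).Orthogonal p' q' := by
  intro S₁ p₁' q₁' hS hp₁' hpn hq₁' hqn
  obtain ⟨M₁, hM₁⟩ := exists_witness_right hS
  obtain ⟨p₁, hp₁⟩ := hp.of_extends H hM hM₁ hp₁'
  obtain ⟨q₁, hq₁⟩ := hq.of_extends H hM hM₁ hq₁'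
  exact hp₁.weaklyOrthogonal hs H hM₁ hq₁ <| h M₁ p₁ q₁ (hM.le_of_le hM₁ hS)
    ((hp.extends_iff H hM hM₁ hS hp₁).2 hp₁') ((hp₁.doesNotFork_iff hs H hM hM₁ hS).1 hpn)
    ((hq.extends_iff H hM hM₁ hS hq₁).2 hq₁') ((hq₁.doesNotFork_iff hs H hM hM₁ hS).1 hqn)

theorem isRegular (hs : s.IsGood lam mu) (H : Expandable s.k E mu)
    (hM : IsWitness s.k E M S) {p : s.k.Typ M} {q : (s.k.adjoin E).Typ S}
    (h : TypeCorr s.k E p q) (hp : s.IsRegular p) : (s.adjoin E).IsRegular q := by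
  refine ⟨(h.mem_bs_iff hs H hM).2 hp.1, fun T r' t' hST hr hqr hrn hqt htn => ?_⟩
  obtain ⟨N, hN⟩ := exists_witness_right hST
  obtain ⟨r, hrr⟩ := h.of_extends H hM hN hqr
  obtain ⟨t, htt⟩ := h.of_extends H hM hN hqt
  exact hrr.orthogonal hs H hN htt <| hp.2 N r t (hM.le_of_le hN hST)
    ((hrr.mem_bs_iff hs H hN).1 hr) ((h.extends_iff H hM hN hST hrr).2 hqr)
    (fun hc => hrn ((hrr.doesNotFork_iff hs H hM hN hST).2 hc))
    ((h.extends_iff H hM hN hST htt).2 hqt) ((htt.doesNotFork_iff hs H hM hN hST).1 htn)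

end TypeCorr

theorem adjoin_hasRegulars (hs : s.IsGood lam mu) (H : Expandable s.k E mu)
    (hr : s.HasRegulars) : (s.adjoin E).HasRegulars := by
  rintro S T ⟨hST, M, N, hM, hN, hMN⟩ hne
  have hle := (hM.le_iff hN).2 ⟨hST, hMN⟩
  obtain ⟨a, haN, haM, p, hp, hreg⟩ := hr M N hMN
    fun h => hne (hM.eq_of_eq H.smooth H.aec hN hST h)
  obtain ⟨q, hq⟩ := TypeCorr.exists_up H hM p
  exact ⟨a, hN.subset haN, fun h => haM ((hM.mem_of_mem hN hST h).2 haN), q,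
    (hq.isTypeOf_iff H hM hN).2 ⟨hle, hp⟩, hq.isRegular hs H hM hreg⟩

theorem numIso_up_adjoin (hs : s.IsGood lam mu) (hE : IsSmooth s.k E) (hsm : IsSmall s.k E)
    (κ : Cardinal.{u}) : ((s.k.adjoin E).up lam).numIso κ = (s.k.up lam).numIso κ := by
  rw [up_adjoin hs.essAEC hs.essAEC_up hE hsm]
  exact numIso_adjoin (upRel_isSmooth hs.essAEC hs.essAEC_up hE)
    (upRel_isSmall hs.essAEC hs.essAEC_up hE hsm) hs.essAEC_up κ

end PrimesRegulars

end EssFrame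

theorem claimb53 {τ : EssFrame.Vocab.{u}} (lam : Cardinal.{u}) (mu : WithTop Cardinal.{u})
    (s : EssFrame.Frame τ) (hs : s.IsGood lam mu)
    (E : EssFrame.SeqRel τ lam) (hE : EssFrame.IsSmooth s.k E) (hsmall : EssFrame.IsSmall s.k E) :
    (s.adjoin E).IsGood lam mu ∧
    (∀ κ : Cardinal.{u}, (s.adjoin E).k.numIso κ = s.k.numIso κ) ∧
    (∀ κ : Cardinal.{u}, ((s.adjoin E).k.up lam).numIso κ = (s.k.up lam).numIso κ) ∧
    (s.HasPrimes → (s.adjoin E).HasPrimes) ∧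
    (s.HasRegulars → (s.adjoin E).HasRegulars) :=
  have H := hs.expandable hE hsmall
  ⟨EssFrame.adjoin_isGood hs hE hsmall, EssFrame.numIso_adjoin hE hsmall hs.essAEC,
    EssFrame.numIso_up_adjoin hs hE hsmall, EssFrame.adjoin_hasPrimes hs H,
    EssFrame.adjoin_hasRegulars hs H⟩
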